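/- Let $k$ be a field of characteristic zero and let $d_1,d_2,d_3\ge 0$ be integers with $d_1+d_2\geq 1$; put $n=d_1+d_2+d_3$ and $\mathbb{A}^n=\mathbb{A}_k^{d_1}\times\mathbb{A}_k^{d_2}\times\mathbb{A}_k^{d_3}$ with coordinates $(x,y,z)$. *Notation.* For a $k$-scheme $S$, $\mathscr{M}^{\mathbb{G}_m}_{S\times\mathbb{G}_m}$ is the colimit over the weights $w\geq 1$ of the Grothendieck groups, localized at $\mathbb{L}=[\mathbb{A}^1]$, of varieties $X\to S\times\mathbb{G}_m$ with a good $\mathbb{G}_m$-action for which $X\to S$ is invariant and $\pi:X\to\mathbb{G}_m$ satisfies $\pi(\lambda\cdot x)=\lambda^w\pi(x)$. The relations are $[X]=[Z]+[X\setminus Z]$ for closed invariant $Z\subset X$, and $[X\times\mathbb{A}^m,\sigma]=\mathbb{L}^m[X]$ for every lifting $\sigma$ of the action on $X$ to an affine action on $X\times\mathbb{A}^m$; the transition map from weight $w$ to weight $rw$ replaces the action of $\lambda$ by that of $\lambda^r$. Write $\mathscr{M}^{\mathbb{G}_m}_{\mathbb{G}_m}$ for $S=\mathrm{Spec}\,k$.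 For $A=\mathscr{M}^{\mathbb{G}_m}_{S\times\mathbb{G}_m}$, $A[[T]]_{sr}$ is the subgroup of $A[[T]]$ generated by the series $a\prod_{i\in I}p_{e_i,j_i}(T)$ with $a\in A$, $I$ finite, $e_i\in\mathbb{Z}$, $j_i\geq 1$ and $p_{e,j}(T)=\mathbb{L}^eT^j/(1-\mathbb{L}^eT^j)$, and $\lim_{T\to\infty}:A[[T]]_{sr}\to A$ is the additive map sending this series to $(-1)^{|I|}a$. For a polynomial $f$ on $\mathbb{A}^N$ with zero locus $X_0(f)$, let $\mathscr{X}_m(f)$ be the space of arcs $\varphi$ of order $m$ in $\mathbb{A}^N$ with $\mathrm{ord}_tf(\varphi)=m$. It lies over $X_0(f)\times\mathbb{G}_m$ by $\varphi\mapsto(\varphi(0),\text{coefficient of }t^m\text{ in }f(\varphi))$ and carries the action $(\lambda\cdot\varphi)(t)=\varphi(\lambda t)$. Put $$Z_f(T)=\sum_{m\geq1}[\mathscr{X}_m(f)]\,\mathbb{L}^{-mN}T^m,\qquad \mathcal{S}_f=-\lim_{T\to\infty}Z_f(T)\in\mathscr{M}^{\mathbb{G}_m}_{X_0(f)\times\mathbb{G}_m}.$$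 If $f(0)=0$, let $\mathcal{S}_{f,0}\in\mathscr{M}^{\mathbb{G}_m}_{\mathbb{G}_m}$ be the pullback of $\mathcal{S}_f$ along $\{0\}\hookrightarrow X_0(f)$. *Hypotheses.* Let $g\in k[x,y,z]$ satisfy $g(0,0,0)=0$ and $g(tx,t^{-1}y,z)=g(x,y,z)$ for all $t\in\mathbb{G}_m$ and all $(x,y,z)\in\mathbb{A}^n$. Let $\Gamma$ be the Newton polyhedron of $g$, the convex hull of $\mathrm{supp}(g)+\mathbb{R}_{\geq0}^n$. Assume that $g$ is nondegenerate with respect to $\Gamma$: for every (nonempty) compact face $\gamma$ of $\Gamma$, the function $g_\gamma=\sum_{\alpha\in\gamma}a_\alpha x^\alpha$, where $a_\alpha$ are the coefficients of $g$, is smooth (has no critical point over an algebraic closure of $k$) on $\mathbb{G}_m^n$. Assume moreover that no vertex of $\Gamma$ lies in a coordinate plane (all coordinates of every vertex are nonzero). *Conclusion.* Then $g(x,0,0)=0$, so that there is an inclusion $i_1:\mathbb{A}^{d_1}\hookrightarrow X_0(g)$, $x\mapsto(x,0,0)$. Write $\int_{\mathbb{A}^{d_1}}:\mathscr{M}^{\mathbb{G}_m}_{\mathbb{A}^{d_1}\times\mathbb{G}_m}\to\mathscr{M}^{\mathbb{G}_m}_{\mathbb{G}_m}$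 for the pushforward. The series $\int_{\mathbb{A}^{d_1}}i_1^*Z_g(T)$ belongs to $\mathscr{M}^{\mathbb{G}_m}_{\mathbb{G}_m}[[T]]_{sr}$ and its limit for $T\to\infty$ is $0$; in particular $$\int_{\mathbb{A}^{d_1}}i_1^*\mathcal{S}_g=0\quad\text{in }\mathscr{M}^{\mathbb{G}_m}_{\mathbb{G}_m}.$$ Moreover $h(z):=g(0,0,z)$ is the zero polynomial, and the Kontsevich–Soibelman identity $\int_{\mathbb{A}^{d_1}}i_1^*\mathcal{S}_g=\mathbb{L}^{d_1}\mathcal{S}_{h,0}$ holds. -/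

import Mathlib

open CategoryTheory AlgebraicGeometry
open scoped LaurentPolynomial

universe u

noncomputable section

namespace MotivicMilnor

/-! ### Schemes over `k`, global functions, actions of the multiplicative group -/

/-- The category of `k`-schemes. -/
abbrev KSch (k : Type u) [Field k] : Type (u + 1) :=
  Over (Spec (CommRingCat.of k))

section Basics

variable {k : Type u} [Field k]

/-- The ring of global functions of a `k`-scheme. -/
abbrev Fun (X : KSch k) : Type u := Γ(X.left, ⊤)

/-- Pullback of global functions along a morphism of `k`-schemes. -/
def pull {X Y : KSch k} (f : X ⟶ Y) : Fun Y →+* Fun X := f.left.appTop.hom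

/-- Pullback of invertible global functions. -/
def pullU {X Y : KSch k} (f : X ⟶ Y) : (Fun Y)ˣ →* (Fun X)ˣ := Units.map (pull f).toMonoidHom

lemma pull_comp {X Y Z : KSch k} (f : X ⟶ Y) (g : Y ⟶ Z) (a : Fun Z) :
    pull (f ≫ g) a = pull f (pull g a) := by
  change (f.left ≫ g.left).appTop.hom a = _
  rw [Scheme.Hom.comp_appTop]
  rfl

lemma pull_id {X : KSch k} (a : Fun X) : pull (𝟙 X) a = a := by
  simp [pull]

lemma pullU_comp {X Y Z : KSch k} (f : X ⟶ Y) (g : Y ⟶ Z) (a : (Fun Z)ˣ) :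
    pullU (f ≫ g) a = pullU f (pullU g a) :=
  Units.ext (pull_comp f g a)

/-- An action of the multiplicative group `𝔾ₘ` on a `k`-scheme `X`, given on `T`-valued points,
naturally in the `k`-scheme `T`: the group `𝔾ₘ(T)` of invertible functions on `T` acts on the set
`X(T)` of morphisms `T ⟶ X`. By the Yoneda lemma this is the same as an action morphism
`𝔾ₘ × X ⟶ X`. -/
structure GmAction (X : KSch k) where
  smul : ∀ {T : KSch k}, (Fun T)ˣ → (T ⟶ X) → (T ⟶ X)
  one_smul : ∀ {T : KSch k} (x : T ⟶ X), smul 1 x = x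
  mul_smul : ∀ {T : KSch k} (a b : (Fun T)ˣ) (x : T ⟶ X), smul (a * b) x = smul a (smul b x)
  natural : ∀ {T T' : KSch k} (f : T' ⟶ T) (a : (Fun T)ˣ) (x : T ⟶ X),
    f ≫ smul a x = smul (pullU f a) (f ≫ x)

/-- An action is good if every orbit is contained in an affine open subset. The orbit of a
point `x` consists of all points `(a • p) s`, where `p : T ⟶ X` is a `T`-valued point with
`p s = x` and `a` is an invertible function on `T`. -/
def GmAction.IsGood {X : KSch k} (σ : GmAction X) : Prop :=
  ∀ x : X.left, ∃ U : X.left.Opens, IsAffineOpen U ∧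
    ∀ (T : KSch k) (p : T ⟶ X) (a : (Fun T)ˣ) (s : T.left),
      p.left s = x → (σ.smul a p).left s ∈ U

/-- A variety over `S × 𝔾ₘ` with a good `𝔾ₘ`-action: a separated `k`-scheme `X` of finite type
with a good action of `𝔾ₘ`, a morphism `X ⟶ S × 𝔾ₘ`, that is a morphism `toBase : X ⟶ S` and an
invertible function `toGm` on `X`, such that `toBase` is invariant and `toGm` is diagonally
monomial of some weight `n > 0`, that is `toGm (a • x) = a ^ n * toGm x`.
(Nilpotents are allowed; they do not change the Grothendieck group, since `X` and its reduction
have the same class by the scissor relation below.) -/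
structure GmVar (S : KSch k) where
  X : KSch k
  separated : IsSeparated X.hom
  locallyOfFiniteType : LocallyOfFiniteType X.hom
  quasiCompact : QuasiCompact X.hom
  act : GmAction X
  good : act.IsGood
  toBase : X ⟶ S
  toGm : (Fun X)ˣ
  weight : ℕ
  weight_pos : 0 < weight
  invariant : ∀ {T : KSch k} (a : (Fun T)ˣ) (x : T ⟶ X), act.smul a x ≫ toBase = x ≫ toBase
  monomial : ∀ {T : KSch k} (a : (Fun T)ˣ) (x : T ⟶ X),
    pullU (act.smul a x) toGm = a ^ weight * pullU x toGm

/-- Equivariant morphisms over `S × 𝔾ₘ` (between objects of the same weight). -/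
structure GmVar.Hom {S : KSch k} (Y X : GmVar S) where
  hom : Y.X ⟶ X.X
  weight_eq : Y.weight = X.weight
  equivariant : ∀ {T : KSch k} (a : (Fun T)ˣ) (y : T ⟶ Y.X),
    Y.act.smul a y ≫ hom = X.act.smul a (y ≫ hom)
  over_base : hom ≫ X.toBase = Y.toBase
  over_gm : pullU hom X.toGm = Y.toGm

/-- The functions `v₁, …, vₘ` identify `Y` with `X × 𝔸ᵐ`, with `p` as the first projection, and
the action on `Y`, which lifts the action on `X` because `p` is equivariant, is affine: for all
`a` and `x` it maps the fibre over `x` to the fibre over `a • x` by an affine map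
`v ↦ A v + b`. -/
structure IsAffineLift {S : KSch k} {Y X : GmVar S} (p : Y.Hom X) {m : ℕ}
    (v : Fin m → Fun Y.X) : Prop where
  bijective : ∀ T : KSch k, Function.Bijective
    (fun y : T ⟶ Y.X => ((y ≫ p.hom, fun i => pull y (v i)) : (T ⟶ X.X) × (Fin m → Fun T)))
  affine : ∀ (T : KSch k) (a : (Fun T)ˣ) (x : T ⟶ X.X),
    ∃ (A : Matrix (Fin m) (Fin m) (Fun T)) (b : Fin m → Fun T), ∀ y : T ⟶ Y.X, y ≫ p.hom = x →
      (fun i => pull (Y.act.smul a y) (v i)) = A.mulVec (fun i => pull y (v i)) + b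

/-- The object of weight `r * n` obtained from an object of weight `n` by letting `a` act as
`a ^ r`. -/
def GmVar.rescale {S : KSch k} (X : GmVar S) (r : ℕ) (hr : 0 < r) : GmVar S where
  X := X.X
  separated := X.separated
  locallyOfFiniteType := X.locallyOfFiniteType
  quasiCompact := X.quasiCompact
  act :=
    { smul := fun a x => X.act.smul (a ^ r) x
      one_smul := fun x => by rw [one_pow, X.act.one_smul]
      mul_smul := fun a b x => by rw [mul_pow, X.act.mul_smul]
      natural := fun f a x => by rw [X.act.natural, map_pow] }
  good := fun x => by
    obtain ⟨U, hU, h⟩ := X.good x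
    exact ⟨U, hU, fun T p a s hs => h T p (a ^ r) s hs⟩
  toBase := X.toBase
  toGm := X.toGm
  weight := r * X.weight
  weight_pos := Nat.mul_pos hr X.weight_pos
  invariant := fun a x => X.invariant (a ^ r) x
  monomial := fun a x => by rw [X.monomial, pow_mul]

/-! ### The localized Grothendieck group -/

/-- The relations of `𝓜_S`. The generator `(X, e)` stands for `[X] 𝕃ᵉ`. -/
inductive MotRel {S : KSch k} : FreeAbelianGroup (GmVar S × ℤ) → Prop
  /-- `[X] = [Z] + [U]` for a closed invariant `Z` in `X` with complement `U`. -/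
  | scissor (X Z U : GmVar S) (i : Z.Hom X) (j : U.Hom X) (hi : IsClosedImmersion i.hom.left)
      (hj : IsOpenImmersion j.hom.left)
      (hij : Set.range j.hom.left = (Set.range i.hom.left)ᶜ) (e : ℤ) :
      MotRel (FreeAbelianGroup.of (X, e) - FreeAbelianGroup.of (Z, e) - FreeAbelianGroup.of (U, e))
  /-- `[X × 𝔸ᵐ] = [X] 𝕃ᵐ` for every lifting of the action of `X` to an affine action on
  `X × 𝔸ᵐ`; in particular `[X × 𝔸ᵐ]` does not depend on the lifting. For `m = 0` this says that
  isomorphic objects have the same class. -/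
  | affine (X Y : GmVar S) (p : Y.Hom X) (m : ℕ) (v : Fin m → Fun Y.X) (h : IsAffineLift p v)
      (e : ℤ) : MotRel (FreeAbelianGroup.of (Y, e) - FreeAbelianGroup.of (X, e + m))
  /-- The transition maps of the colimit over all weights. -/
  | rescale (X : GmVar S) (r : ℕ) (hr : 0 < r) (e : ℤ) :
      MotRel (FreeAbelianGroup.of (X.rescale r hr, e) - FreeAbelianGroup.of (X, e))

/-- The additive group of `𝓜_{S × 𝔾ₘ}^{𝔾ₘ}`: the colimit over the weights `n` of the Grothendieck
groups of varieties over `S × 𝔾ₘ` with good `𝔾ₘ`-action, diagonally monomial of weight `n`,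
localized at the class `𝕃` of the affine line. -/
def Mot (S : KSch k) : Type (u + 1) :=
  FreeAbelianGroup (GmVar S × ℤ) ⧸ AddSubgroup.closure {x | MotRel (S := S) x}

instance (S : KSch k) : AddCommGroup (Mot S) :=
  inferInstanceAs (AddCommGroup (FreeAbelianGroup (GmVar S × ℤ) ⧸ AddSubgroup.closure _))

/-- The element `[X] 𝕃ᵉ`. -/
def Mot.cls {S : KSch k} (X : GmVar S) (e : ℤ) : Mot S :=
  QuotientAddGroup.mk (FreeAbelianGroup.of (X, e))

/-- Additive maps out of `𝓜_S` are given by their values on the elements `[X] 𝕃ᵉ`. -/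
def Mot.lift {S : KSch k} {M : Type*} [AddCommGroup M] (F : GmVar S × ℤ → M)
    (hF : ∀ x, MotRel (S := S) x → FreeAbelianGroup.lift F x = 0) : Mot S →+ M :=
  QuotientAddGroup.lift _ (FreeAbelianGroup.lift F) (by
    rw [AddSubgroup.closure_le]
    exact hF)

@[simp] lemma Mot.lift_cls {S : KSch k} {M : Type*} [AddCommGroup M] (F : GmVar S × ℤ → M)
    (hF : ∀ x, MotRel (S := S) x → FreeAbelianGroup.lift F x = 0) (X : GmVar S) (e : ℤ) :
    Mot.lift F hF (Mot.cls X e) = F (X, e) :=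
  FreeAbelianGroup.lift_apply_of F (X, e)

lemma Mot.eq_zero_of_rel {S : KSch k} {x : FreeAbelianGroup (GmVar S × ℤ)} (h : MotRel x) :
    (QuotientAddGroup.mk x : Mot S) = 0 :=
  (QuotientAddGroup.eq_zero_iff x).2 (AddSubgroup.subset_closure h)

lemma Mot.cls_scissor {S : KSch k} (X Z U : GmVar S) (i : Z.Hom X) (j : U.Hom X)
    (hi : IsClosedImmersion i.hom.left) (hj : IsOpenImmersion j.hom.left)
    (hij : Set.range j.hom.left = (Set.range i.hom.left)ᶜ) (e : ℤ) :
    Mot.cls X e - Mot.cls Z e - Mot.cls U e = 0 :=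
  Mot.eq_zero_of_rel (MotRel.scissor X Z U i j hi hj hij e)

lemma Mot.cls_affine {S : KSch k} (X Y : GmVar S) (p : Y.Hom X) (m : ℕ) (v : Fin m → Fun Y.X)
    (h : IsAffineLift p v) (e : ℤ) : Mot.cls Y e - Mot.cls X (e + m) = 0 :=
  Mot.eq_zero_of_rel (MotRel.affine X Y p m v h e)

lemma Mot.cls_rescale {S : KSch k} (X : GmVar S) (r : ℕ) (hr : 0 < r) (e : ℤ) :
    Mot.cls (X.rescale r hr) e - Mot.cls X e = 0 :=
  Mot.eq_zero_of_rel (MotRel.rescale X r hr e)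

/-- Multiplication by `𝕃ⁿ`. -/
def Mot.shift (S : KSch k) (n : ℤ) : Mot S →+ Mot S :=
  Mot.lift (fun p => Mot.cls p.1 (p.2 + n)) (by
    rintro x (⟨X, Z, U, i, j, hi, hj, hij, e⟩ | ⟨X, Y, p, m, v, h, e⟩ | ⟨X, r, hr, e⟩)
    · simpa using Mot.cls_scissor X Z U i j hi hj hij (e + n)
    · simpa [add_right_comm] using Mot.cls_affine X Y p m v h (e + n)
    · simpa using Mot.cls_rescale X r hr (e + n))

lemma Mot.hom_ext {S : KSch k} {M : Type*} [AddCommGroup M] {f g : Mot S →+ M}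
    (h : ∀ X e, f (Mot.cls X e) = g (Mot.cls X e)) : f = g := by
  refine QuotientAddGroup.addMonoidHom_ext _ (FreeAbelianGroup.lift_ext _ _ ?_)
  rintro ⟨X, e⟩
  exact h X e

/-- The powers of `𝕃` acting on `𝓜_S`. -/
def Mot.shiftHom (S : KSch k) : Multiplicative ℤ →* AddMonoid.End (Mot S) where
  toFun n := Mot.shift S n.toAdd
  map_one' := Mot.hom_ext fun X e => by
    change Mot.shift S 0 (Mot.cls X e) = Mot.cls X e
    simp [Mot.shift]
  map_mul' a b := Mot.hom_ext fun X e => by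
    change Mot.shift S (a.toAdd + b.toAdd) (Mot.cls X e) =
      Mot.shift S a.toAdd (Mot.shift S b.toAdd (Mot.cls X e))
    simp [Mot.shift, add_comm, add_left_comm]

/-- `𝓜_S` is a module over `ℤ[𝕃, 𝕃⁻¹]`, with `𝕃ⁿ · ([X] 𝕃ᵉ) = [X] 𝕃ᵉ⁺ⁿ`. -/
instance (S : KSch k) : Module ℤ[T;T⁻¹] (Mot S) :=
  Module.compHom (Mot S)
    (AddMonoidAlgebra.lift ℤ (AddMonoid.End (Mot S)) ℤ (Mot.shiftHom S)).toRingHom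

lemma Mot.T_smul_cls {S : KSch k} (X : GmVar S) (n e : ℤ) :
    (LaurentPolynomial.T n : ℤ[T;T⁻¹]) • Mot.cls X e = Mot.cls X (e + n) := by
  change (AddMonoidAlgebra.lift ℤ (AddMonoid.End (Mot S)) ℤ (Mot.shiftHom S))
    (LaurentPolynomial.T n) (Mot.cls X e) = _
  rw [LaurentPolynomial.T, AddMonoidAlgebra.lift_single, one_smul]
  change Mot.shift S n (Mot.cls X e) = _
  simp [Mot.shift]

/-! ### Pushforward and pullback -/

/-- The pushforward `f_!` of an object: compose with `f : S ⟶ S'`. -/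
def GmVar.pushforward {S S' : KSch k} (f : S ⟶ S') (X : GmVar S) : GmVar S' where
  X := X.X
  separated := X.separated
  locallyOfFiniteType := X.locallyOfFiniteType
  quasiCompact := X.quasiCompact
  act := X.act
  good := X.good
  toBase := X.toBase ≫ f
  toGm := X.toGm
  weight := X.weight
  weight_pos := X.weight_pos
  invariant := fun a x => by rw [← Category.assoc, X.invariant, Category.assoc]
  monomial := X.monomial

def GmVar.Hom.pushforward {S S' : KSch k} (f : S ⟶ S') {Y X : GmVar S} (p : Y.Hom X) :
    (Y.pushforward f).Hom (X.pushforward f) where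
  hom := p.hom
  weight_eq := p.weight_eq
  equivariant := p.equivariant
  over_base := by
    change p.hom ≫ X.toBase ≫ f = Y.toBase ≫ f
    rw [← Category.assoc, p.over_base]
  over_gm := p.over_gm

/-- The pushforward `f_! : 𝓜_{S × 𝔾ₘ}^{𝔾ₘ} ⟶ 𝓜_{S' × 𝔾ₘ}^{𝔾ₘ}` along `f : S ⟶ S'`. -/
def Mot.pushforward {S S' : KSch k} (f : S ⟶ S') : Mot S →+ Mot S' :=
  Mot.lift (fun p => Mot.cls (p.1.pushforward f) p.2) (by
    rintro x (⟨X, Z, U, i, j, hi, hj, hij, e⟩ | ⟨X, Y, p, m, v, h, e⟩ | ⟨X, r, hr, e⟩)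
    · simpa using Mot.cls_scissor _ _ _ (i.pushforward f) (j.pushforward f) hi hj hij e
    · simpa using Mot.cls_affine _ _ (p.pushforward f) m v ⟨h.bijective, h.affine⟩ e
    · simpa using (show Mot.cls ((X.rescale r hr).pushforward f) e - Mot.cls (X.pushforward f) e = 0
        from Mot.cls_rescale (X.pushforward f) r hr e))

/-- The fibre product `X ×_S S'` as a `k`-scheme. -/
def pbX {S S' : KSch k} (f : S' ⟶ S) (X : GmVar S) : KSch k :=
  Over.mk (Limits.pullback.fst X.toBase.left f.left ≫ X.X.hom)

/-- The first projection `X ×_S S' ⟶ X`. -/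
def pbFst {S S' : KSch k} (f : S' ⟶ S) (X : GmVar S) : pbX f X ⟶ X.X :=
  Over.homMk (Limits.pullback.fst X.toBase.left f.left) rfl

lemma pb_hom_eq {S S' : KSch k} (f : S' ⟶ S) (X : GmVar S) :
    Limits.pullback.snd X.toBase.left f.left ≫ S'.hom =
      Limits.pullback.fst X.toBase.left f.left ≫ X.X.hom := by
  rw [← Over.w f, ← Over.w X.toBase, Limits.pullback.condition_assoc]

/-- The second projection `X ×_S S' ⟶ S'`. -/
def pbSnd {S S' : KSch k} (f : S' ⟶ S) (X : GmVar S) : pbX f X ⟶ S' :=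
  Over.homMk (Limits.pullback.snd X.toBase.left f.left) (pb_hom_eq f X)

lemma pb_condition {S S' : KSch k} (f : S' ⟶ S) (X : GmVar S) :
    pbFst f X ≫ X.toBase = pbSnd f X ≫ f :=
  Over.OverMorphism.ext Limits.pullback.condition

lemma pb_isPullback {S S' : KSch k} (f : S' ⟶ S) (X : GmVar S) :
    IsPullback (pbFst f X).left (pbSnd f X).left X.toBase.left f.left :=
  IsPullback.of_hasPullback _ _

lemma pb_ext {S S' : KSch k} (f : S' ⟶ S) (X : GmVar S) {T : KSch k} {x y : T ⟶ pbX f X}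
    (h1 : x ≫ pbFst f X = y ≫ pbFst f X) (h2 : x ≫ pbSnd f X = y ≫ pbSnd f X) : x = y :=
  Over.OverMorphism.ext (Limits.pullback.hom_ext
    (congrArg CommaMorphism.left h1) (congrArg CommaMorphism.left h2))

/-- The universal property of `X ×_S S'`. -/
def pbLift {S S' : KSch k} (f : S' ⟶ S) (X : GmVar S) {T : KSch k} (a : T ⟶ X.X) (b : T ⟶ S')
    (h : a ≫ X.toBase = b ≫ f) : T ⟶ pbX f X :=
  Over.homMk (Limits.pullback.lift a.left b.left (congrArg CommaMorphism.left h))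
    ((Limits.pullback.lift_fst_assoc _ _ _ _).trans (Over.w a))

@[simp] lemma pbLift_fst {S S' : KSch k} (f : S' ⟶ S) (X : GmVar S) {T : KSch k}
    (a : T ⟶ X.X) (b : T ⟶ S') (h : a ≫ X.toBase = b ≫ f) : pbLift f X a b h ≫ pbFst f X = a :=
  Over.OverMorphism.ext (Limits.pullback.lift_fst _ _ _)

@[simp] lemma pbLift_snd {S S' : KSch k} (f : S' ⟶ S) (X : GmVar S) {T : KSch k}
    (a : T ⟶ X.X) (b : T ⟶ S') (h : a ≫ X.toBase = b ≫ f) : pbLift f X a b h ≫ pbSnd f X = b :=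
  Over.OverMorphism.ext (Limits.pullback.lift_snd _ _ _)

/-- The action on the first factor of `X ×_S S'`. -/
def pbAct {S S' : KSch k} (f : S' ⟶ S) (X : GmVar S) : GmAction (pbX f X) where
  smul a x := pbLift f X (X.act.smul a (x ≫ pbFst f X)) (x ≫ pbSnd f X) (by
    rw [X.invariant, Category.assoc, pb_condition, Category.assoc])
  one_smul x := pb_ext f X (by simp [X.act.one_smul]) (by simp)
  mul_smul a b x := pb_ext f X (by simp [X.act.mul_smul]) (by simp)
  natural g a x := pb_ext f X (by simp [X.act.natural]) (by simp)

lemma pbAct_fst {S S' : KSch k} (f : S' ⟶ S) (X : GmVar S) {T : KSch k} (a : (Fun T)ˣ)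
    (x : T ⟶ pbX f X) : (pbAct f X).smul a x ≫ pbFst f X = X.act.smul a (x ≫ pbFst f X) := by
  simp [pbAct]

lemma pbAct_snd {S S' : KSch k} (f : S' ⟶ S) (X : GmVar S) {T : KSch k} (a : (Fun T)ˣ)
    (x : T ⟶ pbX f X) : (pbAct f X).smul a x ≫ pbSnd f X = x ≫ pbSnd f X := by
  simp [pbAct]

/-- The base change `X ×_S S'` of an object, with the action on the first factor. -/
def GmVar.pullback {S S' : KSch k} (f : S' ⟶ S) [IsAffineHom f.left]
    [LocallyOfFiniteType f.left] (X : GmVar S) : GmVar S' where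
  X := pbX f X
  separated := by
    have := X.separated
    have : IsAffineHom (pbFst f X).left :=
      MorphismProperty.of_isPullback (pb_isPullback f X).flip inferInstance
    exact inferInstanceAs (IsSeparated ((pbFst f X).left ≫ X.X.hom))
  locallyOfFiniteType := by
    have := X.locallyOfFiniteType
    exact inferInstanceAs
      (LocallyOfFiniteType (Limits.pullback.fst X.toBase.left f.left ≫ X.X.hom))
  quasiCompact := by
    have := X.quasiCompact
    exact inferInstanceAs (QuasiCompact (Limits.pullback.fst X.toBase.left f.left ≫ X.X.hom))
  act := pbAct f X
  good := fun x => by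
    obtain ⟨U, hU, h⟩ := X.good ((pbFst f X).left x)
    have : IsAffineHom (pbFst f X).left :=
      MorphismProperty.of_isPullback (pb_isPullback f X).flip inferInstance
    refine ⟨(pbFst f X).left ⁻¹ᵁ U, hU.preimage _, fun T p a s hs => ?_⟩
    have h2 := h T (p ≫ pbFst f X) a s (by simp [hs])
    rw [← pbAct_fst] at h2
    exact h2
  toBase := pbSnd f X
  toGm := pullU (pbFst f X) X.toGm
  weight := X.weight
  weight_pos := X.weight_pos
  invariant := fun a x => pbAct_snd f X a x
  monomial := fun a x => by
    rw [← pullU_comp, ← pullU_comp, pbAct_fst, X.monomial]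

/-- The base change of an equivariant morphism, on underlying schemes. -/
def pbMap {S S' : KSch k} (f : S' ⟶ S) {Y X : GmVar S} (p : Y.Hom X) : pbX f Y ⟶ pbX f X :=
  pbLift f X (pbFst f Y ≫ p.hom) (pbSnd f Y) (by
    rw [Category.assoc, p.over_base, pb_condition])

lemma pbMap_fst {S S' : KSch k} (f : S' ⟶ S) {Y X : GmVar S} (p : Y.Hom X) :
    pbMap f p ≫ pbFst f X = pbFst f Y ≫ p.hom :=
  pbLift_fst _ _ _ _ _

lemma pbMap_snd {S S' : KSch k} (f : S' ⟶ S) {Y X : GmVar S} (p : Y.Hom X) :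
    pbMap f p ≫ pbSnd f X = pbSnd f Y :=
  pbLift_snd _ _ _ _ _

lemma pbMap_isPullback {S S' : KSch k} (f : S' ⟶ S) {Y X : GmVar S} (p : Y.Hom X) :
    IsPullback (pbFst f Y).left (pbMap f p).left p.hom.left (pbFst f X).left := by
  have e1 : (pbMap f p).left ≫ (pbSnd f X).left = (pbSnd f Y).left :=
    congrArg CommaMorphism.left (pbMap_snd f p)
  have e2 : p.hom.left ≫ X.toBase.left = Y.toBase.left :=
    congrArg CommaMorphism.left p.over_base
  have e3 : (pbMap f p).left ≫ (pbFst f X).left = (pbFst f Y).left ≫ p.hom.left :=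
    congrArg CommaMorphism.left (pbMap_fst f p)
  have hY := pb_isPullback f Y
  rw [← e1, ← e2] at hY
  exact IsPullback.of_bot hY e3.symm (pb_isPullback f X)

def GmVar.Hom.pullback {S S' : KSch k} (f : S' ⟶ S) [IsAffineHom f.left]
    [LocallyOfFiniteType f.left] {Y X : GmVar S} (p : Y.Hom X) :
    (Y.pullback f).Hom (X.pullback f) where
  hom := pbMap f p
  weight_eq := p.weight_eq
  equivariant := fun {T} a (y : T ⟶ pbX f Y) => pb_ext f X
    (show ((pbAct f Y).smul a y ≫ pbMap f p) ≫ pbFst f X =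
        (pbAct f X).smul a (y ≫ pbMap f p) ≫ pbFst f X by
      rw [pbAct_fst, Category.assoc, Category.assoc, pbMap_fst, ← Category.assoc, pbAct_fst,
        p.equivariant, Category.assoc])
    (show ((pbAct f Y).smul a y ≫ pbMap f p) ≫ pbSnd f X =
        (pbAct f X).smul a (y ≫ pbMap f p) ≫ pbSnd f X by
      rw [pbAct_snd, Category.assoc, Category.assoc, pbMap_snd, pbAct_snd])
  over_base := pbMap_snd f p
  over_gm := by
    change pullU (pbMap f p) (pullU (pbFst f X) X.toGm) = pullU (pbFst f Y) Y.toGm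
    rw [← pullU_comp, pbMap_fst, pullU_comp, p.over_gm]

lemma IsAffineLift.pullback {S S' : KSch k} (f : S' ⟶ S) [IsAffineHom f.left]
    [LocallyOfFiniteType f.left] {Y X : GmVar S} {p : Y.Hom X} {m : ℕ} {v : Fin m → Fun Y.X}
    (h : IsAffineLift p v) : IsAffineLift (p.pullback f) (fun i => pull (pbFst f Y) (v i)) where
  bijective T := by
    constructor
    · intro (y : T ⟶ pbX f Y) (z : T ⟶ pbX f Y) hyz
      obtain ⟨h1, h2⟩ := Prod.mk.inj hyz
      have h1' : y ≫ pbMap f p = z ≫ pbMap f p := h1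
      refine pb_ext f Y ((h.bijective T).1 (Prod.ext ?_ ?_)) ?_
      · change (y ≫ pbFst f Y) ≫ p.hom = (z ≫ pbFst f Y) ≫ p.hom
        rw [Category.assoc, Category.assoc, ← pbMap_fst, ← Category.assoc, h1', Category.assoc]
      · funext i
        have := congrFun h2 i
        change pull (y ≫ pbFst f Y) (v i) = pull (z ≫ pbFst f Y) (v i)
        rw [pull_comp, pull_comp]
        exact this
      · rw [← pbMap_snd f p, ← Category.assoc, h1', Category.assoc]
    · rintro ⟨(x : T ⟶ pbX f X), w⟩
      obtain ⟨y, hy⟩ := (h.bijective T).2 (x ≫ pbFst f X, w)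
      obtain ⟨h1, h2⟩ := Prod.mk.inj hy
      have hy2 : y ≫ Y.toBase = (x ≫ pbSnd f X) ≫ f := by
        rw [← p.over_base, ← Category.assoc, h1, Category.assoc, pb_condition, Category.assoc]
      refine ⟨pbLift f Y y (x ≫ pbSnd f X) hy2, Prod.ext ?_ ?_⟩
      · refine pb_ext f X ?_ ?_
        · change (pbLift f Y y (x ≫ pbSnd f X) hy2 ≫ pbMap f p) ≫ pbFst f X = _
          rw [Category.assoc, pbMap_fst, ← Category.assoc, pbLift_fst, h1]
        · change (pbLift f Y y (x ≫ pbSnd f X) hy2 ≫ pbMap f p) ≫ pbSnd f X = _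
          rw [Category.assoc, pbMap_snd, pbLift_snd]
      · funext i
        change pull (pbLift f Y y (x ≫ pbSnd f X) hy2) (pull (pbFst f Y) (v i)) = w i
        rw [← pull_comp, pbLift_fst]
        exact congrFun h2 i
  affine T a (x : T ⟶ pbX f X) := by
    obtain ⟨A, b, hA⟩ := h.affine T a (x ≫ pbFst f X)
    refine ⟨A, b, fun (y : T ⟶ pbX f Y) (hy : y ≫ pbMap f p = x) => ?_⟩
    have := hA (y ≫ pbFst f Y) (by rw [Category.assoc, ← pbMap_fst, ← Category.assoc, hy])
    change (fun i => pull ((pbAct f Y).smul a y) (pull (pbFst f Y) (v i))) =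
      A.mulVec (fun i => pull y (pull (pbFst f Y) (v i))) + b
    simpa only [← pull_comp, pbAct_fst] using this

lemma range_pbMap {S S' : KSch k} (f : S' ⟶ S) {Y X : GmVar S} (p : Y.Hom X) :
    Set.range (pbMap f p).left = (pbFst f X).left ⁻¹' Set.range p.hom.left := by
  have h := pbMap_isPullback f p
  rw [← Scheme.Pullback.range_snd, ← h.isoPullback_hom_snd, Scheme.Hom.comp_base, TopCat.coe_comp]
  exact (h.isoPullback.hom.surjective.range_comp _)

/-- The pullback `f^* : 𝓜_{S × 𝔾ₘ}^{𝔾ₘ} ⟶ 𝓜_{S' × 𝔾ₘ}^{𝔾ₘ}` along an affine morphism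
`f : S' ⟶ S` of finite type, given by `[X] ↦ [X ×_S S']`. -/
def Mot.pullback {S S' : KSch k} (f : S' ⟶ S) [IsAffineHom f.left]
    [LocallyOfFiniteType f.left] : Mot S →+ Mot S' :=
  Mot.lift (fun p => Mot.cls (p.1.pullback f) p.2) (by
    rintro x (⟨X, Z, U, i, j, hi, hj, hij, e⟩ | ⟨X, Y, p, m, v, h, e⟩ | ⟨X, r, hr, e⟩)
    · have hi' : IsClosedImmersion (pbMap f i).left :=
        MorphismProperty.of_isPullback (pbMap_isPullback f i) hi
      have hj' : IsOpenImmersion (pbMap f j).left :=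
        MorphismProperty.of_isPullback (pbMap_isPullback f j) hj
      have hij' : Set.range (pbMap f j).left = (Set.range (pbMap f i).left)ᶜ := by
        rw [range_pbMap, range_pbMap, hij, Set.preimage_compl]
      simpa using Mot.cls_scissor _ _ _ (i.pullback f) (j.pullback f) hi' hj' hij' e
    · simpa using Mot.cls_affine _ _ (p.pullback f) m _ (h.pullback f) e
    · simpa using (show Mot.cls ((X.rescale r hr).pullback f) e - Mot.cls (X.pullback f) e = 0
        from Mot.cls_rescale (X.pullback f) r hr e))

/-! ### Affine schemes -/

/-- The affine `k`-scheme `Spec A`. -/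
def SpecK (k : Type u) [Field k] (A : Type u) [CommRing A] [Algebra k A] : KSch k :=
  Over.mk (Spec.map (CommRingCat.ofHom (algebraMap k A)))

/-- The morphism `Spec B ⟶ Spec A` given by a homomorphism of `k`-algebras `A ⟶ B`. -/
def SpecK.map {A B : Type u} [CommRing A] [Algebra k A] [CommRing B] [Algebra k B]
    (φ : A →ₐ[k] B) : SpecK k B ⟶ SpecK k A :=
  Over.homMk (Spec.map (CommRingCat.ofHom φ.toRingHom)) (by
    change Spec.map _ ≫ Spec.map _ = Spec.map _
    rw [← Spec.map_comp, ← CommRingCat.ofHom_comp]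
    congr 2
    exact φ.comp_algebraMap)

instance {A B : Type u} [CommRing A] [Algebra k A] [CommRing B] [Algebra k B]
    (φ : A →ₐ[k] B) : IsAffineHom (SpecK.map φ).left :=
  inferInstanceAs (IsAffineHom (Spec.map (CommRingCat.ofHom φ.toRingHom)))

lemma SpecK.map_finiteType {A B : Type u} [CommRing A] [Algebra k A] [CommRing B] [Algebra k B]
    (φ : A →ₐ[k] B) (h : φ.FiniteType) : LocallyOfFiniteType (SpecK.map φ).left :=
  (HasRingHomProperty.Spec_iff (P := @LocallyOfFiniteType)).2 h

instance {A B : Type u} [CommRing A] [Algebra k A] [CommRing B] [Algebra k B]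
    [Algebra.FiniteType k B] (φ : A →ₐ[k] B) : LocallyOfFiniteType (SpecK.map φ).left :=
  SpecK.map_finiteType φ (AlgHom.FiniteType.of_comp_finiteType (f := Algebra.ofId k A) (by
    have h : φ.comp (Algebra.ofId k A) = Algebra.ofId k B := Subsingleton.elim _ _
    rw [h]
    exact (RingHom.finiteType_algebraMap (A := k) (B := B)).2 inferInstance))

lemma specIso_inv_comp {X : Scheme.{u}} {A B : CommRingCat.{u}} (φ : A ⟶ B) (x : X ⟶ Spec B) :
    (Scheme.ΓSpecIso A).inv ≫ (x ≫ Spec.map φ).appTop =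
      φ ≫ (Scheme.ΓSpecIso B).inv ≫ x.appTop := by
  rw [Scheme.Hom.comp_appTop, ← Scheme.ΓSpecIso_inv_naturality_assoc]

lemma specIso_inv_toSpecΓ {X : Scheme.{u}} {A : CommRingCat.{u}} (φ : A ⟶ Γ(X, ⊤)) :
    (Scheme.ΓSpecIso A).inv ≫ (X.toSpecΓ ≫ Spec.map φ).appTop = φ := by
  rw [specIso_inv_comp, Scheme.toSpecΓ_appTop, Iso.inv_hom_id, Category.comp_id]

/-- The homomorphism `A ⟶ 𝒪(T)` corresponding to a morphism `T ⟶ Spec A`. -/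
def toFun {A : Type u} [CommRing A] [Algebra k A] {T : KSch k} (x : T ⟶ SpecK k A) :
    A →+* Fun T :=
  x.left.appTop.hom.comp (Scheme.ΓSpecIso (CommRingCat.of A)).inv.hom

/-- The structure homomorphism `k ⟶ 𝒪(T)`. -/
def str (T : KSch k) : k →+* Fun T :=
  T.hom.appTop.hom.comp (Scheme.ΓSpecIso (CommRingCat.of k)).inv.hom

lemma toFun_ext {A : Type u} [CommRing A] [Algebra k A] {T : KSch k} {x y : T ⟶ SpecK k A}
    (h : toFun x = toFun y) : x = y :=
  Over.OverMorphism.ext (ext_to_Spec (CommRingCat.hom_ext h))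

lemma toFun_comp {A : Type u} [CommRing A] [Algebra k A] {T T' : KSch k} (f : T' ⟶ T)
    (x : T ⟶ SpecK k A) : toFun (f ≫ x) = (pull f).comp (toFun x) := by
  ext a
  change (f.left ≫ x.left).appTop.hom _ = _
  rw [Scheme.Hom.comp_appTop]
  rfl

lemma toFun_algebraMap {A : Type u} [CommRing A] [Algebra k A] {T : KSch k}
    (x : T ⟶ SpecK k A) : (toFun x).comp (algebraMap k A) = str T := by
  have h : x.left ≫ Spec.map (CommRingCat.ofHom (algebraMap k A)) = T.hom := Over.w x
  have h2 := specIso_inv_comp (CommRingCat.ofHom (algebraMap k A)) x.left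
  have h3 := congrArg (fun f : T.left ⟶ Spec (CommRingCat.of k) =>
    (Scheme.ΓSpecIso (CommRingCat.of k)).inv ≫ f.appTop) h
  exact (congrArg CommRingCat.Hom.hom (h3.symm.trans h2)).symm

/-- The morphism `T ⟶ Spec A` corresponding to a homomorphism of `k`-algebras `A ⟶ 𝒪(T)`. -/
def ofFun {A : Type u} [CommRing A] [Algebra k A] {T : KSch k} (ψ : A →+* Fun T)
    (h : ψ.comp (algebraMap k A) = str T) : T ⟶ SpecK k A :=
  Over.homMk (T.left.toSpecΓ ≫ Spec.map (CommRingCat.ofHom ψ)) (by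
    change (_ ≫ Spec.map _) ≫ Spec.map _ = _
    rw [Category.assoc, ← Spec.map_comp, ← CommRingCat.ofHom_comp, h]
    refine ext_to_Spec (X := T.left) ((specIso_inv_toSpecΓ (CommRingCat.ofHom (str T))).trans ?_)
    rfl)

lemma toFun_ofFun {A : Type u} [CommRing A] [Algebra k A] {T : KSch k} (ψ : A →+* Fun T)
    (h : ψ.comp (algebraMap k A) = str T) : toFun (ofFun ψ h) = ψ :=
  congrArg CommRingCat.Hom.hom
    (specIso_inv_toSpecΓ (X := T.left) (CommRingCat.ofHom ψ))

lemma toFun_map {A B : Type u} [CommRing A] [Algebra k A] [CommRing B] [Algebra k B]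
    (φ : A →ₐ[k] B) {T : KSch k} (x : T ⟶ SpecK k B) :
    toFun (x ≫ SpecK.map φ) = (toFun x).comp φ.toRingHom :=
  congrArg CommRingCat.Hom.hom (specIso_inv_comp (CommRingCat.ofHom φ.toRingHom) x.left)

/-- A coaction of the Hopf algebra `k[s, s⁻¹]` on a `k`-algebra `A`, that is an action of `𝔾ₘ`
on `Spec A`. The two axioms are stated through evaluation at invertible elements. -/
structure Coaction (k : Type u) [Field k] (A : Type u) [CommRing A] [Algebra k A] where
  ρ : A →ₐ[k] A[T;T⁻¹]
  counit : (LaurentPolynomial.eval₂ (RingHom.id A) 1).comp ρ.toRingHom = RingHom.id A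
  coassoc : ∀ (B : Type u) [CommRing B] (φ : A →+* B) (a b : Bˣ),
    (LaurentPolynomial.eval₂ ((LaurentPolynomial.eval₂ φ b).comp ρ.toRingHom) a).comp ρ.toRingHom =
      (LaurentPolynomial.eval₂ φ (a * b)).comp ρ.toRingHom

lemma laurent_hom_ext {A B : Type u} [CommRing A] [CommRing B] {f g : A[T;T⁻¹] →+* B}
    (h1 : ∀ a, f (LaurentPolynomial.C a) = g (LaurentPolynomial.C a))
    (h2 : f (LaurentPolynomial.T 1) = g (LaurentPolynomial.T 1)) : f = g := by
  refine IsLocalization.ringHom_ext (Submonoid.powers (Polynomial.X : Polynomial A)) ?_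
  refine Polynomial.ringHom_ext (fun a => ?_) ?_
  · simpa using h1 a
  · simpa using h2

lemma eval₂_natural {A B B' : Type u} [CommRing A] [CommRing B] [CommRing B'] (f : B →+* B')
    (φ : A →+* B) (a : Bˣ) : f.comp (LaurentPolynomial.eval₂ φ a) =
      LaurentPolynomial.eval₂ (f.comp φ) (Units.map f.toMonoidHom a) := by
  refine laurent_hom_ext (fun x => ?_) ?_
  · simp
  · simp

/-- The action of `𝔾ₘ` on `Spec A` given by a coaction. -/
def Coaction.act {A : Type u} [CommRing A] [Algebra k A] (c : Coaction k A) :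
    GmAction (SpecK k A) where
  smul {T} a x := ofFun ((LaurentPolynomial.eval₂ (toFun x) a).comp c.ρ.toRingHom) (by
    rw [← toFun_algebraMap x]
    ext t
    simp [LaurentPolynomial.algebraMap_apply])
  one_smul x := toFun_ext (by
    rw [toFun_ofFun]
    have h := eval₂_natural (toFun x) (RingHom.id A) 1
    rw [map_one, RingHom.comp_id] at h
    rw [← h, RingHom.comp_assoc, c.counit, RingHom.comp_id])
  mul_smul a b x := toFun_ext (by
    rw [toFun_ofFun, toFun_ofFun, toFun_ofFun]
    exact (c.coassoc _ _ a b).symm)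
  natural f a x := toFun_ext (by
    rw [toFun_comp, toFun_ofFun, toFun_ofFun, toFun_comp, ← RingHom.comp_assoc, eval₂_natural]
    rfl)

lemma Coaction.toFun_act {A : Type u} [CommRing A] [Algebra k A] (c : Coaction k A) {T : KSch k}
    (a : (Fun T)ˣ) (x : T ⟶ SpecK k A) :
    toFun (c.act.smul a x) = (LaurentPolynomial.eval₂ (toFun x) a).comp c.ρ.toRingHom := by
  simp only [Coaction.act, toFun_ofFun]

/-- The object over `Spec R × 𝔾ₘ` given by a `k`-algebra `A` of finite type with a coaction, a
homomorphism `r : R ⟶ A` into the invariants and an invertible element `w` of degree `n > 0`. -/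
def GmVar.ofCoaction {A R : Type u} [CommRing A] [Algebra k A] [Algebra.FiniteType k A]
    [CommRing R] [Algebra k R] (c : Coaction k A) (r : R →ₐ[k] A)
    (hr : ∀ x, c.ρ (r x) = LaurentPolynomial.C (r x)) (w : Aˣ) (n : ℕ) (hn : 0 < n)
    (hw : c.ρ w = LaurentPolynomial.C (w : A) * LaurentPolynomial.T n) :
    GmVar (SpecK k R) where
  X := SpecK k A
  separated := inferInstanceAs (IsSeparated (Spec.map (CommRingCat.ofHom (algebraMap k A))))
  locallyOfFiniteType :=
    (HasRingHomProperty.Spec_iff (P := @LocallyOfFiniteType)).2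
      ((RingHom.finiteType_algebraMap (A := k) (B := A)).2 inferInstance)
  quasiCompact := inferInstanceAs (QuasiCompact (Spec.map (CommRingCat.ofHom (algebraMap k A))))
  act := c.act
  good := fun x => by
    have : IsAffine (SpecK k A).left := inferInstanceAs (IsAffine (Spec (CommRingCat.of A)))
    exact ⟨⊤, isAffineOpen_top _, fun _ _ _ _ _ => trivial⟩
  toBase := SpecK.map r
  toGm := Units.map (Scheme.ΓSpecIso (CommRingCat.of A)).inv.hom.toMonoidHom w
  weight := n
  weight_pos := hn
  invariant := fun a x => toFun_ext (by
    rw [toFun_map, toFun_map, c.toFun_act]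
    ext y
    simp [hr])
  monomial := fun a x => Units.ext (by
    have h : toFun (c.act.smul a x) (w : A) = a ^ n * toFun x (w : A) := by
      rw [c.toFun_act]
      change LaurentPolynomial.eval₂ (toFun x) a (c.ρ (w : A)) = _
      rw [hw, LaurentPolynomial.eval₂_C_mul_T_n, mul_comm]
    exact h)

/-! ### Jet schemes, contact loci and motivic zeta functions on affine space -/

section Jets

variable {ι : Type}

/-- The coordinate ring of the space `𝓛_m(𝔸^ι)` of arcs of order `m` in `𝔸^ι`: the variable
`(i, j)` is the coefficient of `t ^ j` in the `i`-th coordinate of the arc. -/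
abbrev JetPoly (k : Type u) [Field k] (ι : Type) (m : ℕ) : Type u :=
  MvPolynomial (ι × Fin (m + 1)) k

/-- The coefficient of `t ^ l` in `g(φ(t))`, where `φ` is the universal arc of order `m`. -/
def jetCoeff (g : MvPolynomial ι k) (m l : ℕ) : JetPoly k ι m :=
  (MvPolynomial.aeval (fun i : ι => ∑ j : Fin (m + 1),
    Polynomial.C (MvPolynomial.X (i, j) : JetPoly k ι m) * Polynomial.X ^ (j : ℕ)) g :
      Polynomial (JetPoly k ι m)).coeff l

/-- The ideal generated by the coefficients of `1, t, …, t ^ (m - 1)` in `g(φ(t))`. -/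
def jetIdeal (g : MvPolynomial ι k) (m : ℕ) : Ideal (JetPoly k ι m) :=
  Ideal.span (Set.range fun l : Fin m => jetCoeff g m l)

/-- The coordinate ring of `𝓧_m(g) = {φ ∈ 𝓛_m(𝔸^ι) | ord_t g(φ) = m}`: the coefficients of
`1, t, …, t ^ (m - 1)` in `g(φ(t))` vanish and the coefficient of `t ^ m` is invertible. -/
abbrev JetRing (g : MvPolynomial ι k) (m : ℕ) : Type u :=
  Localization.Away (Ideal.Quotient.mk (jetIdeal g m) (jetCoeff g m m))

/-- The coordinate functions on `𝓧_m(g)`. -/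
def jetMk (g : MvPolynomial ι k) (m : ℕ) : JetPoly k ι m →ₐ[k] JetRing g m :=
  (IsScalarTower.toAlgHom k (JetPoly k ι m ⧸ jetIdeal g m) (JetRing g m)).comp
    (Ideal.Quotient.mkₐ k (jetIdeal g m))

lemma jetMk_coeff_eq_zero (g : MvPolynomial ι k) {m l : ℕ} (h : l < m) :
    jetMk g m (jetCoeff g m l) = 0 := by
  have h2 : Ideal.Quotient.mk (jetIdeal g m) (jetCoeff g m l) = 0 :=
    Ideal.Quotient.eq_zero_iff_mem.2 (Ideal.subset_span ⟨⟨l, h⟩, rfl⟩)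
  change algebraMap _ (JetRing g m) (Ideal.Quotient.mk (jetIdeal g m) (jetCoeff g m l)) = 0
  rw [h2, map_zero]

lemma isUnit_jetMk_coeff (g : MvPolynomial ι k) (m : ℕ) : IsUnit (jetMk g m (jetCoeff g m m)) :=
  IsLocalization.Away.algebraMap_isUnit
    (Ideal.Quotient.mk (jetIdeal g m) (jetCoeff g m m))

lemma jetRing_hom_ext {B : Type*} [CommRing B] (g : MvPolynomial ι k) (m : ℕ)
    {φ ψ : JetRing g m →+* B}
    (h0 : ∀ a : k, φ (algebraMap k _ a) = ψ (algebraMap k _ a))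
    (h : ∀ i j, φ (jetMk g m (MvPolynomial.X (i, j))) = ψ (jetMk g m (MvPolynomial.X (i, j)))) :
    φ = ψ := by
  refine IsLocalization.ringHom_ext (Submonoid.powers
      (Ideal.Quotient.mk (jetIdeal g m) (jetCoeff g m m))) ?_
  refine Ideal.Quotient.ringHom_ext (MvPolynomial.ringHom_ext (fun a => h0 a) ?_)
  rintro ⟨i, j⟩
  exact h i j

lemma map_jetCoeff {B : Type*} [CommRing B] [Algebra k B] (g : MvPolynomial ι k) (m l : ℕ)
    (φ : JetPoly k ι m →ₐ[k] B) :
    φ (jetCoeff g m l) = (MvPolynomial.aeval (fun i : ι => ∑ j : Fin (m + 1),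
      Polynomial.C (φ (MvPolynomial.X (i, j))) * Polynomial.X ^ (j : ℕ)) g :
        Polynomial B).coeff l := by
  have h : Polynomial.mapAlgHom φ (MvPolynomial.aeval (fun i : ι => ∑ j : Fin (m + 1),
      Polynomial.C (MvPolynomial.X (i, j) : JetPoly k ι m) * Polynomial.X ^ (j : ℕ)) g) =
      MvPolynomial.aeval (fun i : ι => ∑ j : Fin (m + 1),
      Polynomial.C (φ (MvPolynomial.X (i, j))) * Polynomial.X ^ (j : ℕ)) g := by
    rw [← AlgHom.comp_apply, MvPolynomial.comp_aeval]
    simp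
  rw [← h, jetCoeff]
  simp

/-- The coaction on coordinate functions: the variable `(i, j)` has degree `j`. -/
def jetρ₀ (g : MvPolynomial ι k) (m : ℕ) : JetPoly k ι m →ₐ[k] (JetRing g m)[T;T⁻¹] :=
  MvPolynomial.aeval fun p : ι × Fin (m + 1) =>
    LaurentPolynomial.C (jetMk g m (MvPolynomial.X p)) * LaurentPolynomial.T ((p.2 : ℕ) : ℤ)

lemma coeff_rescaled_arc {A : Type u} [CommRing A] [Algebra k A] {m : ℕ}
    (y : ι → Fin (m + 1) → A) (g : MvPolynomial ι k) (l : ℕ) :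
    (MvPolynomial.aeval (fun i : ι => ∑ j : Fin (m + 1),
      Polynomial.C (LaurentPolynomial.C (y i j) * LaurentPolynomial.T ((j : ℕ) : ℤ)) *
        Polynomial.X ^ (j : ℕ)) g : Polynomial A[T;T⁻¹]).coeff l =
    LaurentPolynomial.C ((MvPolynomial.aeval (fun i : ι => ∑ j : Fin (m + 1),
      Polynomial.C (y i j) * Polynomial.X ^ (j : ℕ)) g : Polynomial A).coeff l) *
      LaurentPolynomial.T (l : ℤ) := by
  let q : Polynomial A[T;T⁻¹] := Polynomial.C (LaurentPolynomial.T 1) * Polynomial.X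
  let ψ : Polynomial A →+* Polynomial A[T;T⁻¹] :=
    (Polynomial.compRingHom q).comp (Polynomial.mapRingHom LaurentPolynomial.C)
  have h : ψ.comp (MvPolynomial.aeval (R := k) (fun i : ι => ∑ j : Fin (m + 1),
      Polynomial.C (y i j) * Polynomial.X ^ (j : ℕ))).toRingHom =
      (MvPolynomial.aeval (R := k) (fun i : ι => ∑ j : Fin (m + 1),
      Polynomial.C (LaurentPolynomial.C (y i j) * LaurentPolynomial.T ((j : ℕ) : ℤ)) *
        Polynomial.X ^ (j : ℕ))).toRingHom := by
    refine MvPolynomial.ringHom_ext (fun a => ?_) (fun i => ?_)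
    · simp [ψ, q, Polynomial.algebraMap_apply, LaurentPolynomial.algebraMap_apply]
    · simp only [RingHom.comp_apply, AlgHom.toRingHom_eq_coe, RingHom.coe_coe,
        MvPolynomial.aeval_X, map_sum]
      refine Finset.sum_congr rfl fun j _ => ?_
      simp only [ψ, q, RingHom.comp_apply, map_mul, map_pow, Polynomial.coe_mapRingHom,
        Polynomial.map_C, Polynomial.map_X, Polynomial.coe_compRingHom_apply, Polynomial.C_comp,
        Polynomial.X_comp, mul_pow, ← Polynomial.C_pow, LaurentPolynomial.T_pow, mul_one, mul_assoc]
  have h2 := RingHom.congr_fun h g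
  have h3 := congrArg (fun p => Polynomial.coeff p l) h2
  refine h3.symm.trans ?_
  change Polynomial.coeff (Polynomial.comp (Polynomial.map LaurentPolynomial.C _)
    (Polynomial.C (LaurentPolynomial.T 1) * Polynomial.X)) l = _
  rw [Polynomial.comp_C_mul_X_coeff, Polynomial.coeff_map, LaurentPolynomial.T_pow, mul_one]
  rfl

lemma jetρ₀_coeff (g : MvPolynomial ι k) (m l : ℕ) : jetρ₀ g m (jetCoeff g m l) =
    LaurentPolynomial.C (jetMk g m (jetCoeff g m l)) * LaurentPolynomial.T (l : ℤ) := by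
  rw [map_jetCoeff, map_jetCoeff, ← coeff_rescaled_arc]
  simp only [jetρ₀, MvPolynomial.aeval_X]

lemma jetρ₀_mem (g : MvPolynomial ι k) (m : ℕ) (x : JetPoly k ι m) (hx : x ∈ jetIdeal g m) :
    jetρ₀ g m x = 0 := by
  have h : jetIdeal g m ≤ RingHom.ker (jetρ₀ g m) := by
    refine Ideal.span_le.2 ?_
    rintro _ ⟨l, rfl⟩
    change jetρ₀ g m _ = 0
    rw [jetρ₀_coeff, jetMk_coeff_eq_zero g l.2, map_zero, zero_mul]
  exact h hx

/-- The coaction on `𝓧_m(g)` of the action `(a • φ)(t) = φ(a t)`. -/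
def jetρ (g : MvPolynomial ι k) (m : ℕ) : JetRing g m →ₐ[k] (JetRing g m)[T;T⁻¹] :=
  IsLocalization.liftAlgHom
    (M := Submonoid.powers (Ideal.Quotient.mk (jetIdeal g m) (jetCoeff g m m)))
    (f := Ideal.Quotient.liftₐ (jetIdeal g m) (jetρ₀ g m) (jetρ₀_mem g m)) (by
      rintro ⟨_, n, rfl⟩
      rw [map_pow]
      refine IsUnit.pow n ?_
      change IsUnit (jetρ₀ g m (jetCoeff g m m))
      rw [jetρ₀_coeff]
      exact ((isUnit_jetMk_coeff g m).map _).mul (LaurentPolynomial.isUnit_T _))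

lemma jetρ_jetMk (g : MvPolynomial ι k) (m : ℕ) (x : JetPoly k ι m) :
    jetρ g m (jetMk g m x) = jetρ₀ g m x :=
  IsLocalization.lift_eq _ _

lemma jetρ_X (g : MvPolynomial ι k) (m : ℕ) (i : ι) (j : Fin (m + 1)) :
    jetρ g m (jetMk g m (MvPolynomial.X (i, j))) =
      LaurentPolynomial.C (jetMk g m (MvPolynomial.X (i, j))) *
        LaurentPolynomial.T ((j : ℕ) : ℤ) := by
  rw [jetρ_jetMk, jetρ₀, MvPolynomial.aeval_X]

/-- The action `(a • φ)(t) = φ(a t)` on `𝓧_m(g)`. -/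
def jetCoaction (g : MvPolynomial ι k) (m : ℕ) : Coaction k (JetRing g m) where
  ρ := jetρ g m
  counit := jetRing_hom_ext g m (fun a => by
      change LaurentPolynomial.eval₂ _ _ (jetρ g m (algebraMap k _ a)) = _
      rw [AlgHom.commutes, IsScalarTower.algebraMap_apply k (JetRing g m),
        LaurentPolynomial.algebraMap_apply, LaurentPolynomial.eval₂_C]
      rfl) (fun i j => by
      change LaurentPolynomial.eval₂ _ _ (jetρ g m _) = _
      rw [jetρ_X, LaurentPolynomial.eval₂_C_mul_T_n]
      simp)
  coassoc B _ φ a b := jetRing_hom_ext g m (fun x => by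
      change LaurentPolynomial.eval₂ _ _ (jetρ g m (algebraMap k _ x)) =
        LaurentPolynomial.eval₂ _ _ (jetρ g m (algebraMap k _ x))
      rw [AlgHom.commutes, IsScalarTower.algebraMap_apply k (JetRing g m) (JetRing g m)[T;T⁻¹],
        LaurentPolynomial.algebraMap_apply, LaurentPolynomial.eval₂_C, LaurentPolynomial.eval₂_C]
      change LaurentPolynomial.eval₂ _ _ (jetρ g m (algebraMap k _ x)) = _
      rw [AlgHom.commutes, IsScalarTower.algebraMap_apply k (JetRing g m) (JetRing g m)[T;T⁻¹],
        LaurentPolynomial.algebraMap_apply, LaurentPolynomial.eval₂_C]) (fun i j => by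
      change LaurentPolynomial.eval₂ _ _ (jetρ g m _) = LaurentPolynomial.eval₂ _ _ (jetρ g m _)
      rw [jetρ_X, LaurentPolynomial.eval₂_C_mul_T_n, LaurentPolynomial.eval₂_C_mul_T_n]
      change LaurentPolynomial.eval₂ _ _ (jetρ g m _) * _ = _
      rw [jetρ_X, LaurentPolynomial.eval₂_C_mul_T_n, Units.val_mul, mul_pow]
      ring)

/-- The coordinate ring of the zero locus `X₀(g)` of `g` in `𝔸^ι`. -/
abbrev ZeroRing (g : MvPolynomial ι k) : Type u := MvPolynomial ι k ⧸ Ideal.span {g}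

/-- The zero locus `X₀(g)` of `g` in `𝔸^ι`. -/
abbrev zeroLocus (g : MvPolynomial ι k) : KSch k := SpecK k (ZeroRing g)

lemma jetBase_aux (g : MvPolynomial ι k) {m : ℕ} (hm : 0 < m) (x : MvPolynomial ι k)
    (hx : x ∈ Ideal.span {g}) :
    MvPolynomial.aeval (fun i : ι => jetMk g m (MvPolynomial.X (i, 0))) x = 0 := by
  have h : MvPolynomial.aeval (fun i : ι => jetMk g m (MvPolynomial.X (i, 0))) g =
      jetMk g m (jetCoeff g m 0) := by
    rw [map_jetCoeff]
    have h2 : (MvPolynomial.aeval (R := k)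
          fun i : ι => jetMk g m (MvPolynomial.X (i, 0))).toRingHom =
        Polynomial.constantCoeff.comp (MvPolynomial.aeval (R := k) (fun i : ι =>
          ∑ j : Fin (m + 1), Polynomial.C (jetMk g m (MvPolynomial.X (i, j))) *
            Polynomial.X ^ (j : ℕ))).toRingHom := by
      refine MvPolynomial.ringHom_ext (fun a => ?_) (fun i => ?_)
      · simp [Polynomial.algebraMap_apply]
      · simp only [RingHom.comp_apply, AlgHom.toRingHom_eq_coe, RingHom.coe_coe,
          MvPolynomial.aeval_X, map_sum]
        rw [Finset.sum_eq_single 0]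
        · simp
        · intro j _ hj
          have : (j : ℕ) ≠ 0 := fun h => hj (Fin.ext h)
          simp [this.symm]
        · simp
    exact RingHom.congr_fun h2 g
  obtain ⟨y, rfl⟩ := Ideal.mem_span_singleton.1 hx
  rw [map_mul, h, jetMk_coeff_eq_zero g hm, zero_mul]

/-- The morphism `𝓧_m(g) ⟶ X₀(g)`, `φ ↦ φ(0)`. -/
def jetBase (g : MvPolynomial ι k) {m : ℕ} (hm : 0 < m) : ZeroRing g →ₐ[k] JetRing g m :=
  Ideal.Quotient.liftₐ (Ideal.span {g})
    (MvPolynomial.aeval fun i : ι => jetMk g m (MvPolynomial.X (i, 0))) (jetBase_aux g hm)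

lemma jetBase_invariant (g : MvPolynomial ι k) {m : ℕ} (hm : 0 < m) (x : ZeroRing g) :
    jetρ g m (jetBase g hm x) = LaurentPolynomial.C (jetBase g hm x) := by
  have h : (jetρ g m).comp (jetBase g hm) =
      (IsScalarTower.toAlgHom k (JetRing g m) (JetRing g m)[T;T⁻¹]).comp (jetBase g hm) := by
    refine Ideal.Quotient.algHom_ext k (MvPolynomial.algHom_ext fun i => ?_)
    change jetρ g m (jetBase g hm (Ideal.Quotient.mk _ (MvPolynomial.X i))) =
      algebraMap (JetRing g m) (JetRing g m)[T;T⁻¹]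
        (jetBase g hm (Ideal.Quotient.mk _ (MvPolynomial.X i)))
    have h2 : jetBase g hm (Ideal.Quotient.mk _ (MvPolynomial.X i)) =
        jetMk g m (MvPolynomial.X (i, 0)) := by
      change MvPolynomial.aeval _ _ = _
      rw [MvPolynomial.aeval_X]
    rw [h2, jetρ_X, LaurentPolynomial.algebraMap_apply]
    simp
  exact DFunLike.congr_fun h x

/-- The space `𝓧_m(g)` over `X₀(g) × 𝔾ₘ`, for `m > 0`: the morphism to `X₀(g)` is `φ ↦ φ(0)`, the
morphism to `𝔾ₘ` is the angular component `φ ↦ ac(g(φ))`, and `𝔾ₘ` acts by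
`(a • φ)(t) = φ(a t)`. -/
def jetVar [Finite ι] (g : MvPolynomial ι k) {m : ℕ} (hm : 0 < m) : GmVar (zeroLocus g) :=
  GmVar.ofCoaction (jetCoaction g m) (jetBase g hm) (jetBase_invariant g hm)
    (isUnit_jetMk_coeff g m).unit m hm (by
      change jetρ g m (jetMk g m (jetCoeff g m m)) = _
      rw [jetρ_jetMk, jetρ₀_coeff]
      rfl)

/-- The motivic zeta function `Z_g(T) = ∑_{m ≥ 1} [𝓧_m(g)] 𝕃^{-mn} T^m`, where `n` is the
dimension of the affine space, as the sequence of its coefficients. -/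
def motivicZeta [Fintype ι] (g : MvPolynomial ι k) (m : ℕ) : Mot (zeroLocus g) :=
  if hm : 0 < m then Mot.cls (jetVar g hm) (-((m : ℤ) * Fintype.card ι)) else 0

end Jets

/-! ### Rational series and their limits -/

section Limit

variable {M : Type*} [AddCommGroup M] [Module ℤ[T;T⁻¹] M]

/-- The series `p_{e,i}(T) = 𝕃ᵉ Tⁱ / (1 - 𝕃ᵉ Tⁱ)` over `ℤ[𝕃, 𝕃⁻¹]`, for `i > 0`. -/
def pSeries (e : ℤ) (i : ℕ) : PowerSeries ℤ[T;T⁻¹] :=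
  PowerSeries.C (LaurentPolynomial.T e) * PowerSeries.X ^ i *
    PowerSeries.invOfUnit (1 - PowerSeries.C (LaurentPolynomial.T e) * PowerSeries.X ^ i) 1

/-- The product of the series `p_{e,i}` over a finite family of pairs `(e, i)`. -/
def pProd (s : Multiset (ℤ × ℕ)) : PowerSeries ℤ[T;T⁻¹] :=
  (s.map fun p => pSeries p.1 p.2).prod

variable (M) in
/-- The graph of the linear map `lim_{T → ∞} : M⟦T⟧_sr ⟶ M`, where a power series over `M` is given
by the sequence of its coefficients: the subgroup generated by the pairs
`(a ∏ p_{e,i}(T), (-1)^|I| a)` for `a` in `M` and finite families `I` of pairs `(e, i)` with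
`i > 0`. -/
def limGraph : AddSubgroup ((ℕ → M) × M) :=
  AddSubgroup.closure {z | ∃ (a : M) (s : Multiset (ℤ × ℕ)), (∀ p ∈ s, 0 < p.2) ∧
    z = (fun m => PowerSeries.coeff m (pProd s) • a, (-1 : ℤ) ^ Multiset.card s • a)}

/-- The series `Z` belongs to `M⟦T⟧_sr` and `lim_{T → ∞} Z = c`. -/
def HasLimInfty (Z : ℕ → M) (c : M) : Prop := (Z, c) ∈ limGraph M

open Classical in
/-- `lim_{T → ∞} Z` for a series `Z` in `M⟦T⟧_sr` (and `0` for other series). -/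
def limInfty (Z : ℕ → M) : M := if h : ∃ c, HasLimInfty Z c then h.choose else 0

/-- Multiplication by `T` on power series over `M`. -/
def mulT : Module.End ℤ[T;T⁻¹] (ℕ → M) where
  toFun Z m := if 0 < m then Z (m - 1) else 0
  map_add' Z W := by
    funext m
    by_cases h : 0 < m <;> simp [h]
  map_smul' c Z := by
    funext m
    by_cases h : 0 < m <;> simp [h]

lemma mulT_pow (j : ℕ) (Z : ℕ → M) (m : ℕ) :
    (mulT ^ j : Module.End ℤ[T;T⁻¹] (ℕ → M)) Z m = if j ≤ m then Z (m - j) else 0 := by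
  induction j generalizing m with
  | zero => simp
  | succ j ih =>
    rw [pow_succ', Module.End.mul_apply]
    change (if 0 < m then _ else 0) = _
    rw [ih]
    by_cases h : 0 < m
    · by_cases h2 : j + 1 ≤ m
      · have h3 : j ≤ m - 1 := by omega
        rw [if_pos h, if_pos h2, if_pos h3]
        congr 1
        omega
      · have h3 : ¬ j ≤ m - 1 := by omega
        rw [if_pos h, if_neg h2, if_neg h3]
    · have h3 : ¬ j + 1 ≤ m := by omega
      rw [if_neg h, if_neg h3]

lemma aeval_mulT (D : Polynomial ℤ[T;T⁻¹]) (Z : ℕ → M) (m : ℕ) :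
    Polynomial.aeval (mulT (M := M)) D Z m =
      ∑ j ∈ Finset.range (m + 1), D.coeff j • Z (m - j) := by
  induction D using Polynomial.induction_on' with
  | add p q hp hq =>
    simp only [map_add, LinearMap.add_apply, Pi.add_apply, hp, hq, Polynomial.coeff_add, add_smul,
      Finset.sum_add_distrib]
  | monomial n a =>
    rw [Polynomial.aeval_monomial, Module.End.mul_apply]
    change (a • ((mulT ^ n : Module.End ℤ[T;T⁻¹] (ℕ → M)) Z)) m = _
    rw [Pi.smul_apply, mulT_pow]
    simp only [Polynomial.coeff_monomial, ite_smul, zero_smul, Finset.sum_ite_eq, Finset.mem_range]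
    by_cases h : n ≤ m
    · rw [if_pos h, if_pos (by omega)]
    · rw [if_neg h, if_neg (by omega), smul_zero]

lemma aeval_mulT_top (D : Polynomial ℤ[T;T⁻¹]) (W : ℕ → M) {N N' : ℕ} (hD : D.natDegree ≤ N)
    (hW : ∀ m, N' < m → W m = 0) :
    (∀ m, N + N' < m → Polynomial.aeval (mulT (M := M)) D W m = 0) ∧
      Polynomial.aeval (mulT (M := M)) D W (N + N') = D.coeff N • W N' := by
  constructor
  · intro m hm
    rw [aeval_mulT]
    refine Finset.sum_eq_zero fun j _ => ?_
    by_cases h : j ≤ N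
    · rw [hW _ (by omega), smul_zero]
    · rw [Polynomial.coeff_eq_zero_of_natDegree_lt (by omega), zero_smul]
  · rw [aeval_mulT, Finset.sum_eq_single N]
    · rw [Nat.add_sub_cancel_left]
    · intro j _ hj
      by_cases h : j ≤ N
      · rw [hW _ (by omega), smul_zero]
      · rw [Polynomial.coeff_eq_zero_of_natDegree_lt (by omega), zero_smul]
    · intro h
      exact absurd (Finset.mem_range.2 (by omega)) h

/-- `Z` is a polynomial of degree at most `N` divided by a polynomial of degree `N` with invertible
leading coefficient, and `c` is the quotient of the coefficients of `T ^ N`. -/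
def IsFrac (Z : ℕ → M) (c : M) : Prop :=
  ∃ (D : Polynomial ℤ[T;T⁻¹]) (N : ℕ), D.natDegree ≤ N ∧ IsUnit (D.coeff N) ∧
    (∀ m, N < m → Polynomial.aeval (mulT (M := M)) D Z m = 0) ∧
    Polynomial.aeval (mulT (M := M)) D Z N = D.coeff N • c

lemma IsFrac.add {Z Z' : ℕ → M} {c c' : M} (h : IsFrac Z c) (h' : IsFrac Z' c') :
    IsFrac (Z + Z') (c + c') := by
  obtain ⟨D, N, hN, hu, hz, hc⟩ := h
  obtain ⟨D', N', hN', hu', hz', hc'⟩ := h'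
  have e1 : Polynomial.aeval (mulT (M := M)) (D * D') (Z + Z') =
      Polynomial.aeval (mulT (M := M)) D' (Polynomial.aeval (mulT (M := M)) D Z) +
      Polynomial.aeval (mulT (M := M)) D (Polynomial.aeval (mulT (M := M)) D' Z') := by
    rw [map_add]
    congr 1
    · rw [mul_comm, map_mul, Module.End.mul_apply]
    · rw [map_mul, Module.End.mul_apply]
  have e2 : (D * D').coeff (N + N') = D.coeff N * D'.coeff N' :=
    Polynomial.coeff_mul_add_eq_of_natDegree_le hN hN'
  obtain ⟨a1, a2⟩ := aeval_mulT_top D' _ hN' hz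
  obtain ⟨b1, b2⟩ := aeval_mulT_top D _ hN hz'
  refine ⟨D * D', N + N', Polynomial.natDegree_mul_le_of_le hN hN', e2 ▸ hu.mul hu', ?_, ?_⟩
  · intro m hm
    rw [e1, Pi.add_apply, a1 m (by omega), b1 m hm, add_zero]
  · rw [e1, Pi.add_apply, b2, add_comm N N', a2, add_comm N' N, e2, hc, hc', smul_smul, smul_smul,
      smul_add, mul_comm]

lemma IsFrac.neg {Z : ℕ → M} {c : M} (h : IsFrac Z c) : IsFrac (-Z) (-c) := by
  obtain ⟨D, N, hN, hu, hz, hc⟩ := h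
  refine ⟨D, N, hN, hu, fun m hm => ?_, ?_⟩
  · rw [map_neg, Pi.neg_apply, hz m hm, neg_zero]
  · rw [map_neg, Pi.neg_apply, hc, smul_neg]

/-- The common denominator of a product of series `p_{e,i}`. -/
def pDen (s : Multiset (ℤ × ℕ)) : Polynomial ℤ[T;T⁻¹] :=
  (s.map fun p => 1 - Polynomial.C (LaurentPolynomial.T p.1) * Polynomial.X ^ p.2).prod

lemma pDen_mul_pProd (s : Multiset (ℤ × ℕ)) (hs : ∀ p ∈ s, 0 < p.2) :
    ∃ (n : ℤ) (N : ℕ), (pDen s).natDegree ≤ N ∧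
      (pDen s).coeff N = (-1) ^ Multiset.card s * LaurentPolynomial.T n ∧
      (pDen s : PowerSeries ℤ[T;T⁻¹]) * pProd s =
        PowerSeries.C (LaurentPolynomial.T n) * PowerSeries.X ^ N := by
  induction s using Multiset.induction_on with
  | empty => exact ⟨0, 0, by simp [pDen], by simp [pDen], by simp [pDen, pProd]⟩
  | cons p s ih =>
    obtain ⟨n, N, h1, h2, h3⟩ := ih fun q hq => hs q (Multiset.mem_cons_of_mem hq)
    have hp : 0 < p.2 := hs p (Multiset.mem_cons_self p s)
    let d : Polynomial ℤ[T;T⁻¹] := 1 - Polynomial.C (LaurentPolynomial.T p.1) * Polynomial.X ^ p.2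
    have hd : pDen (p ::ₘ s) = d * pDen s := by simp [pDen, d]
    have hd1 : d.natDegree ≤ p.2 :=
      (Polynomial.natDegree_sub_le_of_le (Polynomial.natDegree_one.trans_le (Nat.zero_le 0))
        (Polynomial.natDegree_C_mul_X_pow_le _ _)).trans (by simp)
    have hd2 : d.coeff p.2 = - LaurentPolynomial.T p.1 := by
      simp [d, Polynomial.coeff_one, hp.ne']
    have hd3 : (d : PowerSeries ℤ[T;T⁻¹]) * pSeries p.1 p.2 =
        PowerSeries.C (LaurentPolynomial.T p.1) * PowerSeries.X ^ p.2 := by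
      have hd4 : (d : PowerSeries ℤ[T;T⁻¹]) =
          1 - PowerSeries.C (LaurentPolynomial.T p.1) * PowerSeries.X ^ p.2 := by
        simp [d]
      rw [hd4, pSeries, mul_left_comm, PowerSeries.mul_invOfUnit, mul_one]
      simp [hp.ne']
    refine ⟨p.1 + n, p.2 + N, ?_, ?_, ?_⟩
    · rw [hd]
      exact Polynomial.natDegree_mul_le_of_le hd1 h1
    · rw [hd, Polynomial.coeff_mul_add_eq_of_natDegree_le hd1 h1, hd2, h2, LaurentPolynomial.T_add,
        Multiset.card_cons, pow_succ]
      ring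
    · have hpp : pProd (p ::ₘ s) = pSeries p.1 p.2 * pProd s := by simp [pProd]
      rw [hd, hpp, Polynomial.coe_mul, mul_mul_mul_comm, hd3, h3, LaurentPolynomial.T_add, map_mul,
        pow_add]
      ring

lemma isFrac_pProd (a : M) (s : Multiset (ℤ × ℕ)) (hs : ∀ p ∈ s, 0 < p.2) :
    IsFrac (fun m => PowerSeries.coeff m (pProd s) • a) ((-1 : ℤ) ^ Multiset.card s • a) := by
  obtain ⟨n, N, h1, h2, h3⟩ := pDen_mul_pProd s hs
  have h4 : ∀ m, Polynomial.aeval (mulT (M := M)) (pDen s)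
      (fun m => PowerSeries.coeff m (pProd s) • a) m =
      PowerSeries.coeff m (PowerSeries.C (LaurentPolynomial.T n : ℤ[T;T⁻¹]) *
        PowerSeries.X ^ N) • a := by
    intro m
    rw [aeval_mulT, ← h3, PowerSeries.coeff_mul, Finset.Nat.sum_antidiagonal_eq_sum_range_succ_mk,
      Finset.sum_smul]
    simp [mul_smul]
  refine ⟨pDen s, N, h1, ?_, fun m hm => ?_, ?_⟩
  · rw [h2]
    exact (IsUnit.pow _ isUnit_one.neg).mul (LaurentPolynomial.isUnit_T n)
  · rw [h4, PowerSeries.coeff_C_mul, PowerSeries.coeff_X_pow, if_neg hm.ne', mul_zero, zero_smul]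
  · rw [h4, h2, PowerSeries.coeff_C_mul, PowerSeries.coeff_X_pow, if_pos rfl, mul_one]
    rw [← Int.cast_smul_eq_zsmul ℤ[T;T⁻¹], smul_smul]
    congr 1
    push_cast
    rw [mul_right_comm, ← mul_pow]
    simp

lemma HasLimInfty.isFrac {Z : ℕ → M} {c : M} (h : HasLimInfty Z c) : IsFrac Z c := by
  have : ∀ z ∈ limGraph M, IsFrac z.1 z.2 := by
    intro z hz
    induction hz using AddSubgroup.closure_induction with
    | mem z hz =>
      obtain ⟨a, s, hs, rfl⟩ := hz
      exact isFrac_pProd a s hs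
    | zero => exact ⟨1, 0, by simp, by simp, by simp, by simp⟩
    | add x y _ _ hx hy => exact hx.add hy
    | neg x _ hx => exact hx.neg
  exact this _ h

/-- The limit is well defined. -/
theorem HasLimInfty.unique {Z : ℕ → M} {c c' : M} (h : HasLimInfty Z c) (h' : HasLimInfty Z c') :
    c = c' := by
  have h2 : HasLimInfty (Z - Z) (c - c') := AddSubgroup.sub_mem (limGraph M) h h'
  obtain ⟨D, N, -, hu, -, hc⟩ := h2.isFrac
  rw [sub_self, map_zero] at hc
  have h3 : D.coeff N • (c - c') = 0 := hc.symm
  rw [hu.smul_eq_zero] at h3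
  exact sub_eq_zero.1 h3

theorem HasLimInfty.limInfty_eq {Z : ℕ → M} {c : M} (h : HasLimInfty Z c) : limInfty Z = c := by
  have h2 : ∃ c, HasLimInfty Z c := ⟨c, h⟩
  rw [limInfty, dif_pos h2]
  exact h2.choose_spec.unique h

end Limit

/-! ### Newton polyhedra -/

section Newton

variable {ι : Type}

/-- An exponent vector, as a vector with real coordinates. -/
def expVec (α : ι →₀ ℕ) : ι → ℝ := fun i => (α i : ℝ)

/-- The Newton polyhedron of `g`: the convex hull of `supp(g) + ℝ_{≥ 0}^ι`. -/
def newtonPolyhedron (g : MvPolynomial ι k) : Set (ι → ℝ) :=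
  convexHull ℝ {v | ∃ α ∈ g.support, ∃ r : ι → ℝ, (∀ i, 0 ≤ r i) ∧ v = expVec α + r}

/-- `γ` is a compact face of the Newton polyhedron of `g`. -/
def IsCompactFace (g : MvPolynomial ι k) (γ : Set (ι → ℝ)) : Prop :=
  γ.Nonempty ∧ IsExposed ℝ (newtonPolyhedron g) γ ∧ IsCompact γ

open Classical in
/-- The face function `g_γ`: the sum of the terms `a_α x^α` of `g` with `α` in `γ`. -/
def faceFunction (g : MvPolynomial ι k) (γ : Set (ι → ℝ)) : MvPolynomial ι k :=
  ∑ α ∈ g.support with expVec α ∈ γ, MvPolynomial.monomial α (g.coeff α)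

/-- The function `f` is smooth on the torus `𝔾ₘ^ι`: it has no critical point with nonzero
coordinates in an algebraic closure of `k`. -/
def IsSmoothOnTorus (f : MvPolynomial ι k) : Prop :=
  ∀ x : ι → AlgebraicClosure k, (∀ i, x i ≠ 0) →
    ∃ i, MvPolynomial.aeval x (MvPolynomial.pderiv i f) ≠ 0

/-- `g` is nondegenerate with respect to its Newton polyhedron. -/
def IsNondegenerate (g : MvPolynomial ι k) : Prop :=
  ∀ γ : Set (ι → ℝ), IsCompactFace g γ → IsSmoothOnTorus (faceFunction g γ)

/-- No vertex of the Newton polyhedron of `g` lies in a coordinate plane. -/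
def NoVertexInCoordinatePlane (g : MvPolynomial ι k) : Prop :=
  ∀ v ∈ (newtonPolyhedron g).extremePoints ℝ, ∀ i, v i ≠ 0

end Newton

/-! ### The motivic Milnor fibre and the integral over `𝔸^{d₁}` -/

section Milnor

variable {ι : Type}

/-- The motivic Milnor fibre `𝓢_g = - lim_{T → ∞} Z_g(T)` in `𝓜_{X₀(g) × 𝔾ₘ}^{𝔾ₘ}`. -/
def milnorFiber [Fintype ι] (g : MvPolynomial ι k) : Mot (zeroLocus g) := - limInfty (motivicZeta g)

lemma origin_aux (h : MvPolynomial ι k) (h0 : MvPolynomial.eval 0 h = 0) (x : MvPolynomial ι k)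
    (hx : x ∈ Ideal.span {h}) : MvPolynomial.aeval (0 : ι → k) x = 0 := by
  obtain ⟨y, rfl⟩ := Ideal.mem_span_singleton.1 hx
  rw [map_mul, MvPolynomial.aeval_eq_eval, h0, zero_mul]

/-- The inclusion `i₀` of the origin into `X₀(h)`, for `h` with `h(0) = 0`. -/
def origin (h : MvPolynomial ι k) (h0 : MvPolynomial.eval 0 h = 0) : SpecK k k ⟶ zeroLocus h :=
  SpecK.map (Ideal.Quotient.liftₐ (Ideal.span {h}) (MvPolynomial.aeval (0 : ι → k))
    (origin_aux h h0))

instance (h : MvPolynomial ι k) (h0 : MvPolynomial.eval 0 h = 0) :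
    IsAffineHom (origin h h0).left := by
  unfold origin; infer_instance

instance (h : MvPolynomial ι k) (h0 : MvPolynomial.eval 0 h = 0) :
    LocallyOfFiniteType (origin h h0).left := by
  unfold origin; infer_instance

/-- The local motivic Milnor fibre `𝓢_{h,0} = i₀^* 𝓢_h` in `𝓜_{𝔾ₘ}^{𝔾ₘ}`. -/
def localMilnorFiber [Fintype ι] (h : MvPolynomial ι k) (h0 : MvPolynomial.eval 0 h = 0) :
    Mot (SpecK k k) :=
  Mot.pullback (origin h h0) (milnorFiber h)

end Milnor

section Weights

variable {d₁ d₂ d₃ : ℕ}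

/-- `g(t x, t⁻¹ y, z) = g(x, y, z)` for all `t` in `𝔾ₘ` and `(x, y, z)` in
`𝔸^{d₁} × 𝔸^{d₂} × 𝔸^{d₃}`. -/
def IsWeightZero (g : MvPolynomial (Fin d₁ ⊕ Fin d₂ ⊕ Fin d₃) k) : Prop :=
  ∀ (t : kˣ) (x : Fin d₁ → k) (y : Fin d₂ → k) (z : Fin d₃ → k),
    MvPolynomial.eval (Sum.elim (fun i => (t : k) * x i)
      (Sum.elim (fun i => ((t⁻¹ : kˣ) : k) * y i) z)) g =
    MvPolynomial.eval (Sum.elim x (Sum.elim y z)) g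

/-- The restriction `g(x, 0, 0)`. -/
def restrictX : MvPolynomial (Fin d₁ ⊕ Fin d₂ ⊕ Fin d₃) k →ₐ[k] MvPolynomial (Fin d₁) k :=
  MvPolynomial.aeval (Sum.elim MvPolynomial.X 0)

/-- The restriction `h(z) = g(0, 0, z)`. -/
def restrictZ : MvPolynomial (Fin d₁ ⊕ Fin d₂ ⊕ Fin d₃) k →ₐ[k] MvPolynomial (Fin d₃) k :=
  MvPolynomial.aeval (Sum.elim 0 (Sum.elim 0 MvPolynomial.X))

lemma eval_restrictX (g : MvPolynomial (Fin d₁ ⊕ Fin d₂ ⊕ Fin d₃) k) (x : Fin d₁ → k) :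
    MvPolynomial.eval x (restrictX g) = MvPolynomial.eval (Sum.elim x 0) g := by
  rw [restrictX, ← MvPolynomial.aeval_eq_eval, ← MvPolynomial.aeval_eq_eval,
    ← AlgHom.comp_apply]
  refine DFunLike.congr_fun (MvPolynomial.algHom_ext fun i => ?_) g
  rw [AlgHom.comp_apply, MvPolynomial.aeval_X, MvPolynomial.aeval_X]
  rcases i with i | i <;> simp

lemma eval_zero_restrictZ (g : MvPolynomial (Fin d₁ ⊕ Fin d₂ ⊕ Fin d₃) k)
    (h0 : MvPolynomial.eval 0 g = 0) : MvPolynomial.eval 0 (restrictZ g) = 0 := by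
  rw [← h0, restrictZ, ← MvPolynomial.aeval_eq_eval, ← MvPolynomial.aeval_eq_eval,
    ← AlgHom.comp_apply]
  refine DFunLike.congr_fun (MvPolynomial.algHom_ext fun i => ?_) g
  rw [AlgHom.comp_apply, MvPolynomial.aeval_X, MvPolynomial.aeval_X]
  rcases i with i | i | i <;> simp

/-- The zero locus of `g` contains `𝔸^{d₁}`. -/
lemma restrictX_eq_zero [CharZero k] (g : MvPolynomial (Fin d₁ ⊕ Fin d₂ ⊕ Fin d₃) k)
    (h0 : MvPolynomial.eval 0 g = 0) (hg : IsWeightZero g) : restrictX g = 0 := by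
  have h0' : MvPolynomial.eval 0 (restrictX g) = 0 := by
    rw [eval_restrictX, ← h0]
    congr 1
    congr 1
    funext i
    rcases i with i | i <;> rfl
  refine MvPolynomial.funext fun x => ?_
  rw [map_zero]
  have h1 : ∀ t : kˣ, MvPolynomial.eval (fun i => (t : k) * x i) (restrictX g) =
      MvPolynomial.eval x (restrictX g) := by
    intro t
    rw [eval_restrictX, eval_restrictX]
    have := hg t x 0 0
    have e : ∀ y : Fin d₁ → k, Sum.elim y (0 : Fin d₂ ⊕ Fin d₃ → k) =
        Sum.elim y (Sum.elim 0 0) := by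
      intro y
      funext i
      rcases i with i | i | i <;> rfl
    rw [e, e, ← this]
    simp only [Pi.zero_apply, mul_zero]
    rfl
  let q : Polynomial k := MvPolynomial.aeval (fun i => Polynomial.C (x i) * Polynomial.X)
    (restrictX g)
  have hq : ∀ t : k, q.eval t = MvPolynomial.eval (fun i => t * x i) (restrictX g) := by
    intro t
    rw [← MvPolynomial.aeval_eq_eval, ← Polynomial.coe_aeval_eq_eval]
    change ((Polynomial.aeval t).comp (MvPolynomial.aeval fun i =>
      Polynomial.C (x i) * Polynomial.X)) (restrictX g) = _
    refine DFunLike.congr_fun (MvPolynomial.algHom_ext fun i => ?_) _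
    rw [AlgHom.comp_apply, MvPolynomial.aeval_X, MvPolynomial.aeval_X, map_mul,
      Polynomial.aeval_C, Polynomial.aeval_X, mul_comm]
    rfl
  have hq2 : q = Polynomial.C (MvPolynomial.eval x (restrictX g)) := by
    refine Polynomial.eq_of_infinite_eval_eq _ _ 
      (Set.Infinite.mono ?_ (Set.finite_singleton (0 : k)).infinite_compl)
    intro t ht
    have h4 : MvPolynomial.eval (fun i => t * x i) (restrictX g) =
        MvPolynomial.eval x (restrictX g) := h1 (Units.mk0 t ht)
    simpa [hq] using h4
  have h2 := hq 0
  rw [hq2, Polynomial.eval_C] at h2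
  have h3 : (fun i => (0 : k) * x i) = 0 := funext fun i => zero_mul (x i)
  rw [h2, h3, h0']

lemma incl_aux (g : MvPolynomial (Fin d₁ ⊕ Fin d₂ ⊕ Fin d₃) k) (hg : restrictX g = 0)
    (x : MvPolynomial (Fin d₁ ⊕ Fin d₂ ⊕ Fin d₃) k) (hx : x ∈ Ideal.span {g}) :
    restrictX x = 0 := by
  obtain ⟨y, rfl⟩ := Ideal.mem_span_singleton.1 hx
  rw [map_mul, hg, zero_mul]

/-- The affine space `𝔸^n` over `k`. -/
abbrev affSpace (k : Type u) [Field k] (n : ℕ) : KSch k := SpecK k (MvPolynomial (Fin n) k)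

/-- The inclusion `i₁ : 𝔸^{d₁} ⟶ X₀(g)`, `x ↦ (x, 0, 0)`, for `g` with `g(x, 0, 0) = 0`. -/
def incl (g : MvPolynomial (Fin d₁ ⊕ Fin d₂ ⊕ Fin d₃) k) (hg : restrictX g = 0) :
    affSpace k d₁ ⟶ zeroLocus g :=
  SpecK.map (Ideal.Quotient.liftₐ (Ideal.span {g}) restrictX (incl_aux g hg))

instance (g : MvPolynomial (Fin d₁ ⊕ Fin d₂ ⊕ Fin d₃) k) (hg : restrictX g = 0) :
    IsAffineHom (incl g hg).left := by
  unfold incl; infer_instance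

instance (g : MvPolynomial (Fin d₁ ⊕ Fin d₂ ⊕ Fin d₃) k) (hg : restrictX g = 0) :
    LocallyOfFiniteType (incl g hg).left := by
  unfold incl; infer_instance

/-- The structure morphism `𝔸^n ⟶ Spec k`. -/
def affSpaceStr (k : Type u) [Field k] (n : ℕ) : affSpace k n ⟶ SpecK k k :=
  SpecK.map (Algebra.ofId k (MvPolynomial (Fin n) k))

/-- The map `∫_{𝔸^{d₁}} i₁^* : 𝓜_{X₀(g) × 𝔾ₘ}^{𝔾ₘ} ⟶ 𝓜_{𝔾ₘ}^{𝔾ₘ}`: pullback along `i₁`, followed by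
the pushforward along `𝔸^{d₁} ⟶ Spec k`. -/
def intIncl (g : MvPolynomial (Fin d₁ ⊕ Fin d₂ ⊕ Fin d₃) k) (hg : restrictX g = 0) :
    Mot (zeroLocus g) →+ Mot (SpecK k k) :=
  (Mot.pushforward (affSpaceStr k d₁)).comp (Mot.pullback (incl g hg))

end Weights

end Basics

end MotivicMilnor

end

open MotivicMilnor

/-!
Since no vertex of the Newton polyhedron lies in a coordinate plane, every exponent of `g` has
only positive entries (`NoVertexInCoordinatePlane.pos`). Hence `g(0, 0, z) = 0`, and an arc along
which `g` has order `m` has all its coordinates of order at most `m`. If `g = 0` all spaces of arcs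
are empty; otherwise `d₁, d₂ ≥ 1` because the exponents have weight zero.

The coefficients of `∫ i₁^* Z_g(T)` are the classes of the arcs whose `y`- and `z`-coordinates
vanish at the origin (`intIncl_jetVar`). They are stratified by the vector `κ` of the orders of the
coordinates. Let `P` be the set of the exponents of `g` on which the linear form `κ` is minimal,
`ℓ` its minimum and `g_P` the sum of the corresponding terms. The form `2 κ + (1, -1, 0)` attains
its minimum on the same set `P` and has positive coefficients, so that `P` belongs to a compact
face and `g_P` is smooth on the torus (`IsNondegenerate.isSmoothOnTorus`). The stratum of `κ` is
empty for `m < ℓ`; for `m = ℓ` it is an affine bundle over the complement of `g_P = 0` in the torus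
(`cls_ordStratum_eq`); for `m > ℓ` Hensel's lemma shows that it is a union of affine bundles over
the product of `𝔾ₘ` with the strata of `{g_P = 0}` on which a given logarithmic derivative of `g_P`
is the first one that does not vanish (`cls_ordStratum_eq_sum`).

The action of `𝔾ₘ` on these bases depends on `κ`, their classes do not
(`WPres.cls_eq_of_same_equations`): the base is invariant under the torus with weights `(1, -1, 0)`,
which splits off an invertible coordinate and allows to absorb the difference of two actions.

It remains to sum powers of `𝕃` and `T` over all `κ` with a given set `P`. The vectors
`κ + a (1, -1, 0)` have the same `P` and `ℓ`, and those with nonnegative `x`-orders and positive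
`y`-orders form a half-open interval `0 ≤ a < b`, where `b` is a minimum of coordinates. After a
subdivision into cones on which all relevant linear forms have constant sign, the sum is one over
lattice points `(u, a)` with `u` in an open orthant and `0 ≤ a < b(u)` for a linear form `b`, and
such a sum has the limit zero (`SumLim.half_open`): the Euler characteristic with compact supports
of a half-open interval vanishes.
-/

noncomputable section

namespace MotivicMilnor

/-! ### Varieties presented by weighted equations -/

section Presentations

variable {k : Type u} [Field k]

/-- The global functions of a `k`-scheme form a `k`-algebra. -/
instance funAlgebra (T : KSch k) : Algebra k (Fun T) := (str T).toAlgebra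

lemma pull_str {T T' : KSch k} (f : T' ⟶ T) : (pull f).comp (str T) = str T' := by
  have h := Over.w f
  have h2 := specIso_inv_comp (CommRingCat.ofHom (algebraMap k k)) (f.left ≫ T.hom)
  refine RingHom.ext fun a => ?_
  have h3 : T'.hom.appTop = (f.left ≫ T.hom).appTop := by
    have : T'.hom = f.left ≫ T.hom := h.symm
    rw [this]
  change f.left.appTop.hom (T.hom.appTop.hom _) = T'.hom.appTop.hom _
  rw [h3, Scheme.Hom.comp_appTop]
  rfl

/-- Pullback of functions as a homomorphism of `k`-algebras. -/
def pullAlg {T T' : KSch k} (f : T' ⟶ T) : Fun T →ₐ[k] Fun T' :=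
  { pull f with commutes' := fun a => RingHom.congr_fun (pull_str f) a }

lemma pullAlg_apply {T T' : KSch k} (f : T' ⟶ T) (a : Fun T) : pullAlg f a = pull f a := rfl

/-- The homomorphism of `k`-algebras corresponding to a morphism to an affine scheme. -/
def toFunAlg {A : Type u} [CommRing A] [Algebra k A] {T : KSch k} (x : T ⟶ SpecK k A) :
    A →ₐ[k] Fun T :=
  { toFun x with commutes' := fun a => RingHom.congr_fun (toFun_algebraMap x) a }

lemma toFunAlg_apply {A : Type u} [CommRing A] [Algebra k A] {T : KSch k} (x : T ⟶ SpecK k A)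
    (a : A) : toFunAlg x a = toFun x a := rfl

/-- The morphism to an affine scheme corresponding to a homomorphism of `k`-algebras. -/
def ofFunAlg {A : Type u} [CommRing A] [Algebra k A] {T : KSch k} (ψ : A →ₐ[k] Fun T) :
    T ⟶ SpecK k A :=
  ofFun ψ.toRingHom ψ.comp_algebraMap

lemma toFunAlg_ofFunAlg {A : Type u} [CommRing A] [Algebra k A] {T : KSch k}
    (ψ : A →ₐ[k] Fun T) : toFunAlg (ofFunAlg ψ) = ψ :=
  AlgHom.ext fun a => RingHom.congr_fun (toFun_ofFun ψ.toRingHom ψ.comp_algebraMap) a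

lemma toFunAlg_ext {A : Type u} [CommRing A] [Algebra k A] {T : KSch k} {x y : T ⟶ SpecK k A}
    (h : toFunAlg x = toFunAlg y) : x = y :=
  toFun_ext (RingHom.ext fun a => DFunLike.congr_fun h a)

variable {σ τ : Type}

lemma aeval_comp_algHom {B B' : Type*} [CommRing B] [Algebra k B] [CommRing B']
    [Algebra k B'] (f : B →ₐ[k] B') (x : σ → B) (p : MvPolynomial σ k) :
    MvPolynomial.aeval (fun i => f (x i)) p = f (MvPolynomial.aeval x p) :=
  (MvPolynomial.comp_aeval_apply x f p).symm

/-- The one-parameter group with weights `wt` acting on the coordinates of affine space. -/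
def torus {B : Type u} [CommRing B] (wt : σ → ℤ) (a : Bˣ) (x : σ → B) : σ → B :=
  fun i => ((a ^ wt i : Bˣ) : B) * x i

/-- The polynomial `f` is homogeneous of degree `d` for the weights `wt`. This is expressed
through its values, on points with coordinates in any `k`-algebra. -/
def Homog (wt : σ → ℤ) (f : MvPolynomial σ k) (d : ℤ) : Prop :=
  ∀ (B : Type u) [CommRing B] [Algebra k B] (a : Bˣ) (x : σ → B),
    MvPolynomial.aeval (torus wt a x) f = ((a ^ d : Bˣ) : B) * MvPolynomial.aeval x f

lemma Homog.mul {wt : σ → ℤ} {f f' : MvPolynomial σ k} {d d' : ℤ} (h : Homog wt f d)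
    (h' : Homog wt f' d') : Homog wt (f * f') (d + d') := by
  intro B _ _ a x
  rw [map_mul, map_mul, h, h', zpow_add, Units.val_mul]
  ring

lemma Homog.X (wt : σ → ℤ) (i : σ) : Homog (k := k) wt (MvPolynomial.X i) (wt i) := by
  intro B _ _ a x
  rw [MvPolynomial.aeval_X, MvPolynomial.aeval_X, torus]

lemma Homog.one (wt : σ → ℤ) : Homog (k := k) wt 1 0 := by
  intro B _ _ a x
  simp

lemma Homog.sum {ι : Type*} (s : Finset ι) {wt : σ → ℤ} {f : ι → MvPolynomial σ k} {d : ℤ}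
    (h : ∀ i ∈ s, Homog wt (f i) d) : Homog wt (∑ i ∈ s, f i) d := by
  intro B _ _ a x
  rw [map_sum, map_sum, Finset.mul_sum]
  exact Finset.sum_congr rfl fun i hi => h i hi B a x

lemma Homog.prod {ι : Type*} (s : Finset ι) {wt : σ → ℤ} {f : ι → MvPolynomial σ k} {d : ι → ℤ}
    (h : ∀ i ∈ s, Homog wt (f i) (d i)) : Homog wt (∏ i ∈ s, f i) (∑ i ∈ s, d i) := by
  classical
  induction s using Finset.induction_on with
  | empty => simpa using Homog.one wt
  | insert i s hi ih =>
    rw [Finset.prod_insert hi, Finset.sum_insert hi]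
    exact (h i (Finset.mem_insert_self i s)).mul
      (ih fun j hj => h j (Finset.mem_insert_of_mem hj))

/-- An affine variety over `𝔾ₘ` with a linear `𝔾ₘ`-action, presented inside the affine space
with coordinates `σ`: the locus where the polynomials `eqs` vanish and `gm * inv` is invertible.
The group acts through the weights `wt`, and `gm`, homogeneous of degree `n > 0`, is the morphism
to `𝔾ₘ`. -/
structure WPres (k : Type u) [Field k] (σ : Type) where
  wt : σ → ℤ
  eqs : Set (MvPolynomial σ k)
  inv : MvPolynomial σ k
  gm : MvPolynomial σ k
  n : ℕ
  n_pos : 0 < n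
  eqs_homog : ∀ f ∈ eqs, ∃ d, Homog wt f d
  inv_homog : ∃ d, Homog wt inv d
  gm_homog : Homog wt gm n

namespace WPres

/-- Points of a presented variety with coordinates in a `k`-algebra. -/
structure IsPt (D : WPres k σ) {B : Type u} [CommRing B] [Algebra k B] (x : σ → B) : Prop where
  eqs : ∀ f ∈ D.eqs, MvPolynomial.aeval x f = 0
  gm : IsUnit (MvPolynomial.aeval x D.gm)
  inv : IsUnit (MvPolynomial.aeval x D.inv)

lemma IsPt.torus {D : WPres k σ} {B : Type u} [CommRing B] [Algebra k B] {x : σ → B}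
    (h : D.IsPt x) (a : Bˣ) : D.IsPt (torus D.wt a x) where
  eqs f hf := by
    obtain ⟨d, hd⟩ := D.eqs_homog f hf
    rw [hd, h.eqs f hf, mul_zero]
  gm := by
    rw [D.gm_homog]
    exact (Units.isUnit _).mul h.gm
  inv := by
    obtain ⟨d, hd⟩ := D.inv_homog
    rw [hd]
    exact (Units.isUnit _).mul h.inv

lemma IsPt.map {D : WPres k σ} {B B' : Type u} [CommRing B] [Algebra k B] [CommRing B']
    [Algebra k B'] {x : σ → B} (h : D.IsPt x) (f : B →ₐ[k] B') : D.IsPt (fun i => f (x i)) := by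
  have e := fun p : MvPolynomial σ k => aeval_comp_algHom f x p
  exact ⟨fun p hp => by rw [e, h.eqs p hp, map_zero], by rw [e]; exact h.gm.map f,
    by rw [e]; exact h.inv.map f⟩

/-- The coordinate ring of a presented variety. -/
abbrev Ring (D : WPres k σ) : Type u :=
  Localization.Away (Ideal.Quotient.mk (Ideal.span D.eqs) (D.gm * D.inv))

/-- The restriction of polynomials to a presented variety. -/
def res (D : WPres k σ) : MvPolynomial σ k →ₐ[k] D.Ring :=
  (IsScalarTower.toAlgHom k (MvPolynomial σ k ⧸ Ideal.span D.eqs) D.Ring).comp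
    (Ideal.Quotient.mkₐ k (Ideal.span D.eqs))

/-- The universal point of a presented variety. -/
def univ (D : WPres k σ) (i : σ) : D.Ring := D.res (MvPolynomial.X i)

lemma aeval_univ (D : WPres k σ) (p : MvPolynomial σ k) :
    MvPolynomial.aeval D.univ p = D.res p :=
  (DFunLike.congr_fun (MvPolynomial.aeval_unique D.res) p).symm

lemma isPt_univ (D : WPres k σ) : D.IsPt D.univ := by
  have h : IsUnit (D.res (D.gm * D.inv)) :=
    IsLocalization.Away.algebraMap_isUnit
      (Ideal.Quotient.mk (Ideal.span D.eqs) (D.gm * D.inv))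
  have h := (map_mul D.res D.gm D.inv) ▸ h
  refine ⟨fun f hf => ?_, ?_, ?_⟩
  · rw [aeval_univ]
    change algebraMap _ D.Ring (Ideal.Quotient.mk (Ideal.span D.eqs) f) = 0
    rw [Ideal.Quotient.eq_zero_iff_mem.2 (Ideal.subset_span hf), map_zero]
  · rw [aeval_univ]
    exact isUnit_of_mul_isUnit_left h
  · rw [aeval_univ]
    exact isUnit_of_mul_isUnit_right h

lemma ringHom_ext {B : Type*} [CommRing B] (D : WPres k σ) {φ ψ : D.Ring →+* B}
    (h0 : ∀ a : k, φ (algebraMap k _ a) = ψ (algebraMap k _ a))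
    (h : ∀ i, φ (D.univ i) = ψ (D.univ i)) : φ = ψ := by
  refine IsLocalization.ringHom_ext (Submonoid.powers
      (Ideal.Quotient.mk (Ideal.span D.eqs) (D.gm * D.inv))) ?_
  exact Ideal.Quotient.ringHom_ext (MvPolynomial.ringHom_ext (fun a => h0 a) h)

lemma algHom_ext {B : Type*} [CommRing B] [Algebra k B] (D : WPres k σ) {φ ψ : D.Ring →ₐ[k] B}
    (h : ∀ i, φ (D.univ i) = ψ (D.univ i)) : φ = ψ :=
  AlgHom.ext fun a => RingHom.congr_fun (D.ringHom_ext (φ := φ.toRingHom) (ψ := ψ.toRingHom)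
    (fun a => by simp) h) a

lemma lift_aux (D : WPres k σ) {B : Type u} [CommRing B] [Algebra k B] (x : σ → B)
    (h : D.IsPt x) (p : MvPolynomial σ k) (hp : p ∈ Ideal.span D.eqs) :
    MvPolynomial.aeval x p = 0 := by
  have h2 : Ideal.span D.eqs ≤ RingHom.ker (MvPolynomial.aeval (R := k) x) :=
    Ideal.span_le.2 fun f hf => h.eqs f hf
  exact h2 hp

/-- The evaluation at a point. -/
def lift (D : WPres k σ) {B : Type u} [CommRing B] [Algebra k B] (x : σ → B)
    (h : D.IsPt x) : D.Ring →ₐ[k] B :=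
  IsLocalization.liftAlgHom
    (M := Submonoid.powers (Ideal.Quotient.mk (Ideal.span D.eqs) (D.gm * D.inv)))
    (f := Ideal.Quotient.liftₐ (Ideal.span D.eqs) (MvPolynomial.aeval x) (D.lift_aux x h)) (by
      rintro ⟨_, n, rfl⟩
      rw [map_pow]
      refine IsUnit.pow n ?_
      change IsUnit (MvPolynomial.aeval x (D.gm * D.inv))
      rw [map_mul]
      exact h.gm.mul h.inv)

lemma lift_res (D : WPres k σ) {B : Type u} [CommRing B] [Algebra k B] (x : σ → B)
    (h : D.IsPt x) (p : MvPolynomial σ k) : D.lift x h (D.res p) = MvPolynomial.aeval x p :=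
  IsLocalization.lift_eq _ _

lemma lift_univ (D : WPres k σ) {B : Type u} [CommRing B] [Algebra k B] (x : σ → B)
    (h : D.IsPt x) (i : σ) : D.lift x h (D.univ i) = x i := by
  rw [univ, lift_res, MvPolynomial.aeval_X]

/-- The variable of a ring of Laurent polynomials, as a unit. -/
def laurentUnit (A : Type u) [CommRing A] : (A[T;T⁻¹])ˣ :=
  ⟨LaurentPolynomial.T 1, LaurentPolynomial.T (-1), by rw [← LaurentPolynomial.T_add]; simp,
    by rw [← LaurentPolynomial.T_add]; simp⟩

lemma laurentUnit_zpow (A : Type u) [CommRing A] (n : ℤ) :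
    ((laurentUnit A ^ n : (A[T;T⁻¹])ˣ) : A[T;T⁻¹]) = LaurentPolynomial.T n := by
  rcases n with n | n
  · simp [laurentUnit, LaurentPolynomial.T_pow]
  · rw [zpow_negSucc, ← inv_pow, Units.val_pow_eq_pow_val]
    change LaurentPolynomial.T (-1) ^ (n + 1) = _
    rw [LaurentPolynomial.T_pow]
    congr 1
    rw [Int.negSucc_eq]
    push_cast
    ring

/-- The coaction on a presented variety: the coordinate `i` has degree `wt i`. -/
def ρ (D : WPres k σ) : D.Ring →ₐ[k] D.Ring[T;T⁻¹] :=
  D.lift _ ((D.isPt_univ.map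
    (IsScalarTower.toAlgHom k D.Ring D.Ring[T;T⁻¹])).torus (laurentUnit D.Ring))

lemma ρ_univ (D : WPres k σ) (i : σ) : D.ρ (D.univ i) =
    LaurentPolynomial.C (D.univ i) * LaurentPolynomial.T (D.wt i) := by
  rw [ρ, lift_univ]
  simp only [torus]
  rw [laurentUnit_zpow]
  exact mul_comm _ _

lemma ρ_res (D : WPres k σ) (f : MvPolynomial σ k) (d : ℤ) (h : Homog D.wt f d) : D.ρ (D.res f) =
    LaurentPolynomial.C (D.res f) * LaurentPolynomial.T d := by
  rw [ρ, lift_res, h, laurentUnit_zpow, aeval_comp_algHom, aeval_univ]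
  exact mul_comm _ _

/-- The coaction on the coordinate ring of a presented variety. -/
def coaction (D : WPres k σ) : Coaction k D.Ring where
  ρ := D.ρ
  counit := D.ringHom_ext (fun a => by
      change LaurentPolynomial.eval₂ _ _ (D.ρ (algebraMap k _ a)) = _
      rw [AlgHom.commutes, IsScalarTower.algebraMap_apply k D.Ring,
        LaurentPolynomial.algebraMap_apply, LaurentPolynomial.eval₂_C]
      rfl) (fun i => by
      change LaurentPolynomial.eval₂ _ _ (D.ρ _) = _
      rw [ρ_univ, LaurentPolynomial.eval₂_C_mul_T]
      simp)
  coassoc B _ φ a b := D.ringHom_ext (fun x => by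
      change LaurentPolynomial.eval₂ _ _ (D.ρ (algebraMap k _ x)) =
        LaurentPolynomial.eval₂ _ _ (D.ρ (algebraMap k _ x))
      rw [AlgHom.commutes, IsScalarTower.algebraMap_apply k D.Ring D.Ring[T;T⁻¹],
        LaurentPolynomial.algebraMap_apply, LaurentPolynomial.eval₂_C, LaurentPolynomial.eval₂_C]
      change LaurentPolynomial.eval₂ _ _ (D.ρ (algebraMap k _ x)) = _
      rw [AlgHom.commutes, IsScalarTower.algebraMap_apply k D.Ring D.Ring[T;T⁻¹],
        LaurentPolynomial.algebraMap_apply, LaurentPolynomial.eval₂_C]) (fun i => by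
      change LaurentPolynomial.eval₂ _ _ (D.ρ _) = LaurentPolynomial.eval₂ _ _ (D.ρ _)
      rw [ρ_univ, LaurentPolynomial.eval₂_C_mul_T, LaurentPolynomial.eval₂_C_mul_T]
      change LaurentPolynomial.eval₂ _ _ (D.ρ _) * _ = _
      rw [ρ_univ, LaurentPolynomial.eval₂_C_mul_T, mul_zpow, Units.val_mul]
      ring)

lemma isUnit_res_gm (D : WPres k σ) : IsUnit (D.res D.gm) := by
  have := D.isPt_univ.gm
  rwa [aeval_univ] at this

/-- The object of the Grothendieck group defined by a presentation. -/
def var [Finite σ] (D : WPres k σ) : GmVar (SpecK k k) :=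
  GmVar.ofCoaction D.coaction (Algebra.ofId k D.Ring) (fun x => by
      change D.ρ (algebraMap k _ x) = LaurentPolynomial.C (algebraMap k _ x)
      rw [AlgHom.commutes, IsScalarTower.algebraMap_apply k D.Ring D.Ring[T;T⁻¹],
        LaurentPolynomial.algebraMap_apply]
      rfl)
    D.isUnit_res_gm.unit D.n D.n_pos (D.ρ_res D.gm D.n D.gm_homog)

/-- A `T`-valued point as a homomorphism from the coordinate ring. -/
def ptHom [Finite σ] (D : WPres k σ) {T : KSch k} (y : T ⟶ D.var.X) : D.Ring →ₐ[k] Fun T :=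
  toFunAlg (A := D.Ring) y

/-- The coordinates of a `T`-valued point. -/
def coord [Finite σ] (D : WPres k σ) {T : KSch k} (y : T ⟶ D.var.X) (i : σ) : Fun T :=
  D.ptHom y (D.univ i)

lemma isPt_coord [Finite σ] (D : WPres k σ) {T : KSch k} (y : T ⟶ D.var.X) :
    D.IsPt (D.coord y) :=
  D.isPt_univ.map (D.ptHom y)

lemma aeval_coord [Finite σ] (D : WPres k σ) {T : KSch k} (y : T ⟶ D.var.X)
    (p : MvPolynomial σ k) :
    MvPolynomial.aeval (D.coord y) p = D.ptHom y (D.res p) := by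
  rw [← aeval_univ]
  exact aeval_comp_algHom (D.ptHom y) D.univ p

lemma coord_ext [Finite σ] (D : WPres k σ) {T : KSch k} {y y' : T ⟶ D.var.X}
    (h : ∀ i, D.coord y i = D.coord y' i) : y = y' :=
  toFunAlg_ext (A := D.Ring) (D.algHom_ext h)

lemma coord_smul [Finite σ] (D : WPres k σ) {T : KSch k} (a : (Fun T)ˣ) (y : T ⟶ D.var.X) :
    D.coord (D.var.act.smul a y) = torus D.wt a (D.coord y) := by
  funext i
  refine (RingHom.congr_fun (Coaction.toFun_act D.coaction a y) (D.univ i)).trans ?_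
  change LaurentPolynomial.eval₂ (D.ptHom y).toRingHom _ (D.ρ (D.univ i)) = _
  rw [ρ_univ, LaurentPolynomial.eval₂_C_mul_T, mul_comm]
  rfl

lemma coord_comp [Finite σ] (D : WPres k σ) {T T' : KSch k} (f : T' ⟶ T) (y : T ⟶ D.var.X)
    (i : σ) : D.coord (f ≫ y) i = pull f (D.coord y i) :=
  RingHom.congr_fun (toFun_comp (A := D.Ring) f y) (D.univ i)

/-- The `T`-valued point with given coordinates. -/
def ofPt [Finite σ] (D : WPres k σ) {T : KSch k} (x : σ → Fun T) (h : D.IsPt x) : T ⟶ D.var.X :=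
  ofFunAlg (A := D.Ring) (D.lift x h)

lemma coord_ofPt [Finite σ] (D : WPres k σ) {T : KSch k} (x : σ → Fun T) (h : D.IsPt x) :
    D.coord (D.ofPt x h) = x := by
  funext i
  change toFunAlg (ofFunAlg (A := D.Ring) (D.lift x h)) (D.univ i) = _
  rw [toFunAlg_ofFunAlg, lift_univ]

lemma pullU_toGm [Finite σ] (D : WPres k σ) {T : KSch k} (y : T ⟶ D.var.X) :
    ((pullU y D.var.toGm : (Fun T)ˣ) : Fun T) = MvPolynomial.aeval (D.coord y) D.gm := by
  rw [aeval_coord]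
  rfl

end WPres

end Presentations

/-! ### Relations between classes of presented varieties -/

section PresentedClasses

variable {k : Type u} [Field k] {σ τ : Type}

lemma Mot.cls_eq_smul {S : KSch k} (X : GmVar S) (e : ℤ) :
    Mot.cls X e = (LaurentPolynomial.T e : ℤ[T;T⁻¹]) • Mot.cls X 0 := by
  rw [Mot.T_smul_cls, zero_add]

namespace WPres

/-- A morphism to a presented variety, given by its coordinates. -/
def homTo [Finite σ] (Y : GmVar (SpecK k k)) (D : WPres k σ) (x : σ → Fun Y.X) (hx : D.IsPt x)
    (hn : Y.weight = D.n)
    (heq : ∀ {T : KSch k} (a : (Fun T)ˣ) (y : T ⟶ Y.X) (i : σ),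
      pull (Y.act.smul a y) (x i) = ((a ^ D.wt i : (Fun T)ˣ) : Fun T) * pull y (x i))
    (hgm : MvPolynomial.aeval x D.gm = (Y.toGm : Fun Y.X)) : Y.Hom D.var where
  hom := D.ofPt x hx
  weight_eq := hn
  equivariant a y := D.coord_ext fun i => by
    rw [coord_comp, coord_ofPt, coord_smul, torus, coord_comp, coord_ofPt, heq]
  over_base := toFunAlg_ext (A := k) (Subsingleton.elim _ _)
  over_gm := Units.ext (by rw [pullU_toGm, coord_ofPt, hgm])

/-- A variety with functions `x` and `v` is `D × 𝔸^κ` as soon as its points are described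
uniquely by the coordinates `x`, satisfying the equations of `D`, and by the coordinates `v`, on
which the action is diagonal. -/
lemma cls_eq_of_coords [Finite σ] {κ : Type} [Fintype κ] (Y : GmVar (SpecK k k)) (D : WPres k σ)
    (x : σ → Fun Y.X) (v : κ → Fun Y.X) (hx : D.IsPt x) (hn : Y.weight = D.n)
    (heq : ∀ {T : KSch k} (a : (Fun T)ˣ) (y : T ⟶ Y.X) (i : σ),
      pull (Y.act.smul a y) (x i) = ((a ^ D.wt i : (Fun T)ˣ) : Fun T) * pull y (x i))
    (hgm : MvPolynomial.aeval x D.gm = (Y.toGm : Fun Y.X)) (d : κ → ℤ)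
    (hd : ∀ {T : KSch k} (a : (Fun T)ˣ) (y : T ⟶ Y.X) (j : κ),
      pull (Y.act.smul a y) (v j) = ((a ^ d j : (Fun T)ˣ) : Fun T) * pull y (v j))
    (hbij : ∀ {T : KSch k} (x' : σ → Fun T) (w : κ → Fun T), D.IsPt x' →
      ∃! y : T ⟶ Y.X, (∀ i, pull y (x i) = x' i) ∧ ∀ j, pull y (v j) = w j) :
    Mot.cls Y 0 =
      (LaurentPolynomial.T (Fintype.card κ : ℤ) : ℤ[T;T⁻¹]) • Mot.cls D.var 0 := by
  classical
  let E := Fintype.equivFin κ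
  have h : IsAffineLift (homTo Y D x hx hn heq hgm) (fun i => v (E.symm i)) := by
    constructor
    · intro T
      constructor
      · intro y y' hy
        obtain ⟨h1, h2⟩ := Prod.mk.inj hy
        refine (hbij (D.coord (y ≫ D.ofPt x hx)) (fun j => pull y (v j))
          (D.isPt_coord _)).unique ⟨fun i => ?_, fun j => rfl⟩ ⟨fun i => ?_, fun j => ?_⟩
        · rw [coord_comp, coord_ofPt]
        · change y ≫ D.ofPt x hx = y' ≫ D.ofPt x hx at h1
          rw [h1, coord_comp, coord_ofPt]
        · have := congrFun h2 (E j)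
          simp only [Equiv.symm_apply_apply] at this
          exact this.symm
      · rintro ⟨x', w⟩
        obtain ⟨y, ⟨h1, h2⟩, -⟩ := hbij (D.coord x') (fun j => w (E j)) (D.isPt_coord _)
        refine ⟨y, Prod.ext (D.coord_ext fun i => ?_) (funext fun i => ?_)⟩
        · change D.coord (y ≫ D.ofPt x hx) i = _
          rw [coord_comp, coord_ofPt, h1]
        · change pull y (v (E.symm i)) = _
          rw [h2, Equiv.apply_symm_apply]
    · intro T a x'
      refine ⟨Matrix.diagonal fun i => ((a ^ d (E.symm i) : (Fun T)ˣ) : Fun T), 0,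
        fun y _ => ?_⟩
      funext i
      rw [hd, add_zero, Matrix.mulVec_diagonal]
  have h2 := Mot.cls_affine D.var Y _ _ _ h 0
  rw [sub_eq_zero, zero_add, Mot.cls_eq_smul D.var] at h2
  exact h2

lemma _root_.MotivicMilnor.Homog.rescale {wt : σ → ℤ} {f : MvPolynomial σ k} {d : ℤ}
    (h : Homog wt f d) (r : ℤ) : Homog (fun i => r * wt i) f (r * d) := by
  intro B _ _ a x
  rw [zpow_mul, ← h]
  congr 2
  funext i
  rw [torus, torus, zpow_mul]

/-- The class of a presented variety. -/
def cls [Finite σ] (D : WPres k σ) : Mot (SpecK k k) := Mot.cls D.var 0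

/-- If the points of `D'` are described uniquely by the values of `F`, satisfying the equations of
`D`, and by some of the coordinates, then `D'` is an affine bundle over `D`. -/
lemma cls_eq_of_bundle [Finite σ] [Finite τ] {κ : Type} [Fintype κ] (D' : WPres k τ) (D : WPres k σ)
    (F : ∀ (B : Type u) [CommRing B] [Algebra k B], (τ → B) → σ → B) (c : κ → τ)
    (hn : D'.n = D.n)
    (hF : ∀ (B : Type u) [CommRing B] [Algebra k B] (y : τ → B), D'.IsPt y → D.IsPt (F B y))
    (hnat : ∀ (B B' : Type u) [CommRing B] [Algebra k B] [CommRing B'] [Algebra k B']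
      (f : B →ₐ[k] B') (y : τ → B), D'.IsPt y → ∀ i, F B' (fun j => f (y j)) i = f (F B y i))
    (heq : ∀ (B : Type u) [CommRing B] [Algebra k B] (a : Bˣ) (y : τ → B), D'.IsPt y →
      F B (torus D'.wt a y) = torus D.wt a (F B y))
    (hgm : ∀ (B : Type u) [CommRing B] [Algebra k B] (y : τ → B), D'.IsPt y →
      MvPolynomial.aeval (F B y) D.gm = MvPolynomial.aeval y D'.gm)
    (hbij : ∀ (B : Type u) [CommRing B] [Algebra k B] (x : σ → B) (w : κ → B), D.IsPt x →
      ∃! y : τ → B, D'.IsPt y ∧ F B y = x ∧ ∀ j, y (c j) = w j) :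
    D'.cls = (LaurentPolynomial.T (Fintype.card κ : ℤ) : ℤ[T;T⁻¹]) • D.cls := by
  let y₀ : τ → Fun D'.var.X := D'.coord (𝟙 D'.var.X)
  have hy₀ : D'.IsPt y₀ := D'.isPt_coord _
  have e0 : ∀ {T : KSch k} (y : T ⟶ D'.var.X) (j : τ), pull y (y₀ j) = D'.coord y j := by
    intro T y j
    rw [← coord_comp, Category.comp_id]
  have e1 : ∀ {T : KSch k} (y : T ⟶ D'.var.X) (i : σ),
      pull y (F _ y₀ i) = F _ (D'.coord y) i := by
    intro T y i
    rw [← pullAlg_apply, ← hnat _ _ (pullAlg y) y₀ hy₀]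
    congr 1
  refine cls_eq_of_coords D'.var D (F _ y₀) (fun j => y₀ (c j)) (hF _ _ hy₀) hn ?_ ?_
    (fun j => D'.wt (c j)) ?_ ?_
  · intro T a y i
    rw [e1, e1, coord_smul, heq _ _ _ (D'.isPt_coord y), torus]
  · rw [hgm _ _ hy₀, ← pullU_toGm, pullU]
    simp [pull_id]
  · intro T a y j
    rw [e0, e0, coord_smul, torus]
  · intro T x' w hx'
    obtain ⟨y, ⟨h1, h2, h3⟩, h4⟩ := hbij _ x' w hx'
    refine ⟨D'.ofPt y h1, ⟨fun i => ?_, fun j => ?_⟩, fun y' hy' => ?_⟩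
    · rw [e1, coord_ofPt, h2]
    · rw [e0, coord_ofPt, h3]
    · refine D'.coord_ext fun j => ?_
      rw [coord_ofPt]
      refine congrFun (h4 (D'.coord y') ⟨D'.isPt_coord _, funext fun i => ?_, fun j => ?_⟩) j
      · rw [← e1, hy'.1]
      · rw [← e0, hy'.2]

/-- Presentations with the same coordinates, the same weights and the same points have the same
class. -/
lemma cls_congr [Finite σ] (D D' : WPres k σ) (hwt : D'.wt = D.wt) (hn : D'.n = D.n)
    (hgm : D'.gm = D.gm)
    (hpt : ∀ (B : Type u) [CommRing B] [Algebra k B] (x : σ → B), D'.IsPt x ↔ D.IsPt x) :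
    D'.cls = D.cls := by
  have h := cls_eq_of_bundle (κ := Empty) D' D (fun _ _ _ y => y) Empty.elim hn
    (fun B _ _ y hy => (hpt B y).1 hy) (fun _ _ _ _ _ _ _ _ _ _ => rfl)
    (fun _ _ _ _ _ _ => by rw [hwt]) (fun _ _ _ _ _ => by rw [hgm])
    (fun B _ _ x w hx => ⟨x, ⟨(hpt B x).2 hx, rfl, fun j => j.elim⟩, fun y hy => hy.2.1⟩)
  simpa using h

/-- The closed subvariety where `f` vanishes. -/
def addEq (D : WPres k σ) (f : MvPolynomial σ k) (hf : ∃ d, Homog D.wt f d) : WPres k σ where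
  wt := D.wt
  eqs := insert f D.eqs
  inv := D.inv
  gm := D.gm
  n := D.n
  n_pos := D.n_pos
  eqs_homog := by
    rintro f' (rfl | h)
    · exact hf
    · exact D.eqs_homog f' h
  inv_homog := D.inv_homog
  gm_homog := D.gm_homog

/-- The open subvariety where `f` is invertible. -/
def addInv (D : WPres k σ) (f : MvPolynomial σ k) (hf : ∃ d, Homog D.wt f d) : WPres k σ where
  wt := D.wt
  eqs := D.eqs
  inv := D.inv * f
  gm := D.gm
  n := D.n
  n_pos := D.n_pos
  eqs_homog := D.eqs_homog
  inv_homog := by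
    obtain ⟨d, hd⟩ := D.inv_homog
    obtain ⟨d', hd'⟩ := hf
    exact ⟨_, hd.mul hd'⟩
  gm_homog := D.gm_homog

lemma isPt_addEq {D : WPres k σ} {f : MvPolynomial σ k} {hf : ∃ d, Homog D.wt f d}
    {B : Type u} [CommRing B] [Algebra k B] {x : σ → B} :
    (D.addEq f hf).IsPt x ↔ D.IsPt x ∧ MvPolynomial.aeval x f = 0 :=
  ⟨fun h => ⟨⟨fun p hp => h.eqs p (Set.mem_insert_of_mem f hp), h.gm, h.inv⟩,
    h.eqs f (Set.mem_insert f D.eqs)⟩,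
    fun h => ⟨by
      rintro p (rfl | hp)
      · exact h.2
      · exact h.1.eqs p hp, h.1.gm, h.1.inv⟩⟩

lemma isPt_addInv {D : WPres k σ} {f : MvPolynomial σ k} {hf : ∃ d, Homog D.wt f d}
    {B : Type u} [CommRing B] [Algebra k B] {x : σ → B} :
    (D.addInv f hf).IsPt x ↔ D.IsPt x ∧ IsUnit (MvPolynomial.aeval x f) := by
  constructor
  · intro h
    have h2 : IsUnit (MvPolynomial.aeval x (D.inv * f)) := h.inv
    rw [map_mul, IsUnit.mul_iff] at h2
    exact ⟨⟨h.eqs, h.gm, h2.1⟩, h2.2⟩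
  · intro h
    refine ⟨h.1.eqs, h.1.gm, ?_⟩
    change IsUnit (MvPolynomial.aeval x (D.inv * f))
    rw [map_mul]
    exact h.1.inv.mul h.2

/-- The inclusion of a subvariety given by additional conditions. -/
def inclHom [Finite σ] (D' D : WPres k σ) (hwt : D'.wt = D.wt) (hn : D'.n = D.n)
    (hgm : D'.gm = D.gm) (h : D.IsPt D'.univ) : D'.var.Hom D.var :=
  homTo D'.var D (D'.coord (𝟙 D'.var.X)) (h.map (D'.ptHom (𝟙 D'.var.X))) hn
    (fun a y i => by
      rw [← coord_comp, ← coord_comp, Category.comp_id, Category.comp_id, coord_smul, torus, hwt])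
    (by
      rw [← hgm, ← pullU_toGm, pullU]
      simp [pull_id])

lemma inclHom_left [Finite σ] (D' D : WPres k σ) (hwt : D'.wt = D.wt) (hn : D'.n = D.n)
    (hgm : D'.gm = D.gm) (h : D.IsPt D'.univ) :
    (inclHom D' D hwt hn hgm h).hom = SpecK.map (D.lift D'.univ h) := by
  refine D.coord_ext fun i => ?_
  refine (congrFun (D.coord_ofPt (T := D'.var.X) (D'.coord (𝟙 D'.var.X)) _) i).trans ?_
  have h1 : D.coord (T := SpecK k D'.Ring) (SpecK.map (D.lift D'.univ h)) i =
      toFun (𝟙 (SpecK k D'.Ring) ≫ SpecK.map (D.lift D'.univ h)) (D.univ i) := by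
    rw [Category.id_comp]
    rfl
  refine Eq.trans ?_ h1.symm
  rw [toFun_map]
  exact congrArg (toFun (𝟙 (SpecK k D'.Ring))) (D.lift_univ _ h i).symm

lemma lift_addEq_surjective (D : WPres k σ) (f : MvPolynomial σ k) (hf : ∃ d, Homog D.wt f d) :
    Function.Surjective
      (D.lift (D.addEq f hf).univ (isPt_addEq.1 (D.addEq f hf).isPt_univ).1) := by
  intro z
  obtain ⟨⟨a, ⟨_, n, rfl⟩⟩, hz⟩ := IsLocalization.surj (Submonoid.powers
    (Ideal.Quotient.mk (Ideal.span (D.addEq f hf).eqs) ((D.addEq f hf).gm * (D.addEq f hf).inv))) z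
  obtain ⟨a, rfl⟩ := Ideal.Quotient.mk_surjective a
  let φ := D.lift (D.addEq f hf).univ (isPt_addEq.1 (D.addEq f hf).isPt_univ).1
  have h1 : ∀ p, φ (D.res p) = (D.addEq f hf).res p := by
    intro p
    simp only [φ]
    rw [lift_res, aeval_univ]
  have hu : IsUnit (D.res (D.gm * D.inv)) :=
    IsLocalization.Away.algebraMap_isUnit (Ideal.Quotient.mk (Ideal.span D.eqs) (D.gm * D.inv))
  have h2 : z * (D.addEq f hf).res ((D.gm * D.inv)) ^ n = (D.addEq f hf).res a := by
    refine Eq.trans ?_ hz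
    congr 1
    exact (map_pow (algebraMap _ (D.addEq f hf).Ring) _ n).symm
  refine ⟨D.res a * ((hu.unit⁻¹ : D.Ringˣ) : D.Ring) ^ n, ?_⟩
  change φ _ = z
  rw [map_mul, map_pow, h1, ← h2, mul_assoc, ← mul_pow, ← h1, ← map_mul]
  have h3 : D.res (D.gm * D.inv) * ((hu.unit⁻¹ : D.Ringˣ) : D.Ring) = 1 := hu.mul_val_inv
  rw [h3, map_one, one_pow, mul_one]

/-- Inverting `f` is the localization of the coordinate ring at `f`. -/
lemma exists_addInv_equiv (D : WPres k σ) (f : MvPolynomial σ k) (hf : ∃ d, Homog D.wt f d) :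
    ∃ ε : Localization.Away (D.res f) ≃+* (D.addInv f hf).Ring,
      (ε : _ →+* _).comp (algebraMap D.Ring (Localization.Away (D.res f))) =
        (D.lift (D.addInv f hf).univ (isPt_addInv.1 (D.addInv f hf).isPt_univ).1).toRingHom := by
  let φ := D.lift (D.addInv f hf).univ (isPt_addInv.1 (D.addInv f hf).isPt_univ).1
  have h1 : ∀ p, φ (D.res p) = (D.addInv f hf).res p := by
    intro p
    simp only [φ]
    rw [lift_res, aeval_univ]
  have hu : IsUnit (φ (D.res f)) := by
    rw [h1, ← aeval_univ]
    exact (isPt_addInv.1 (D.addInv f hf).isPt_univ).2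
  let ψ : Localization.Away (D.res f) →+* (D.addInv f hf).Ring :=
    IsLocalization.Away.lift (g := φ.toRingHom) (D.res f) hu
  have hψ : ∀ a, ψ (algebraMap D.Ring (Localization.Away (D.res f)) a) = φ a := fun a =>
    IsLocalization.Away.lift_eq (g := φ.toRingHom) (D.res f) hu a
  let j : D.Ring →ₐ[k] Localization.Away (D.res f) := IsScalarTower.toAlgHom k _ _
  have hx : (D.addInv f hf).IsPt (fun i => j (D.univ i)) := by
    refine isPt_addInv.2 ⟨D.isPt_univ.map j, ?_⟩
    rw [aeval_comp_algHom, aeval_univ]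
    exact IsLocalization.Away.algebraMap_isUnit (D.res f)
  let χ := (D.addInv f hf).lift _ hx
  have hχ : ∀ a, χ (φ a) = j a := by
    intro a
    refine DFunLike.congr_fun (D.algHom_ext (φ := χ.comp φ) (ψ := j) fun i => ?_) a
    rw [AlgHom.comp_apply]
    simp only [φ, χ]
    rw [lift_univ, lift_univ]
  refine ⟨RingEquiv.ofRingHom ψ χ.toRingHom ?_ ?_, ?_⟩
  · refine (D.addInv f hf).ringHom_ext (fun a => ?_) (fun i => ?_)
    · change ψ (χ (algebraMap k _ a)) = algebraMap k _ a
      rw [AlgHom.commutes, IsScalarTower.algebraMap_apply k D.Ring, hψ, AlgHom.commutes]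
    · change ψ (χ _) = _
      simp only [χ]
      rw [lift_univ]
      change ψ (algebraMap _ _ _) = _
      rw [hψ]
      simp only [φ]
      rw [lift_univ]
      rfl
  · refine IsLocalization.ringHom_ext (Submonoid.powers (D.res f)) (RingHom.ext fun a => ?_)
    change χ (ψ (algebraMap _ _ a)) = algebraMap _ _ a
    rw [hψ, hχ]
    rfl
  · exact RingHom.ext hψ

lemma _root_.AlgebraicGeometry.isOpenImmersion_spec_away {R R' : Type u} [CommRing R]
    [CommRing R'] (φ : R →+* R') (f : R) (ε : Localization.Away f ≃+* R')
    (h : (ε : _ →+* _).comp (algebraMap R (Localization.Away f)) = φ) :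
    IsOpenImmersion (Spec.map (CommRingCat.ofHom φ)) ∧
      Set.range (Spec.map (CommRingCat.ofHom φ)) = (PrimeSpectrum.zeroLocus {f})ᶜ := by
  algebraize [φ]
  have : IsLocalization.Away f R' :=
    IsLocalization.isLocalization_of_algEquiv (Submonoid.powers f)
      (AlgEquiv.ofRingEquiv (f := ε) (fun r => RingHom.congr_fun h r))
  constructor
  · exact IsOpenImmersion.of_isLocalization f
  · exact (PrimeSpectrum.localization_away_comap_range R' f).trans
      (PrimeSpectrum.basicOpen_eq_zeroLocus_compl f)

lemma range_spec_addEq (D : WPres k σ) (f : MvPolynomial σ k) (hf : ∃ d, Homog D.wt f d) :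
    Set.range (Spec.map (CommRingCat.ofHom (D.lift (D.addEq f hf).univ
      (isPt_addEq.1 (D.addEq f hf).isPt_univ).1).toRingHom)) =
      PrimeSpectrum.zeroLocus {D.res f} := by
  refine (range_comap_of_surjective _ _ (D.lift_addEq_surjective f hf)).trans
    (Set.Subset.antisymm ?_ ?_)
  · intro p hp a ha
    rw [Set.mem_singleton_iff.1 ha]
    refine hp ?_
    change D.lift _ _ (D.res f) = 0
    rw [lift_res]
    exact (isPt_addEq.1 (D.addEq f hf).isPt_univ).2
  · intro p hp a ha
    have hp' : D.res f ∈ p.asIdeal := hp (Set.mem_singleton _)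
    -- the universal point of `D` modulo `p` satisfies the additional equation
    let q : D.Ring →ₐ[k] D.Ring ⧸ p.asIdeal := Ideal.Quotient.mkₐ k p.asIdeal
    have hx : (D.addEq f hf).IsPt (fun i => q (D.univ i)) := by
      refine isPt_addEq.2 ⟨D.isPt_univ.map q, ?_⟩
      rw [aeval_comp_algHom, aeval_univ]
      exact Ideal.Quotient.eq_zero_iff_mem.2 hp'
    have h1 : ((D.addEq f hf).lift _ hx).comp (D.lift (D.addEq f hf).univ
        (isPt_addEq.1 (D.addEq f hf).isPt_univ).1) = q := by
      refine D.algHom_ext fun i => ?_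
      rw [AlgHom.comp_apply, lift_univ, lift_univ]
    have h2 : q a = 0 := by
      rw [← h1, AlgHom.comp_apply]
      have : D.lift (D.addEq f hf).univ (isPt_addEq.1 (D.addEq f hf).isPt_univ).1 a = 0 := ha
      rw [this, map_zero]
    exact Ideal.Quotient.eq_zero_iff_mem.1 h2

/-- The scissor relation for the locus where a homogeneous function vanishes. -/
lemma cls_scissor [Finite σ] (D : WPres k σ) (f : MvPolynomial σ k) (hf : ∃ d, Homog D.wt f d) :
    D.cls = (D.addEq f hf).cls + (D.addInv f hf).cls := by
  let i := inclHom (D.addEq f hf) D rfl rfl rfl (isPt_addEq.1 (D.addEq f hf).isPt_univ).1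
  let j := inclHom (D.addInv f hf) D rfl rfl rfl (isPt_addInv.1 (D.addInv f hf).isPt_univ).1
  have hi : i.hom.left = Spec.map (CommRingCat.ofHom (D.lift (D.addEq f hf).univ
      (isPt_addEq.1 (D.addEq f hf).isPt_univ).1).toRingHom) :=
    congrArg CommaMorphism.left (inclHom_left _ _ _ _ _ _)
  have hj : j.hom.left = Spec.map (CommRingCat.ofHom (D.lift (D.addInv f hf).univ
      (isPt_addInv.1 (D.addInv f hf).isPt_univ).1).toRingHom) :=
    congrArg CommaMorphism.left (inclHom_left _ _ _ _ _ _)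
  obtain ⟨ε, hε⟩ := D.exists_addInv_equiv f hf
  obtain ⟨hj1, hj2⟩ := isOpenImmersion_spec_away _ (D.res f) ε hε
  have hi1 : IsClosedImmersion i.hom.left := by
    rw [hi]
    exact IsClosedImmersion.spec_of_surjective _ (D.lift_addEq_surjective f hf)
  have hr : Set.range j.hom.left = (Set.range i.hom.left)ᶜ := by
    rw [hi, hj]
    exact hj2.trans (congrArg _ (D.range_spec_addEq f hf).symm)
  have h := Mot.cls_scissor D.var _ _ i j hi1 (hj ▸ hj1) hr 0
  rw [sub_sub, sub_eq_zero] at h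
  exact h

/-- A presented variety without points has class zero. -/
lemma cls_eq_zero [Finite σ] (D : WPres k σ)
    (h : ∀ (B : Type u) [CommRing B] [Algebra k B] (x : σ → B), D.IsPt x → Subsingleton B) :
    D.cls = 0 := by
  have h1 := D.cls_scissor 1 ⟨0, Homog.one _⟩
  have h2 : (D.addEq 1 ⟨0, Homog.one _⟩).cls = D.cls := by
    refine cls_congr _ _ rfl rfl rfl fun B _ _ x => ⟨fun hx => (isPt_addEq.1 hx).1, fun hx => ?_⟩
    have := h B x hx
    exact isPt_addEq.2 ⟨hx, Subsingleton.elim _ _⟩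
  have h3 : (D.addInv 1 ⟨0, Homog.one _⟩).cls = D.cls :=
    cls_congr _ _ rfl rfl rfl fun B _ _ x => ⟨fun hx => (isPt_addInv.1 hx).1, fun hx =>
      isPt_addInv.2 ⟨hx, by rw [map_one]; exact isUnit_one⟩⟩
  rw [h2, h3] at h1
  exact left_eq_add.1 h1

lemma nonempty_algHom_algebraicClosure (K : Type u) [Field K] [Algebra k K] [Module.Finite k K] :
    Nonempty (K →ₐ[k] AlgebraicClosure k) :=
  ⟨IsAlgClosed.lift⟩

/-- A presented variety without points over the algebraic closure of `k` has class zero, by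
the Nullstellensatz. -/
lemma cls_eq_zero_of_algebraicClosure [Finite σ] (D : WPres k σ)
    (h : ∀ x : σ → AlgebraicClosure k, ¬ D.IsPt x) : D.cls = 0 := by
  refine D.cls_eq_zero fun B _ _ x hx => ?_
  by_contra hB
  have hB' : Nontrivial B := not_subsingleton_iff_nontrivial.1 hB
  have hD : Nontrivial D.Ring := (D.lift x hx).toRingHom.domain_nontrivial
  obtain ⟨m, hm⟩ := Ideal.exists_maximal D.Ring
  let _ : Field (D.Ring ⧸ m) := Ideal.Quotient.field m
  have : Module.Finite k (D.Ring ⧸ m) := finite_of_finite_type_of_isJacobsonRing k (D.Ring ⧸ m)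
  obtain ⟨f⟩ := nonempty_algHom_algebraicClosure (k := k) (D.Ring ⧸ m)
  exact h _ (D.isPt_univ.map (f.comp (Ideal.Quotient.mkₐ k m)))

/-- The presentation of the same variety with the action of `a` replaced by that of `a ^ r`. -/
def rescale (D : WPres k σ) (r : ℕ) (hr : 0 < r) : WPres k σ where
  wt i := r * D.wt i
  eqs := D.eqs
  inv := D.inv
  gm := D.gm
  n := r * D.n
  n_pos := Nat.mul_pos hr D.n_pos
  eqs_homog f hf := by
    obtain ⟨d, hd⟩ := D.eqs_homog f hf
    exact ⟨r * d, hd.rescale r⟩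
  inv_homog := by
    obtain ⟨d, hd⟩ := D.inv_homog
    exact ⟨r * d, hd.rescale r⟩
  gm_homog := by
    push_cast
    exact D.gm_homog.rescale r

lemma cls_rescale [Finite σ] (D : WPres k σ) (r : ℕ) (hr : 0 < r) :
    (D.rescale r hr).cls = D.cls := by
  have h1 := Mot.cls_rescale D.var r hr 0
  rw [sub_eq_zero] at h1
  refine Eq.trans ?_ h1
  symm
  let y₀ := D.coord (𝟙 D.var.X)
  have e0 : ∀ {T : KSch k} (y : T ⟶ D.var.X) (j : σ), pull y (y₀ j) = D.coord y j := by
    intro T y j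
    rw [← coord_comp, Category.comp_id]
  have hp : ∀ {B : Type u} [CommRing B] [Algebra k B] {x : σ → B},
      D.IsPt x ↔ (D.rescale r hr).IsPt x :=
    ⟨fun h => ⟨h.eqs, h.gm, h.inv⟩, fun h => ⟨h.eqs, h.gm, h.inv⟩⟩
  have h := cls_eq_of_coords (κ := Empty) (D.var.rescale r hr) (D.rescale r hr) y₀ Empty.elim
    (hp.1 (D.isPt_coord _)) rfl (fun {T} a y i => ?_) ?_ Empty.elim
    (fun {T} a y j => j.elim) (fun {T} x' w hx' => ?_)
  · simpa [cls] using h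
  · refine (e0 (D.var.act.smul (a ^ r) y) i).trans ((congrFun (D.coord_smul (a ^ r) y) i).trans ?_)
    refine congrArg₂ (· * ·) ?_ ?_
    · change _ = ((a ^ ((r : ℤ) * D.wt i) : (Fun T)ˣ) : Fun T)
      rw [zpow_mul, zpow_natCast]
    · exact (e0 y i).symm
  · change MvPolynomial.aeval (D.coord (𝟙 D.var.X)) D.gm = _
    rw [← pullU_toGm, pullU]
    simp only [Units.coe_map]
    exact pull_id _
  · refine ⟨D.ofPt x' (hp.2 hx'), ⟨fun i => ?_, fun j => j.elim⟩, fun y' hy' => ?_⟩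
    · refine (e0 (D.ofPt x' (hp.2 hx')) i).trans ?_
      rw [coord_ofPt]
    · refine D.coord_ext fun j => ?_
      rw [coord_ofPt]
      exact (e0 y' j).symm.trans (hy'.1 j)

end WPres
end PresentedClasses

/-! ### Independence of the class from the weights -/

section Reweighting

variable {k : Type u} [Field k] {σ : Type}

lemma torus_mul_add {B : Type u} [CommRing B] (w w' : σ → ℤ) (c : ℤ) (a : Bˣ) (x : σ → B) :
    torus (fun i => w i + c * w' i) a x = torus w a (torus w' (a ^ c) x) := by
  funext i
  simp only [torus]
  rw [zpow_add, zpow_mul, Units.val_mul, mul_assoc]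

lemma torus_mul {B : Type u} [CommRing B] (w : σ → ℤ) (a b : Bˣ) (x : σ → B) :
    torus w (a * b) x = torus w a (torus w b x) := by
  funext i
  simp only [torus]
  rw [mul_zpow, Units.val_mul, mul_assoc]

lemma torus_one {B : Type u} [CommRing B] (w : σ → ℤ) (x : σ → B) : torus w 1 x = x := by
  funext i
  simp [torus]

lemma torus_inv_torus {B : Type u} [CommRing B] (w : σ → ℤ) (a : Bˣ) (x : σ → B) :
    torus w a⁻¹ (torus w a x) = x := by
  rw [← torus_mul, inv_mul_cancel, torus_one]

lemma torus_torus_inv {B : Type u} [CommRing B] (w : σ → ℤ) (a : Bˣ) (x : σ → B) :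
    torus w a (torus w a⁻¹ x) = x := by
  rw [← torus_mul, mul_inv_cancel, torus_one]

lemma map_torus {B B' : Type u} [CommRing B] [CommRing B'] (f : B →+* B') (w : σ → ℤ) (a : Bˣ)
    (x : σ → B) (i : σ) :
    f (torus w a x i) = torus w (Units.map f.toMonoidHom a) (fun j => f (x j)) i := by
  simp only [torus]
  rw [map_mul, ← map_zpow]
  rfl

lemma Homog.add_mul {w w' : σ → ℤ} {f : MvPolynomial σ k} {d d' : ℤ} (h : Homog w f d)
    (h' : Homog w' f d') (c : ℤ) : Homog (fun i => w i + c * w' i) f (d + c * d') := by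
  intro B _ _ a x
  rw [torus_mul_add, h, h', zpow_add, zpow_mul, Units.val_mul, mul_assoc]

open Classical in
/-- The action of the element `s` by the weights `w`, if `s` is invertible. -/
def twist {B : Type u} [CommRing B] (w : σ → ℤ) (s : B) (x : σ → B) : σ → B :=
  if h : IsUnit s then torus w h.unit x else x

lemma twist_coe {B : Type u} [CommRing B] (w : σ → ℤ) (s : Bˣ) (x : σ → B) :
    twist w (s : B) x = torus w s x := by
  rw [twist, dif_pos s.isUnit, IsUnit.unit_of_val_units]

lemma twist_map {B B' : Type u} [CommRing B] [CommRing B'] (f : B →+* B') (w : σ → ℤ) {s : B}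
    (hs : IsUnit s) (x : σ → B) (i : σ) :
    twist w (f s) (fun j => f (x j)) i = f (twist w s x i) := by
  obtain ⟨s, rfl⟩ := hs
  rw [twist_coe, map_torus]
  exact congrFun (twist_coe w (Units.map f.toMonoidHom s) _) i

namespace WPres

/-- The same variety with another action. -/
def reweight (D : WPres k σ) (w : σ → ℤ) (he : ∀ f ∈ D.eqs, ∃ d, Homog w f d)
    (hi : ∃ d, Homog w D.inv d) (hg : Homog w D.gm D.n) : WPres k σ where
  wt := w
  eqs := D.eqs
  inv := D.inv
  gm := D.gm
  n := D.n
  n_pos := D.n_pos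
  eqs_homog := he
  inv_homog := hi
  gm_homog := hg

lemma isPt_reweight {D : WPres k σ} {w : σ → ℤ} {he : ∀ f ∈ D.eqs, ∃ d, Homog w f d}
    {hi : ∃ d, Homog w D.inv d} {hg : Homog w D.gm D.n} {B : Type u} [CommRing B] [Algebra k B]
    {x : σ → B} : (D.reweight w he hi hg).IsPt x ↔ D.IsPt x :=
  ⟨fun h => ⟨h.eqs, h.gm, h.inv⟩, fun h => ⟨h.eqs, h.gm, h.inv⟩⟩

lemma homog_rename_some {w : Option σ → ℤ} {f : MvPolynomial σ k} {d : ℤ}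
    (h : Homog (fun i => w (some i)) f d) : Homog w (MvPolynomial.rename some f) d := by
  intro B _ _ a x
  rw [MvPolynomial.aeval_rename, MvPolynomial.aeval_rename]
  exact h B a (x ∘ some)

/-- The product with the affine line, on which the group acts with weight `c`. -/
def timesLine (D : WPres k σ) (c : ℤ) : WPres k (Option σ) where
  wt i := i.elim c D.wt
  eqs := MvPolynomial.rename some '' D.eqs
  inv := MvPolynomial.rename some D.inv
  gm := MvPolynomial.rename some D.gm
  n := D.n
  n_pos := D.n_pos
  eqs_homog := by
    rintro _ ⟨f, hf, rfl⟩
    obtain ⟨d, hd⟩ := D.eqs_homog f hf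
    exact ⟨d, homog_rename_some hd⟩
  inv_homog := by
    obtain ⟨d, hd⟩ := D.inv_homog
    exact ⟨d, homog_rename_some hd⟩
  gm_homog := homog_rename_some D.gm_homog

lemma isPt_timesLine {D : WPres k σ} {c : ℤ} {B : Type u} [CommRing B] [Algebra k B]
    {x : Option σ → B} : (D.timesLine c).IsPt x ↔ D.IsPt (fun i => x (some i)) := by
  have e : ∀ f : MvPolynomial σ k, MvPolynomial.aeval x (MvPolynomial.rename some f) =
      MvPolynomial.aeval (fun i => x (some i)) f := fun f => MvPolynomial.aeval_rename _ _ _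
  constructor
  · intro h
    refine ⟨fun f hf => ?_, ?_, ?_⟩
    · rw [← e]
      exact h.eqs _ ⟨f, hf, rfl⟩
    · rw [← e]
      exact h.gm
    · rw [← e]
      exact h.inv
  · intro h
    refine ⟨?_, ?_, ?_⟩
    · rintro _ ⟨f, hf, rfl⟩
      rw [e]
      exact h.eqs f hf
    · exact (e D.gm).symm ▸ h.gm
    · exact (e D.inv).symm ▸ h.inv

lemma cls_timesLine [Finite σ] (D : WPres k σ) (c : ℤ) :
    (D.timesLine c).cls = (LaurentPolynomial.T 1 : ℤ[T;T⁻¹]) • D.cls := by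
  have h := cls_eq_of_bundle (κ := Unit) (D.timesLine c) D (fun _ _ _ y i => y (some i))
    (fun _ => none) rfl (fun B _ _ y hy => isPt_timesLine.1 hy) (fun _ _ _ _ _ _ _ _ _ _ => rfl)
    (fun B _ _ a y hy => rfl) (fun B _ _ y hy => (MvPolynomial.aeval_rename _ _ _).symm)
    (fun B _ _ x w hx => ⟨fun i => i.elim (w ()) x, ⟨isPt_timesLine.2 hx, rfl, fun _ => rfl⟩,
      fun y hy => by
        funext i
        cases i with
        | none => exact hy.2.2 ()
        | some i => exact congrFun hy.2.1 i⟩)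
  simpa using h

/-- The complement of the zero section in the product with a line. -/
lemma cls_timesLine_addInv [Finite σ] (D : WPres k σ) (c : ℤ) :
    ((D.timesLine c).addInv (MvPolynomial.X none) ⟨_, Homog.X _ _⟩).cls =
      (LaurentPolynomial.T 1 - 1 : ℤ[T;T⁻¹]) • D.cls := by
  have h1 := (D.timesLine c).cls_scissor (MvPolynomial.X none) ⟨_, Homog.X _ _⟩
  have h2 : ((D.timesLine c).addEq (MvPolynomial.X none) ⟨_, Homog.X _ _⟩).cls = D.cls := by
    have h := cls_eq_of_bundle (κ := Empty)
      ((D.timesLine c).addEq (MvPolynomial.X none) ⟨_, Homog.X _ _⟩) D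
      (fun _ _ _ y i => y (some i)) Empty.elim rfl
      (fun B _ _ y hy => isPt_timesLine.1 (isPt_addEq.1 hy).1)
      (fun _ _ _ _ _ _ _ _ _ _ => rfl)
      (fun B _ _ a y hy => rfl) (fun B _ _ y hy => (MvPolynomial.aeval_rename _ _ _).symm)
      (fun B _ _ x w hx => ⟨fun i => i.elim 0 x, ⟨isPt_addEq.2 ⟨isPt_timesLine.2 hx, by simp⟩,
        rfl, fun j => j.elim⟩, fun y hy => by
        funext i
        cases i with
        | none => simpa using (isPt_addEq.1 hy.1).2
        | some i => exact congrFun hy.2.1 i⟩)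
    simpa using h
  rw [sub_smul, one_smul, ← cls_timesLine D c, h1, h2, add_sub_cancel_left]

lemma homog_X_sub_one {w : σ → ℤ} {o : σ} (h : w o = 0) :
    Homog (k := k) w (MvPolynomial.X o - 1) 0 := by
  intro B _ _ a x
  simp [torus, h]

lemma normalized_weight {v : σ → ℤ} {o : σ} (hv : v o = 1) (w : σ → ℤ) :
    w o + -w o * v o = 0 := by
  rw [hv]
  ring

/-- If an auxiliary action with weights `v`, where `v o = 1`, preserves a variety on which the
coordinate `o` is invertible, then this coordinate splits off. The remaining factor, where the
coordinate `o` is `1`, carries the action normalized by means of `v`. -/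
lemma cls_eq_smul_slice [Finite σ] (D : WPres k σ) (o : σ) (v : σ → ℤ) (hv : v o = 1)
    (he : ∀ f ∈ D.eqs, ∃ d, Homog v f d) (hi : ∃ d, Homog v D.inv d) (hg : Homog v D.gm 0)
    (hu : ∀ (B : Type u) [CommRing B] [Algebra k B] (x : σ → B), D.IsPt x → IsUnit (x o))
    (D' : WPres k σ) (hD'w : D'.wt = fun i => D.wt i + -D.wt o * v i) (hD'n : D'.n = D.n)
    (hD'g : D'.gm = D.gm)
    (hD' : ∀ (B : Type u) [CommRing B] [Algebra k B] (x : σ → B),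
      D'.IsPt x ↔ D.IsPt x ∧ x o = 1) :
    D.cls = (LaurentPolynomial.T 1 - 1 : ℤ[T;T⁻¹]) • D'.cls := by
  rw [← cls_timesLine_addInv D' (D.wt o)]
  -- the isomorphism with `𝔾ₘ × D'` sends `x` to the pair of `s = x o` and `s⁻¹ • x`, for the
  -- auxiliary action
  have hpt : ∀ (B : Type u) [CommRing B] [Algebra k B] (s : Bˣ) (x : σ → B), D.IsPt x →
      D.IsPt (torus v s x) := by
    intro B _ _ s x hx
    refine ⟨fun f hf => ?_, ?_, ?_⟩
    · obtain ⟨d, hd⟩ := he f hf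
      rw [hd, hx.eqs f hf, mul_zero]
    · rw [hg]
      exact (Units.isUnit _).mul hx.gm
    · obtain ⟨d, hd⟩ := hi
      rw [hd]
      exact (Units.isUnit _).mul hx.inv
  have hto : ∀ (B : Type u) [CommRing B] (s : Bˣ) (x : σ → B), torus v s x o = s * x o := by
    intro B _ s x
    rw [torus, hv, zpow_one]
  have h := cls_eq_of_bundle (κ := Empty) D
    ((D'.timesLine (D.wt o)).addInv (MvPolynomial.X none) ⟨_, Homog.X _ _⟩)
    (fun B _ _ x i => i.elim (x o) (twist (fun j => -v j) (x o) x)) Empty.elim hD'n.symm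
    ?_ ?_ ?_ ?_ ?_
  · simpa using h
  · intro B _ _ x hx
    obtain ⟨s, hs⟩ := hu B x hx
    refine isPt_addInv.2 ⟨isPt_timesLine.2 ((hD' _ _).2 ?_), ?_⟩
    · have e : twist (fun j => -v j) (x o) x = torus v s⁻¹ x := by
        rw [← hs, twist_coe]
        funext i
        simp [torus]
      simp only [Option.elim, e]
      refine ⟨hpt B _ x hx, ?_⟩
      rw [hto, ← hs, Units.inv_mul]
    · rw [MvPolynomial.aeval_X]
      exact hu B x hx
  · intro B B' _ _ _ _ f x hx i
    cases i with
    | none => rfl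
    | some i => exact twist_map f.toRingHom _ (hu B x hx) x i
  · intro B _ _ a x hx
    obtain ⟨s, hs⟩ := hu B x hx
    funext i
    cases i with
    | none => rfl
    | some i =>
      have e : torus D.wt a x o = ((a ^ D.wt o * s : Bˣ) : B) := by
        rw [torus, ← hs, Units.val_mul]
      change twist _ (torus D.wt a x o) _ i = ((a ^ D'.wt i : Bˣ) : B) * twist _ (x o) x i
      rw [e, ← hs, twist_coe, twist_coe, hD'w]
      simp only [torus]
      rw [← mul_assoc, ← mul_assoc, ← Units.val_mul, ← Units.val_mul]
      congr 2
      rw [mul_zpow, ← zpow_mul, mul_right_comm, ← zpow_add]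
      congr 2
      ring
  · intro B _ _ x hx
    obtain ⟨s, hs⟩ := hu B x hx
    refine (MvPolynomial.aeval_rename _ _ _).trans ?_
    have e : (fun i : Option σ => i.elim (x o) (twist (fun j => -v j) (x o) x)) ∘ some =
        torus v s⁻¹ x := by
      rw [← hs]
      funext i
      simp [twist_coe, torus]
    rw [e, hD'g, hg, zpow_zero, Units.val_one, one_mul]
  · intro B _ _ y _ hy
    obtain ⟨hy1, hy2⟩ := isPt_addInv.1 hy
    obtain ⟨hy3, hy4⟩ := (hD' _ _).1 (isPt_timesLine.1 hy1)
    rw [MvPolynomial.aeval_X] at hy2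
    obtain ⟨s, hs⟩ := hy2
    refine ⟨torus v s (fun i => y (some i)), ⟨hpt B _ _ hy3, ?_, fun j => j.elim⟩, ?_⟩
    · have e : torus v s (fun i => y (some i)) o = s := by rw [hto, hy4, mul_one]
      funext i
      cases i with
      | none => exact e.trans hs
      | some i =>
        change twist _ (torus v s (fun i => y (some i)) o) _ i = _
        rw [e, twist_coe]
        simp [torus]
    · rintro x ⟨-, hx, -⟩
      have h0 : x o = s := (congrFun hx none).trans hs.symm
      funext i
      have h1 : twist (fun j => -v j) (x o) x i = y (some i) := congrFun hx (some i)
      rw [h0, twist_coe] at h1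
      rw [torus, ← h1]
      simp [torus]

/-- The class of a variety in a torus depends neither on the action nor on the weight of the
function to `𝔾ₘ`, provided that an auxiliary action with weights `v`, where `v o = 1`, preserves
the variety and the function. -/
lemma cls_eq_of_same_weight [Finite σ] (D₁ D₂ : WPres k σ) (heq : D₂.eqs = D₁.eqs)
    (hinv : D₂.inv = D₁.inv) (hgm : D₂.gm = D₁.gm) (hn : D₂.n = D₁.n) (o : σ) (v : σ → ℤ)
    (hv : v o = 1) (he : ∀ f ∈ D₁.eqs, ∃ d, Homog v f d) (hi : ∃ d, Homog v D₁.inv d)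
    (hg : Homog v D₁.gm 0)
    (hu : ∀ (B : Type u) [CommRing B] [Algebra k B] (x : σ → B), D₁.IsPt x → IsUnit (x o)) :
    D₂.cls = D₁.cls := by
  have hp : ∀ {B : Type u} [CommRing B] [Algebra k B] {x : σ → B}, D₂.IsPt x ↔ D₁.IsPt x := by
    intro B _ _ x
    constructor
    · rintro ⟨h1, h2, h3⟩
      rw [heq] at h1
      rw [hgm] at h2
      rw [hinv] at h3
      exact ⟨h1, h2, h3⟩
    · rintro ⟨h1, h2, h3⟩
      rw [← heq] at h1
      rw [← hgm] at h2
      rw [← hinv] at h3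
      exact ⟨h1, h2, h3⟩
  have he2 := heq ▸ he
  have hi2 := hinv ▸ hi
  have hg2 := hgm ▸ hg
  -- it suffices to treat the case where the coordinate `o` has weight one
  have key : ∀ (D : WPres k σ) (_ : ∀ f ∈ D.eqs, ∃ d, Homog v f d) (_ : ∃ d, Homog v D.inv d)
      (_ : Homog v D.gm 0) (_ : ∀ (B : Type u) [CommRing B] [Algebra k B] (x : σ → B), D.IsPt x →
        IsUnit (x o)), ∃ D' : WPres k σ, D'.eqs = D.eqs ∧ D'.inv = D.inv ∧ D'.gm = D.gm ∧
        D'.n = D.n ∧ D'.wt o = 1 ∧ D'.cls = D.cls := by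
    intro D he hi hg hu
    have hr : ∀ c : ℤ, (∀ f ∈ D.eqs, ∃ d, Homog (fun i => D.wt i + c * v i) f d) ∧
        (∃ d, Homog (fun i => D.wt i + c * v i) D.inv d) ∧
        Homog (fun i => D.wt i + c * v i) D.gm D.n := by
      intro c
      refine ⟨fun f hf => ?_, ?_, ?_⟩
      · obtain ⟨d, hd⟩ := D.eqs_homog f hf
        obtain ⟨d', hd'⟩ := he f hf
        exact ⟨_, hd.add_mul hd' c⟩
      · obtain ⟨d, hd⟩ := D.inv_homog
        obtain ⟨d', hd'⟩ := hi
        exact ⟨_, hd.add_mul hd' c⟩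
      · simpa using D.gm_homog.add_mul hg c
    obtain ⟨r1, r2, r3⟩ := hr (1 - D.wt o)
    obtain ⟨s1, s2, s3⟩ := hr (-D.wt o)
    let D' := D.reweight _ r1 r2 r3
    let Y := (D.reweight _ s1 s2 s3).addEq (MvPolynomial.X o - 1)
      ⟨0, homog_X_sub_one (normalized_weight hv D.wt)⟩
    have hY : ∀ (B : Type u) [CommRing B] [Algebra k B] (x : σ → B),
        Y.IsPt x ↔ D.IsPt x ∧ x o = 1 := by
      intro B _ _ x
      refine isPt_addEq.trans (and_congr isPt_reweight ?_)
      rw [map_sub, MvPolynomial.aeval_X, map_one, sub_eq_zero]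
    have hD'o : D'.wt o = 1 := by
      change D.wt o + (1 - D.wt o) * v o = 1
      rw [hv]
      ring
    refine ⟨D', rfl, rfl, rfl, rfl, hD'o, ?_⟩
    rw [D.cls_eq_smul_slice o v hv he hi hg hu Y rfl rfl rfl hY,
      D'.cls_eq_smul_slice o v hv he hi hg (fun B _ _ x hx => hu B x (isPt_reweight.1 hx)) Y
        ?_ rfl rfl (fun B _ _ x => (hY B x).trans (and_congr_left fun _ => isPt_reweight.symm))]
    rw [hD'o]
    funext i
    change D.wt i + -D.wt o * v i = D.wt i + (1 - D.wt o) * v i + -1 * v i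
    ring
  obtain ⟨E₁, a1, b1, c1, d1, w1, h1⟩ := key D₁ he hi hg hu
  obtain ⟨E₂, a2, b2, c2, d2, w2, h2⟩ := key D₂ he2 hi2 hg2 fun B _ _ x hx => hu B x (hp.1 hx)
  rw [← h1, ← h2]
  have hp1 : ∀ {B : Type u} [CommRing B] [Algebra k B] {x : σ → B}, E₁.IsPt x ↔ D₁.IsPt x := by
    intro B _ _ x
    constructor
    · rintro ⟨h1, h2, h3⟩
      exact ⟨a1 ▸ h1, c1 ▸ h2, b1 ▸ h3⟩
    · rintro ⟨h1, h2, h3⟩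
      exact ⟨a1.symm ▸ h1, c1.symm ▸ h2, b1.symm ▸ h3⟩
  have hp2 : ∀ {B : Type u} [CommRing B] [Algebra k B] {x : σ → B}, E₂.IsPt x ↔ D₁.IsPt x := by
    intro B _ _ x
    refine Iff.trans ?_ hp
    constructor
    · rintro ⟨h1, h2, h3⟩
      exact ⟨a2 ▸ h1, c2 ▸ h2, b2 ▸ h3⟩
    · rintro ⟨h1, h2, h3⟩
      exact ⟨a2.symm ▸ h1, c2.symm ▸ h2, b2.symm ▸ h3⟩
  -- now twisting by the coordinate `o` transforms one action into the other
  let δ : σ → ℤ := fun i => E₁.wt i + -1 * E₂.wt i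
  have hδo : δ o = 0 := by simp [δ, w1, w2]
  have hδe : ∀ f ∈ D₁.eqs, ∃ d, Homog δ f d := by
    intro f hf
    obtain ⟨d, hd⟩ := E₁.eqs_homog f (by rwa [a1])
    obtain ⟨d', hd'⟩ := E₂.eqs_homog f (by rwa [a2, heq])
    exact ⟨_, hd.add_mul hd' (-1)⟩
  have hδi : ∃ d, Homog δ D₁.inv d := by
    obtain ⟨d, hd⟩ := E₁.inv_homog
    obtain ⟨d', hd'⟩ := E₂.inv_homog
    rw [b1] at hd
    rw [b2, hinv] at hd'
    exact ⟨_, hd.add_mul hd' (-1)⟩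
  have hδg : Homog δ D₁.gm 0 := by
    have h3 := E₁.gm_homog
    have h4 := E₂.gm_homog
    rw [c1, d1] at h3
    rw [c2, d2, hgm, hn] at h4
    have h5 := h3.add_mul h4 (-1)
    rwa [neg_one_mul, add_neg_cancel] at h5
  have hpt : ∀ (B : Type u) [CommRing B] [Algebra k B] (s : Bˣ) (x : σ → B), D₁.IsPt x →
      D₁.IsPt (torus δ s x) := by
    intro B _ _ s x hx
    refine ⟨fun f hf => ?_, ?_, ?_⟩
    · obtain ⟨d, hd⟩ := hδe f hf
      rw [hd, hx.eqs f hf, mul_zero]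
    · rw [hδg]
      exact (Units.isUnit _).mul hx.gm
    · obtain ⟨d, hd⟩ := hδi
      rw [hd]
      exact (Units.isUnit _).mul hx.inv
  have hto : ∀ (B : Type u) [CommRing B] (s : Bˣ) (x : σ → B), torus δ s x o = x o := by
    intro B _ s x
    rw [torus, hδo, zpow_zero, Units.val_one, one_mul]
  have h := cls_eq_of_bundle (κ := Empty) E₂ E₁ (fun B _ _ x => twist δ (x o) x) Empty.elim
    (by rw [d1, d2, hn]) ?_ ?_ ?_ ?_ ?_
  · simpa using h
  · intro B _ _ x hx
    obtain ⟨s, hs⟩ := hu B x (hp2.1 hx)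
    rw [← hs, twist_coe]
    exact hp1.2 (hpt B s x (hp2.1 hx))
  · intro B B' _ _ _ _ f x hx i
    exact twist_map f.toRingHom _ (hu B x (hp2.1 hx)) x i
  · intro B _ _ a x hx
    obtain ⟨s, hs⟩ := hu B x (hp2.1 hx)
    have e : torus E₂.wt a x o = ((a * s : Bˣ) : B) := by
      rw [torus, w2, ← hs, zpow_one, Units.val_mul]
    change twist δ (torus E₂.wt a x o) _ = torus E₁.wt a (twist δ (x o) x)
    rw [e, ← hs, twist_coe, twist_coe]
    funext i
    simp only [torus, δ]
    rw [← mul_assoc, ← mul_assoc, ← Units.val_mul, ← Units.val_mul]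
    congr 2
    rw [mul_zpow, mul_right_comm, ← zpow_add]
    congr 2
    ring
  · intro B _ _ x hx
    obtain ⟨s, hs⟩ := hu B x (hp2.1 hx)
    rw [← hs, twist_coe, c1, hδg, zpow_zero, Units.val_one, one_mul, c2, hgm]
  · intro B _ _ y _ hy
    obtain ⟨s, hs⟩ := hu B y (hp1.1 hy)
    refine ⟨torus δ s⁻¹ y, ⟨hp2.2 (hpt B _ y (hp1.1 hy)), ?_, fun j => j.elim⟩, ?_⟩
    · rw [hto, ← hs, twist_coe, torus_torus_inv]
    · rintro x ⟨hx1, hx2, -⟩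
      obtain ⟨s', hs'⟩ := hu B x (hp2.1 hx1)
      change twist δ (x o) x = y at hx2
      rw [← hs', twist_coe] at hx2
      have h3 : s' = s := Units.ext (by rw [hs', hs, ← hx2, hto])
      rw [← hx2, h3, torus_inv_torus]

/-- The class of a variety in a torus does not depend on the action, provided that an auxiliary
action with weights `v`, where `v o = 1`, preserves the variety and the function to `𝔾ₘ`. -/
lemma cls_eq_of_same_equations [Finite σ] (D₁ D₂ : WPres k σ) (heq : D₂.eqs = D₁.eqs)
    (hinv : D₂.inv = D₁.inv) (hgm : D₂.gm = D₁.gm) (o : σ) (v : σ → ℤ)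
    (hv : v o = 1) (he : ∀ f ∈ D₁.eqs, ∃ d, Homog v f d) (hi : ∃ d, Homog v D₁.inv d)
    (hg : Homog v D₁.gm 0)
    (hu : ∀ (B : Type u) [CommRing B] [Algebra k B] (x : σ → B), D₁.IsPt x → IsUnit (x o)) :
    D₂.cls = D₁.cls := by
  -- after rescaling, both functions to `𝔾ₘ` have the weight `D₁.n * D₂.n`
  rw [← D₁.cls_rescale D₂.n D₂.n_pos, ← D₂.cls_rescale D₁.n D₁.n_pos]
  exact cls_eq_of_same_weight _ _ heq hinv hgm (Nat.mul_comm _ _) o v hv he hi hg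
    fun B _ _ x hx => hu B x ⟨hx.eqs, hx.gm, hx.inv⟩

end WPres
end Reweighting

/-! ### Arcs -/

section Arcs

variable {k : Type u} [Field k] {ι : Type}

/-- The arc of order `m` with given coefficients. -/
def arc {B : Type u} [CommRing B] {m : ℕ} (x : ι × Fin (m + 1) → B) (i : ι) : Polynomial B :=
  ∑ j : Fin (m + 1), Polynomial.C (x (i, j)) * Polynomial.X ^ (j : ℕ)

lemma aeval_jetCoeff {B : Type u} [CommRing B] [Algebra k B] (g : MvPolynomial ι k) (m l : ℕ)
    (x : ι × Fin (m + 1) → B) :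
    MvPolynomial.aeval x (jetCoeff g m l) = (MvPolynomial.aeval (arc x) g).coeff l := by
  rw [map_jetCoeff]
  simp only [MvPolynomial.aeval_X]
  rfl

lemma coeff_arc {B : Type u} [CommRing B] {m : ℕ} (x : ι × Fin (m + 1) → B) (i : ι)
    (j : Fin (m + 1)) : (arc x i).coeff j = x (i, j) := by
  rw [arc, Polynomial.finsetSum_coeff, Finset.sum_eq_single j]
  · simp
  · intro j' _ h
    have h2 : (j : ℕ) ≠ j' := fun h3 => h (Fin.ext h3.symm)
    simp [Polynomial.coeff_X_pow, h2]
  · simp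

/-- The action of `𝔾ₘ` on arcs by rescaling of the parameter. -/
lemma homog_jetCoeff (g : MvPolynomial ι k) (m l : ℕ) :
    Homog (fun p : ι × Fin (m + 1) => ((p.2 : ℕ) : ℤ)) (jetCoeff g m l) l := by
  intro B _ _ a x
  rw [aeval_jetCoeff, aeval_jetCoeff]
  have h : arc (torus (fun p : ι × Fin (m + 1) => ((p.2 : ℕ) : ℤ)) a x) = fun i =>
      Polynomial.compRingHom (Polynomial.C (a : B) * Polynomial.X) (arc x i) := by
    funext i
    rw [arc, arc, map_sum]
    refine Finset.sum_congr rfl fun j _ => ?_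
    simp only [torus, zpow_natCast, Units.val_pow_eq_pow_val, map_mul, map_pow,
      Polynomial.coe_compRingHom_apply, Polynomial.C_comp, Polynomial.X_comp]
    ring
  have h2 : MvPolynomial.aeval (arc (torus (fun p : ι × Fin (m + 1) => ((p.2 : ℕ) : ℤ)) a x)) g =
      (MvPolynomial.aeval (arc x) g).comp (Polynomial.C (a : B) * Polynomial.X) := by
    rw [h]
    let ψ : Polynomial B →ₐ[k] Polynomial B :=
      { Polynomial.compRingHom (Polynomial.C (a : B) * Polynomial.X) with
        commutes' := fun r => by
          simp [Polynomial.algebraMap_apply] }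
    exact aeval_comp_algHom ψ (arc x) g
  rw [h2, Polynomial.comp_C_mul_X_coeff, mul_comm, zpow_natCast, Units.val_pow_eq_pow_val]

/-- The space of arcs `φ` of order `m` with `ord_t g(φ) = m` and such that the coordinates in `V`
vanish at the origin of the arc. -/
def jetPres (g : MvPolynomial ι k) (V : Set ι) {m : ℕ} (hm : 0 < m) :
    WPres k (ι × Fin (m + 1)) where
  wt p := ((p.2 : ℕ) : ℤ)
  eqs := {f | ∃ l < m, f = jetCoeff g m l} ∪ {f | ∃ i ∈ V, f = MvPolynomial.X (i, 0)}
  inv := 1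
  gm := jetCoeff g m m
  n := m
  n_pos := hm
  eqs_homog := by
    rintro f (⟨l, -, rfl⟩ | ⟨i, -, rfl⟩)
    · exact ⟨_, homog_jetCoeff g m l⟩
    · exact ⟨_, Homog.X _ _⟩
  inv_homog := ⟨_, Homog.one _⟩
  gm_homog := homog_jetCoeff g m m

lemma isPt_jetPres {g : MvPolynomial ι k} {V : Set ι} {m : ℕ} {hm : 0 < m} {B : Type u}
    [CommRing B] [Algebra k B] {x : ι × Fin (m + 1) → B} :
    (jetPres g V hm).IsPt x ↔ (∀ l < m, (MvPolynomial.aeval (arc x) g).coeff l = 0) ∧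
      IsUnit ((MvPolynomial.aeval (arc x) g).coeff m) ∧ ∀ i ∈ V, x (i, 0) = 0 := by
  constructor
  · intro h
    refine ⟨fun l hl => ?_, ?_, fun i hi => ?_⟩
    · rw [← aeval_jetCoeff]
      exact h.eqs _ (Or.inl ⟨l, hl, rfl⟩)
    · rw [← aeval_jetCoeff]
      exact h.gm
    · have := h.eqs _ (Or.inr ⟨i, hi, rfl⟩)
      rwa [MvPolynomial.aeval_X] at this
  · rintro ⟨h1, h2, h3⟩
    refine ⟨?_, ?_, ?_⟩
    · rintro f (⟨l, hl, rfl⟩ | ⟨i, hi, rfl⟩)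
      · rw [aeval_jetCoeff, h1 l hl]
      · rw [MvPolynomial.aeval_X, h3 i hi]
    · change IsUnit (MvPolynomial.aeval x (jetCoeff g m m))
      rwa [aeval_jetCoeff]
    · change IsUnit (MvPolynomial.aeval x (1 : MvPolynomial (ι × Fin (m + 1)) k))
      rw [map_one]
      exact isUnit_one

lemma jetLift_aux (g : MvPolynomial ι k) (m : ℕ) {B : Type u} [CommRing B] [Algebra k B]
    (x : ι × Fin (m + 1) → B) (h1 : ∀ l < m, (MvPolynomial.aeval (arc x) g).coeff l = 0)
    (p : JetPoly k ι m) (hp : p ∈ jetIdeal g m) : MvPolynomial.aeval x p = 0 := by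
  have h2 : jetIdeal g m ≤ RingHom.ker (MvPolynomial.aeval (R := k) x) := by
    refine Ideal.span_le.2 ?_
    rintro _ ⟨l, rfl⟩
    change MvPolynomial.aeval x (jetCoeff g m l) = 0
    rw [aeval_jetCoeff, h1 l l.2]
  exact h2 hp

/-- The evaluation of functions on `𝓧_m(g)` at a point. -/
def jetLift (g : MvPolynomial ι k) (m : ℕ) {B : Type u} [CommRing B] [Algebra k B]
    (x : ι × Fin (m + 1) → B) (h1 : ∀ l < m, (MvPolynomial.aeval (arc x) g).coeff l = 0)
    (h2 : IsUnit ((MvPolynomial.aeval (arc x) g).coeff m)) : JetRing g m →ₐ[k] B :=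
  IsLocalization.liftAlgHom
    (M := Submonoid.powers (Ideal.Quotient.mk (jetIdeal g m) (jetCoeff g m m)))
    (f := Ideal.Quotient.liftₐ (jetIdeal g m) (MvPolynomial.aeval x) (jetLift_aux g m x h1)) (by
      rintro ⟨_, n, rfl⟩
      rw [map_pow]
      refine IsUnit.pow n ?_
      change IsUnit (MvPolynomial.aeval x (jetCoeff g m m))
      rwa [aeval_jetCoeff])

lemma jetLift_jetMk (g : MvPolynomial ι k) (m : ℕ) {B : Type u} [CommRing B] [Algebra k B]
    (x : ι × Fin (m + 1) → B) (h1 : ∀ l < m, (MvPolynomial.aeval (arc x) g).coeff l = 0)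
    (h2 : IsUnit ((MvPolynomial.aeval (arc x) g).coeff m)) (p : ι × Fin (m + 1)) :
    jetLift g m x h1 h2 (jetMk g m (MvPolynomial.X p)) = x p := by
  refine (IsLocalization.lift_eq _ _).trans ?_
  change MvPolynomial.aeval x (MvPolynomial.X p) = x p
  rw [MvPolynomial.aeval_X]

end Arcs

section Integral

variable {k : Type u} [Field k] {d₁ d₂ d₃ : ℕ}

lemma Mot.pullback_cls {S S' : KSch k} (f : S' ⟶ S) [IsAffineHom f.left]
    [LocallyOfFiniteType f.left] (X : GmVar S) (e : ℤ) :
    Mot.pullback f (Mot.cls X e) = Mot.cls (X.pullback f) e := by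
  rw [Mot.pullback, Mot.lift_cls]

lemma Mot.pushforward_cls {S S' : KSch k} (f : S ⟶ S') (X : GmVar S) (e : ℤ) :
    Mot.pushforward f (Mot.cls X e) = Mot.cls (X.pushforward f) e := by
  rw [Mot.pushforward, Mot.lift_cls]

lemma jetBase_X {ι : Type} (g : MvPolynomial ι k) {m : ℕ} (hm : 0 < m) (i : ι) :
    jetBase g hm (Ideal.Quotient.mk _ (MvPolynomial.X i)) = jetMk g m (MvPolynomial.X (i, 0)) := by
  change MvPolynomial.aeval _ _ = _
  rw [MvPolynomial.aeval_X]

/-- The coordinates `y` and `z` of `𝔸^{d₁} × 𝔸^{d₂} × 𝔸^{d₃}`. -/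
def vanishingCoords (d₁ d₂ d₃ : ℕ) : Set (Fin d₁ ⊕ Fin d₂ ⊕ Fin d₃) := Set.range Sum.inr

/-- The integral over `𝔸^{d₁}` of `𝓧_m(g)` consists of the arcs whose origin lies in `𝔸^{d₁}`. -/
lemma intIncl_jetVar (g : MvPolynomial (Fin d₁ ⊕ Fin d₂ ⊕ Fin d₃) k) (hg : restrictX g = 0)
    {m : ℕ} (hm : 0 < m) :
    intIncl g hg (Mot.cls (jetVar g hm) 0) = (jetPres g (vanishingCoords d₁ d₂ d₃) hm).cls := by
  let f := incl g hg
  let W := jetVar g hm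
  have e : intIncl g hg (Mot.cls W 0) =
      Mot.cls ((W.pullback f).pushforward (affSpaceStr k d₁)) 0 :=
    (congrArg (Mot.pushforward (affSpaceStr k d₁)) (Mot.pullback_cls f W 0)).trans
      (Mot.pushforward_cls _ _ 0)
  rw [e]
  let D := jetPres g (vanishingCoords d₁ d₂ d₃) hm
  -- the universal arc on the fibre product
  let ψ : JetRing g m →ₐ[k] Fun (pbX f W) := toFunAlg (A := JetRing g m) (pbFst f W)
  let x : (Fin d₁ ⊕ Fin d₂ ⊕ Fin d₃) × Fin (m + 1) → Fun (pbX f W) :=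
    fun p => ψ (jetMk g m (MvPolynomial.X p))
  have hψ : ∀ p : JetPoly k _ m, MvPolynomial.aeval x p = ψ (jetMk g m p) := fun p => by
    refine (aeval_comp_algHom (ψ.comp (jetMk g m)) MvPolynomial.X p).trans ?_
    rw [MvPolynomial.aeval_X_left_apply]
    rfl
  have hcond : ∀ {T : KSch k} (a : T ⟶ SpecK k (JetRing g m)) (b : T ⟶ affSpace k d₁),
      a ≫ SpecK.map (jetBase g hm) = b ≫ f ↔
        ∀ i, toFunAlg a (jetMk g m (MvPolynomial.X (i, 0))) =
          toFunAlg b (restrictX (MvPolynomial.X i)) := by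
    intro T a b
    have h1 : ∀ i, toFunAlg (a ≫ SpecK.map (jetBase g hm))
        (Ideal.Quotient.mk _ (MvPolynomial.X i)) =
        toFunAlg a (jetMk g m (MvPolynomial.X (i, 0))) := by
      intro i
      rw [toFunAlg_apply, toFun_map, ← jetBase_X g hm i]
      rfl
    have h2 : ∀ i, toFunAlg (b ≫ f) (Ideal.Quotient.mk _ (MvPolynomial.X i)) =
        toFunAlg b (restrictX (MvPolynomial.X i)) := by
      intro i
      exact RingHom.congr_fun (toFun_map _ b) (Ideal.Quotient.mk _ (MvPolynomial.X i))
    constructor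
    · intro h i
      rw [← h1, ← h2, h]
    · intro h
      refine toFunAlg_ext (Ideal.Quotient.algHom_ext k (MvPolynomial.algHom_ext fun i => ?_))
      exact (h1 i).trans ((h i).trans (h2 i).symm)
  have hrX : ∀ i : Fin d₁, restrictX (k := k) (d₂ := d₂) (d₃ := d₃)
      (MvPolynomial.X (Sum.inl i)) = MvPolynomial.X i := by
    intro i
    rw [restrictX, MvPolynomial.aeval_X, Sum.elim_inl]
  have hr0 : ∀ i : Fin d₂ ⊕ Fin d₃, restrictX (k := k) (d₁ := d₁)
      (MvPolynomial.X (Sum.inr i)) = 0 := by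
    intro i
    rw [restrictX, MvPolynomial.aeval_X, Sum.elim_inr, Pi.zero_apply]
  have hx0 := (hcond (pbFst f W) (pbSnd f W)).1 (pb_condition f W)
  have hx : D.IsPt x := by
    refine isPt_jetPres.2 ⟨fun l hl => ?_, ?_, ?_⟩
    · rw [← aeval_jetCoeff, hψ, jetMk_coeff_eq_zero g hl, map_zero]
    · rw [← aeval_jetCoeff, hψ]
      exact (isUnit_jetMk_coeff g m).map ψ
    · rintro _ ⟨i, rfl⟩
      refine (hx0 (Sum.inr i)).trans ?_
      rw [hr0, map_zero]
  have hpull : ∀ {T : KSch k} (y : T ⟶ pbX f W) (p),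
      pull y (x p) = toFunAlg (A := JetRing g m) (y ≫ pbFst f W)
        (jetMk g m (MvPolynomial.X p)) := by
    intro T y p
    exact (RingHom.congr_fun (toFun_comp (A := JetRing g m) y (pbFst f W)) _).symm
  have h := WPres.cls_eq_of_coords (κ := Empty) ((W.pullback f).pushforward (affSpaceStr k d₁)) D
    x Empty.elim hx rfl (fun {T} a y p => ?_) ?_ Empty.elim
    (fun {T} a y j => j.elim) (fun {T} x' w hx' => ?_)
  · simpa [WPres.cls] using h
  · refine (hpull ((pbAct f W).smul a y) p).trans ((congrArg (fun z => toFunAlg (A := JetRing g m)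
      z (jetMk g m (MvPolynomial.X p))) (pbAct_fst f W a y)).trans ?_)
    refine (RingHom.congr_fun ((jetCoaction g m).toFun_act a (y ≫ pbFst f W))
      (jetMk g m (MvPolynomial.X p))).trans ?_
    change LaurentPolynomial.eval₂ _ a (jetρ g m (jetMk g m (MvPolynomial.X (p.1, p.2)))) = _
    rw [jetρ_X, LaurentPolynomial.eval₂_C_mul_T, mul_comm]
    exact congrArg _ (hpull y p).symm
  · exact hψ _
  · obtain ⟨h1, h2, h3⟩ := isPt_jetPres.1 hx'
    let a : T ⟶ SpecK k (JetRing g m) := ofFunAlg (jetLift g m x' h1 h2)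
    let b : T ⟶ affSpace k d₁ := ofFunAlg (MvPolynomial.aeval fun i => x' (Sum.inl i, 0))
    have ha : ∀ p, toFunAlg a (jetMk g m (MvPolynomial.X p)) = x' p := by
      intro p
      rw [toFunAlg_ofFunAlg, jetLift_jetMk]
    have hb : ∀ i, toFunAlg b (MvPolynomial.X i) = x' (Sum.inl i, 0) := by
      intro i
      rw [toFunAlg_ofFunAlg, MvPolynomial.aeval_X]
    have hab : a ≫ SpecK.map (jetBase g hm) = b ≫ f := by
      refine (hcond a b).2 fun i => ?_
      rw [ha]
      rcases i with i | i
      · rw [hrX, hb]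
      · rw [hr0, map_zero, h3 _ ⟨i, rfl⟩]
    refine ⟨pbLift f W a b hab, ⟨fun p => ?_, fun j => j.elim⟩, fun y' hy' => ?_⟩
    · exact (hpull (pbLift f W a b hab) p).trans ((congrArg (fun z => toFunAlg (A := JetRing g m)
        z (jetMk g m (MvPolynomial.X p))) (pbLift_fst f W a b hab)).trans (ha p))
    · have hy1 : ∀ p, toFunAlg (A := JetRing g m) (y' ≫ pbFst f W)
          (jetMk g m (MvPolynomial.X p)) = x' p := fun p => (hpull y' p).symm.trans (hy'.1 p)
      have hf : y' ≫ pbFst f W = a := by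
        refine toFunAlg_ext (A := JetRing g m) (AlgHom.ext fun r => RingHom.congr_fun
          (jetRing_hom_ext g m (φ := (toFunAlg (A := JetRing g m) (y' ≫ pbFst f W)).toRingHom)
            (ψ := (toFunAlg a).toRingHom) (fun c => by simp) fun i j => ?_) r)
        exact (hy1 (i, j)).trans (ha (i, j)).symm
      refine pb_ext f W (hf.trans (pbLift_fst f W a b hab).symm)
        (Eq.trans ?_ (pbLift_snd f W a b hab).symm)
      have h4 : ∀ z : T ⟶ pbX f W, z ≫ pbFst f W = a →
          a ≫ SpecK.map (jetBase g hm) = (z ≫ pbSnd f W) ≫ f := by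
        intro z hz
        rw [← hz, Category.assoc]
        refine Eq.trans (Category.assoc z (pbFst f W) W.toBase) ?_
        exact congrArg (z ≫ ·) (pb_condition f W)
      refine toFunAlg_ext (MvPolynomial.algHom_ext fun i => ?_)
      have h5 := (hcond a (y' ≫ pbSnd f W)).1 (h4 y' hf) (Sum.inl i)
      rw [hrX, ha] at h5
      rw [hb]
      exact h5.symm

end Integral

/-! ### Stratifications -/

section Strata

variable {k : Type u} [Field k] {σ : Type}

namespace WPres

/-- The locally closed subvariety where the functions in `E` vanish and `s` is invertible. -/
def restrict (D : WPres k σ) (E : Set (MvPolynomial σ k)) (s : MvPolynomial σ k)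
    (hE : ∀ f ∈ E, ∃ d, Homog D.wt f d) (hs : ∃ d, Homog D.wt s d) : WPres k σ where
  wt := D.wt
  eqs := D.eqs ∪ E
  inv := D.inv * s
  gm := D.gm
  n := D.n
  n_pos := D.n_pos
  eqs_homog := by
    rintro f (h | h)
    · exact D.eqs_homog f h
    · exact hE f h
  inv_homog := by
    obtain ⟨d, hd⟩ := D.inv_homog
    obtain ⟨d', hd'⟩ := hs
    exact ⟨_, hd.mul hd'⟩
  gm_homog := D.gm_homog

lemma isPt_restrict {D : WPres k σ} {E : Set (MvPolynomial σ k)} {s : MvPolynomial σ k}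
    {hE : ∀ f ∈ E, ∃ d, Homog D.wt f d} {hs : ∃ d, Homog D.wt s d} {B : Type u} [CommRing B]
    [Algebra k B] {x : σ → B} : (D.restrict E s hE hs).IsPt x ↔
      D.IsPt x ∧ (∀ f ∈ E, MvPolynomial.aeval x f = 0) ∧ IsUnit (MvPolynomial.aeval x s) := by
  constructor
  · intro h
    have h2 : IsUnit (MvPolynomial.aeval x (D.inv * s)) := h.inv
    rw [map_mul, IsUnit.mul_iff] at h2
    exact ⟨⟨fun f hf => h.eqs f (Or.inl hf), h.gm, h2.1⟩, fun f hf => h.eqs f (Or.inr hf), h2.2⟩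
  · rintro ⟨h, h1, h2⟩
    refine ⟨?_, h.gm, ?_⟩
    · rintro f (hf | hf)
      · exact h.eqs f hf
      · exact h1 f hf
    · change IsUnit (MvPolynomial.aeval x (D.inv * s))
      rw [map_mul]
      exact h.inv.mul h2

/-- The locus where the functions `f b`, for `b < a`, vanish and `f a` is invertible. -/
def firstNonzero (D : WPres k σ) {N : ℕ} (f : Fin N → MvPolynomial σ k)
    (hf : ∀ a, ∃ d, Homog D.wt (f a) d) (a : Fin N) : WPres k σ :=
  D.restrict {p | ∃ b < a, p = f b} (f a) (by rintro _ ⟨b, -, rfl⟩; exact hf b) (hf a)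

lemma isPt_firstNonzero {D : WPres k σ} {N : ℕ} {f : Fin N → MvPolynomial σ k}
    {hf : ∀ a, ∃ d, Homog D.wt (f a) d} {a : Fin N} {B : Type u} [CommRing B] [Algebra k B]
    {x : σ → B} : (D.firstNonzero f hf a).IsPt x ↔
      D.IsPt x ∧ (∀ b < a, MvPolynomial.aeval x (f b) = 0) ∧
        IsUnit (MvPolynomial.aeval x (f a)) := by
  refine isPt_restrict.trans (and_congr_right fun _ => and_congr_left fun _ => ⟨?_, ?_⟩)
  · intro h b hb
    exact h _ ⟨b, hb, rfl⟩
  · rintro h _ ⟨b, hb, rfl⟩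
    exact h b hb

/-- The locus where all the functions `f a` vanish. -/
def allZero (D : WPres k σ) {N : ℕ} (f : Fin N → MvPolynomial σ k)
    (hf : ∀ a, ∃ d, Homog D.wt (f a) d) : WPres k σ :=
  D.restrict (Set.range f) 1 (by rintro _ ⟨b, rfl⟩; exact hf b) ⟨0, Homog.one _⟩

lemma isPt_allZero {D : WPres k σ} {N : ℕ} {f : Fin N → MvPolynomial σ k}
    {hf : ∀ a, ∃ d, Homog D.wt (f a) d} {B : Type u} [CommRing B] [Algebra k B]
    {x : σ → B} : (D.allZero f hf).IsPt x ↔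
      D.IsPt x ∧ ∀ b, MvPolynomial.aeval x (f b) = 0 := by
  refine isPt_restrict.trans
    (and_congr_right fun _ => ⟨fun h b => h.1 _ ⟨b, rfl⟩, fun h => ⟨?_, ?_⟩⟩)
  · rintro _ ⟨b, rfl⟩
    exact h b
  · rw [map_one]
    exact isUnit_one

lemma cls_eq_sum_firstNonzero_add [Finite σ] (D : WPres k σ) {N : ℕ} (f : Fin N → MvPolynomial σ k)
    (hf : ∀ a, ∃ d, Homog D.wt (f a) d) :
    D.cls = ∑ a, (D.firstNonzero f hf a).cls + (D.allZero f hf).cls := by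
  induction N with
  | zero =>
    rw [Finset.univ_eq_empty, Finset.sum_empty, zero_add]
    symm
    refine cls_congr _ _ rfl rfl rfl fun B _ _ x => ?_
    exact isPt_allZero.trans ⟨fun h => h.1, fun h => ⟨h, fun b => b.elim0⟩⟩
  | succ N ih =>
    rw [ih (fun a => f a.castSucc) (fun a => hf a.castSucc), Fin.sum_univ_castSucc,
      (D.allZero (fun a => f a.castSucc) (fun a => hf a.castSucc)).cls_scissor (f (Fin.last N))
        (hf (Fin.last N)), add_assoc]
    refine congrArg₂ (· + ·) ?_ ((add_comm _ _).trans (congrArg₂ (· + ·) ?_ ?_))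
    · refine Finset.sum_congr rfl fun a _ => cls_congr _ _ rfl rfl rfl fun B _ _ x => ?_
      refine isPt_firstNonzero.trans (Iff.trans ?_ isPt_firstNonzero.symm)
      refine and_congr_right fun _ => and_congr_left fun _ => ⟨fun h b hb => ?_, fun h b hb => ?_⟩
      · have hb' : (b : ℕ) < N := by
          have h1 : (b : ℕ) < a := hb
          omega
        exact h ⟨b, hb'⟩ hb
      · exact h _ (Fin.castSucc_lt_castSucc_iff.2 hb)
    · refine cls_congr _ _ rfl rfl rfl fun B _ _ x => ?_
      refine isPt_addInv.trans (Iff.trans ?_ isPt_firstNonzero.symm)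
      rw [isPt_allZero, and_assoc]
      refine and_congr_right fun _ => and_congr_left fun _ => ⟨fun h b hb => ?_, fun h b => ?_⟩
      · exact h ⟨b, hb⟩
      · exact h _ (Fin.castSucc_lt_last b)
    · refine cls_congr _ _ rfl rfl rfl fun B _ _ x => ?_
      refine isPt_addEq.trans (Iff.trans ?_ isPt_allZero.symm)
      rw [isPt_allZero, and_assoc]
      refine and_congr_right fun _ => ⟨fun h b => ?_, fun h => ⟨fun b => h _, h _⟩⟩
      exact Fin.lastCases h.2 h.1 b

/-- If the functions `f a` have no common zero, the loci where `f a` is the first one that does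
not vanish form a stratification. -/
lemma cls_eq_sum_firstNonzero [Finite σ] (D : WPres k σ) {N : ℕ} (f : Fin N → MvPolynomial σ k)
    (hf : ∀ a, ∃ d, Homog D.wt (f a) d) (h0 : (D.allZero f hf).cls = 0) :
    D.cls = ∑ a, (D.firstNonzero f hf a).cls := by
  rw [cls_eq_sum_firstNonzero_add D f hf, h0, add_zero]

variable {ι : Type} {m : ℕ}

/-- The arcs whose coordinate `i` has order `κ i`, for `i` in `s`. -/
def ordStratum (D : WPres k (ι × Fin (m + 1))) (s : Finset ι) (κ : ι → Fin (m + 1)) :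
    WPres k (ι × Fin (m + 1)) :=
  D.restrict {f | ∃ i ∈ s, ∃ j < κ i, f = MvPolynomial.X (i, j)}
    (∏ i ∈ s, MvPolynomial.X (i, κ i)) (by rintro _ ⟨i, -, j, -, rfl⟩; exact ⟨_, Homog.X _ _⟩)
    ⟨_, Homog.prod s fun i _ => Homog.X _ _⟩

lemma isPt_ordStratum {D : WPres k (ι × Fin (m + 1))} {s : Finset ι} {κ : ι → Fin (m + 1)}
    {B : Type u} [CommRing B] [Algebra k B] {x : ι × Fin (m + 1) → B} :
    (D.ordStratum s κ).IsPt x ↔ D.IsPt x ∧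
      ∀ i ∈ s, (∀ j < κ i, x (i, j) = 0) ∧ IsUnit (x (i, κ i)) := by
  refine isPt_restrict.trans (and_congr_right fun _ => ?_)
  rw [map_prod, IsUnit.prod_iff]
  simp only [MvPolynomial.aeval_X]
  constructor
  · rintro ⟨h1, h2⟩ i hi
    refine ⟨fun j hj => ?_, h2 i hi⟩
    have := h1 _ ⟨i, hi, j, hj, rfl⟩
    rwa [MvPolynomial.aeval_X] at this
  · intro h
    refine ⟨?_, fun i hi => (h i hi).2⟩
    rintro _ ⟨i, hi, j, hj, rfl⟩
    rw [MvPolynomial.aeval_X]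
    exact (h i hi).1 j hj

/-- The stratification of a space of arcs of order `m` by the orders of the coordinates, if no
coordinate vanishes up to order `m`. -/
lemma cls_eq_sum_ordStratum [Fintype ι] [DecidableEq ι] (D : WPres k (ι × Fin (m + 1)))
    (hD : ∀ (B : Type u) [CommRing B] [Algebra k B] (x : ι × Fin (m + 1) → B), D.IsPt x →
      ∀ i, (∀ j, x (i, j) = 0) → Subsingleton B) :
    D.cls = ∑ κ : ι → Fin (m + 1), (D.ordStratum Finset.univ κ).cls := by
  have key : ∀ s : Finset ι, D.cls =
      ∑ κ : ι → Fin (m + 1) with ∀ i, i ∉ s → κ i = 0, (D.ordStratum s κ).cls := by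
    intro s
    induction s using Finset.induction_on with
    | empty =>
      have e : (Finset.univ.filter fun κ : ι → Fin (m + 1) => ∀ i, i ∉ (∅ : Finset ι) → κ i = 0) =
          {0} := by
        ext κ
        simp [funext_iff]
      rw [e, Finset.sum_singleton]
      symm
      refine cls_congr _ _ rfl rfl rfl fun B _ _ x => ?_
      exact isPt_ordStratum.trans (by simp)
    | insert i₀ s hi₀ ih =>
      have h1 : ∀ κ : ι → Fin (m + 1), (D.ordStratum s κ).cls =
          ∑ j, (D.ordStratum (insert i₀ s) (Function.update κ i₀ j)).cls := by
        intro κ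
        rw [(D.ordStratum s κ).cls_eq_sum_firstNonzero (fun j => MvPolynomial.X (i₀, j))
          (fun j => ⟨_, Homog.X _ _⟩)]
        · refine Finset.sum_congr rfl fun j _ => cls_congr _ _ rfl rfl rfl fun B _ _ x => ?_
          rw [isPt_firstNonzero, isPt_ordStratum, isPt_ordStratum, Finset.forall_mem_insert,
            Function.update_self, and_assoc]
          simp only [MvPolynomial.aeval_X]
          refine and_congr_right fun _ => ?_
          rw [and_comm]
          refine and_congr_right fun _ => forall₂_congr fun i hi => ?_
          rw [Function.update_of_ne (ne_of_mem_of_not_mem hi hi₀)]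
        · refine cls_eq_zero _ fun B _ _ x hx => ?_
          rw [isPt_allZero, isPt_ordStratum] at hx
          refine hD B x hx.1.1 i₀ fun j => ?_
          simpa using hx.2 j
      rw [ih]
      simp only [h1]
      rw [← Finset.sum_product']
      refine Finset.sum_nbij' (fun p => Function.update p.1 i₀ p.2)
        (fun κ => (Function.update κ i₀ 0, κ i₀)) ?_ ?_ ?_ ?_ ?_
      · rintro ⟨κ, j⟩ hκ
        simp only [Finset.mem_product, Finset.mem_filter, Finset.mem_univ, true_and,
          and_true] at hκ ⊢
        intro i hi
        rw [Finset.mem_insert, not_or] at hi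
        rw [Function.update_of_ne hi.1]
        exact hκ i hi.2
      · intro κ hκ
        simp only [Finset.mem_product, Finset.mem_filter, Finset.mem_univ, true_and,
          and_true] at hκ ⊢
        intro i hi
        by_cases h : i = i₀
        · rw [h, Function.update_self]
        · rw [Function.update_of_ne h]
          exact hκ i (by simp [h, hi])
      · rintro ⟨κ, j⟩ hκ
        simp only [Finset.mem_product, Finset.mem_filter, Finset.mem_univ, true_and,
          and_true] at hκ
        refine Prod.ext ?_ (Function.update_self ..)
        simp only [Function.update_idem]
        rw [← hκ i₀ hi₀, Function.update_eq_self]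
      · intro κ _
        simp
      · intro p _
        rfl
  have h := key Finset.univ
  simpa using h

end WPres
end Strata

/-! ### Solving equations for the coefficients of a series -/

section Hensel

open Polynomial

variable {B : Type*} [CommRing B]

lemma coeff_X_pow_mul_zero_add (n : ℕ) (p : B[X]) : (X ^ n * p).coeff n = p.coeff 0 := by
  have := coeff_X_pow_mul p n 0
  rwa [zero_add] at this

lemma coeff_eval_add_of_lt (F : B[X][X]) (y q : B[X]) {l r : ℕ} (h : l < r) :
    (F.eval (y + X ^ r * q)).coeff l = (F.eval y).coeff l := by
  obtain ⟨c, hc⟩ := sub_dvd_eval_sub (y + X ^ r * q) y F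
  rw [add_sub_cancel_left] at hc
  rw [sub_eq_iff_eq_add.1 hc, coeff_add, mul_assoc, coeff_X_pow_mul', if_neg (by omega), zero_add]

lemma coeff_eval_add (F : B[X][X]) (y q : B[X]) {r : ℕ} (h : 0 < r) :
    (F.eval (y + X ^ r * q)).coeff r =
      (F.eval y).coeff r + ((derivative F).eval y).coeff 0 * q.coeff 0 := by
  obtain ⟨c, hc⟩ := binomExpansion F y (X ^ r * q)
  have e : F.derivative.eval y * (X ^ r * q) + c * (X ^ r * q) ^ 2 =
      X ^ r * (F.derivative.eval y * q) + X ^ (2 * r) * (c * q ^ 2) := by ring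
  rw [hc, add_assoc, e, coeff_add, coeff_add, coeff_X_pow_mul_zero_add, coeff_X_pow_mul',
    if_neg (by omega), add_zero, mul_coeff_zero]

lemma eval_coeff_zero (F : B[X][X]) (y y' : B[X]) (h : y.coeff 0 = y'.coeff 0) :
    (F.eval y).coeff 0 = (F.eval y').coeff 0 := by
  obtain ⟨q, hq⟩ : X ∣ y - y' := X_dvd_iff.2 (by rw [coeff_sub, h, sub_self])
  have e : y = y' + X ^ 1 * q := by rw [pow_one, ← hq]; ring
  rw [e, coeff_eval_add_of_lt F y' q zero_lt_one]

/-- Hensel's lemma, existence: the coefficients of order `1, …, j` of `y` can be modified such that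
those of `F(y)` take given values. -/
lemma exists_eval_coeff_eq (F : B[X][X]) (y : B[X]) (hF : IsUnit ((derivative F).eval y |>.coeff 0))
    (t : ℕ → B) (j : ℕ) : ∃ y' : B[X], (∀ r, r = 0 ∨ j < r → y'.coeff r = y.coeff r) ∧
      ∀ r, 0 < r → r ≤ j → (F.eval y').coeff r = t r := by
  induction j with
  | zero => exact ⟨y, fun _ _ => rfl, fun r h1 h2 => absurd h1 (by omega)⟩
  | succ j ih =>
    obtain ⟨y₁, h1, h2⟩ := ih
    have hu : IsUnit ((derivative F).eval y₁ |>.coeff 0) := by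
      rwa [eval_coeff_zero _ y₁ y (h1 0 (Or.inl rfl))]
    obtain ⟨u, hu⟩ := hu
    -- one step of the Newton iteration, which changes only the coefficient of order `j + 1`
    refine ⟨y₁ + X ^ (j + 1) * C ((u⁻¹ : Bˣ) * (t (j + 1) - (F.eval y₁).coeff (j + 1))),
      fun r hr => ?_, fun r hr1 hr2 => ?_⟩
    · rw [coeff_add, coeff_X_pow_mul', h1 r (by omega)]
      split_ifs with h3
      · rw [coeff_C_of_ne_zero (by omega), add_zero]
      · rw [add_zero]
    · by_cases h3 : r = j + 1
      · rw [h3, coeff_eval_add F _ _ (Nat.succ_pos j), coeff_C_zero, ← hu, ← mul_assoc,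
          Units.mul_inv, one_mul]
        ring
      · rw [coeff_eval_add_of_lt F _ _ (by omega), h2 r hr1 (by omega)]

/-- Hensel's lemma, uniqueness. -/
lemma eq_of_eval_coeff_eq (F : B[X][X]) (y y' : B[X])
    (hF : IsUnit ((derivative F).eval y |>.coeff 0)) (j : ℕ)
    (h1 : ∀ r, r = 0 ∨ j < r → y'.coeff r = y.coeff r)
    (h2 : ∀ r, 0 < r → r ≤ j → (F.eval y').coeff r = (F.eval y).coeff r) : y' = y := by
  have h3 : ∀ r, ∀ l < r, y'.coeff l = y.coeff l := by
    intro r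
    induction r with
    | zero => exact fun l h => absurd h (by omega)
    | succ r ih =>
      intro l hl
      by_cases hr : r = 0 ∨ j < r
      · by_cases h : l = r
        · rw [h, h1 r hr]
        · exact ih l (by omega)
      · by_cases h : l = r
        · obtain ⟨q, hq⟩ : X ^ r ∣ y' - y := X_pow_dvd_iff.2 fun d hd => by
            rw [coeff_sub, ih d hd, sub_self]
          have e : y' = y + X ^ r * q := by rw [← hq]; ring
          have h4 := h2 r (by omega) (by omega)
          rw [e, coeff_eval_add F y q (by omega)] at h4
          have h5 : q.coeff 0 = 0 := by
            rw [add_eq_left] at h4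
            exact (hF.mul_right_eq_zero).1 h4
          rw [h, e, coeff_add, coeff_X_pow_mul_zero_add, h5, add_zero]
        · exact ih l (by omega)
  exact Polynomial.ext fun l => h3 (l + 1) l (by omega)

end Hensel

/-! ### Initial forms -/

section InitialForms

open Polynomial

variable {k : Type u} [Field k] {ι : Type} [Fintype ι] [DecidableEq ι]

/-- The value of the linear form `κ` on an exponent. -/
def lev (κ : ι → ℕ) (α : ι →₀ ℕ) : ℕ := ∑ i, κ i * α i

/-- The sum of the terms of `g` with exponents in `P`. -/
def initForm (g : MvPolynomial ι k) (P : Finset (ι →₀ ℕ)) : MvPolynomial ι k :=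
  ∑ α ∈ P, MvPolynomial.monomial α (g.coeff α)

/-- The logarithmic derivative `xᵢ ∂ᵢ` of `initForm g P`. -/
def logDeriv (g : MvPolynomial ι k) (P : Finset (ι →₀ ℕ)) (i : ι) : MvPolynomial ι k :=
  ∑ α ∈ P, MvPolynomial.monomial α (g.coeff α * α i)

/-- The minimum of the linear form `κ` on the support of `g` is `ℓ`, and it is attained precisely
on `P`. -/
structure IsInit (g : MvPolynomial ι k) (κ : ι → ℕ) (P : Finset (ι →₀ ℕ)) (ℓ : ℕ) : Prop where
  nonempty : P.Nonempty
  subset : P ⊆ g.support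
  le : ∀ α ∈ g.support, ℓ ≤ lev κ α
  iff : ∀ α ∈ g.support, lev κ α = ℓ ↔ α ∈ P

lemma homog_monomial (wt : ι → ℤ) (α : ι →₀ ℕ) (c : k) :
    Homog wt (MvPolynomial.monomial α c) (∑ i, wt i * α i) := by
  intro B _ _ a x
  rw [MvPolynomial.aeval_monomial, MvPolynomial.aeval_monomial,
    Finsupp.prod_fintype _ _ (fun _ => pow_zero _), Finsupp.prod_fintype _ _ (fun _ => pow_zero _)]
  simp only [torus]
  have e : ∏ i, (((a ^ wt i : Bˣ) : B) * x i) ^ α i =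
      ((a ^ (∑ i, wt i * α i) : Bˣ) : B) * ∏ i, x i ^ α i := by
    have h : (a ^ (∑ i, wt i * α i) : Bˣ) = ∏ i, (a ^ wt i) ^ α i := by
      have h2 : ∀ s : Finset ι, (a ^ (∑ i ∈ s, wt i * α i) : Bˣ) = ∏ i ∈ s, (a ^ wt i) ^ α i := by
        intro s
        classical
        induction s using Finset.induction_on with
        | empty => simp
        | insert i s hi ih =>
          rw [Finset.sum_insert hi, Finset.prod_insert hi, zpow_add, ih, zpow_mul, zpow_natCast]
      exact h2 _
    rw [h, Units.coe_prod, ← Finset.prod_mul_distrib]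
    exact Finset.prod_congr rfl fun i _ => by rw [mul_pow, Units.val_pow_eq_pow_val]
  rw [e]
  ring

lemma homog_initForm (g : MvPolynomial ι k) (P : Finset (ι →₀ ℕ)) (wt : ι → ℤ) (d : ℤ)
    (h : ∀ α ∈ P, ∑ i, wt i * α i = d) : Homog wt (initForm g P) d :=
  Homog.sum P fun α hα => h α hα ▸ homog_monomial wt α _

lemma homog_logDeriv (g : MvPolynomial ι k) (P : Finset (ι →₀ ℕ)) (i : ι) (wt : ι → ℤ) (d : ℤ)
    (h : ∀ α ∈ P, ∑ i, wt i * α i = d) : Homog wt (logDeriv g P i) d :=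
  Homog.sum P fun α hα => h α hα ▸ homog_monomial wt α _

/-- For coordinates `t ^ κ i * ψ i`, the value of `g` divided by `t ^ ℓ`. -/
def gev {B : Type u} [CommRing B] [Algebra k B] (g : MvPolynomial ι k) (κ : ι → ℕ) (ℓ : ℕ)
    (ψ : ι → B[X]) : B[X] :=
  ∑ α ∈ g.support, C (algebraMap k B (g.coeff α)) * X ^ (lev κ α - ℓ) * ∏ i, ψ i ^ α i

/-- The polynomial in the coordinate `i₀` obtained from `gev`. -/
def gevPoly {B : Type u} [CommRing B] [Algebra k B] (g : MvPolynomial ι k) (κ : ι → ℕ) (ℓ : ℕ)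
    (ψ : ι → B[X]) (i₀ : ι) : B[X][X] :=
  ∑ α ∈ g.support, C (C (algebraMap k B (g.coeff α)) * X ^ (lev κ α - ℓ) *
    ∏ i ∈ Finset.univ.erase i₀, ψ i ^ α i) * X ^ α i₀

variable {B : Type u} [CommRing B] [Algebra k B] {g : MvPolynomial ι k} {κ : ι → ℕ}
  {P : Finset (ι →₀ ℕ)} {ℓ : ℕ}

lemma aeval_X_pow_mul (h : ∀ α ∈ g.support, ℓ ≤ lev κ α) (ψ : ι → B[X]) :
    MvPolynomial.aeval (fun i => X ^ κ i * ψ i) g = X ^ ℓ * gev g κ ℓ ψ := by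
  rw [MvPolynomial.aeval_def, MvPolynomial.eval₂_eq', gev, Finset.mul_sum]
  refine Finset.sum_congr rfl fun α hα => ?_
  have e : ∏ i, (X ^ κ i * ψ i) ^ α i = (X : B[X]) ^ lev κ α * ∏ i, ψ i ^ α i := by
    rw [lev, ← Finset.prod_pow_eq_pow_sum, ← Finset.prod_mul_distrib]
    exact Finset.prod_congr rfl fun i _ => by rw [mul_pow, pow_mul]
  have e2 : (X : B[X]) ^ lev κ α = X ^ ℓ * X ^ (lev κ α - ℓ) := by
    rw [← pow_add, Nat.add_sub_cancel' (h α hα)]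
  rw [e, e2, Polynomial.algebraMap_apply]
  ring

lemma gevPoly_eval (ψ : ι → B[X]) (i₀ : ι) (y : B[X]) :
    (gevPoly g κ ℓ ψ i₀).eval y = gev g κ ℓ (Function.update ψ i₀ y) := by
  rw [gevPoly, gev, Polynomial.eval_finsetSum]
  refine Finset.sum_congr rfl fun α _ => ?_
  rw [eval_mul, eval_C, eval_pow, eval_X, ← Finset.mul_prod_erase _ _ (Finset.mem_univ i₀),
    Function.update_self]
  have e : ∏ i ∈ Finset.univ.erase i₀, Function.update ψ i₀ y i ^ α i =
      ∏ i ∈ Finset.univ.erase i₀, ψ i ^ α i :=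
    Finset.prod_congr rfl fun i hi => by rw [Function.update_of_ne (Finset.ne_of_mem_erase hi)]
  rw [e]
  ring

lemma coeff_zero_X_pow_sub (h : IsInit g κ P ℓ) {α : ι →₀ ℕ} (hα : α ∈ g.support) :
    constantCoeff ((X : B[X]) ^ (lev κ α - ℓ)) = if α ∈ P then 1 else 0 := by
  have h1 := h.le α hα
  split_ifs with hP
  · rw [(h.iff α hα).2 hP, Nat.sub_self, pow_zero, map_one]
  · have h2 : lev κ α ≠ ℓ := fun h2 => hP ((h.iff α hα).1 h2)
    rw [map_pow, constantCoeff_apply, coeff_X_zero, zero_pow (by omega)]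

lemma gev_coeff_zero (h : IsInit g κ P ℓ) (ψ : ι → B[X]) :
    (gev g κ ℓ ψ).coeff 0 = MvPolynomial.aeval (fun i => (ψ i).coeff 0) (initForm g P) := by
  rw [← constantCoeff_apply, gev, map_sum, initForm, map_sum,
    ← Finset.sum_subset h.subset (f := fun α => constantCoeff _)]
  · refine Finset.sum_congr rfl fun α hα => ?_
    rw [map_mul, map_mul, coeff_zero_X_pow_sub h (h.subset hα), if_pos hα, mul_one,
      MvPolynomial.aeval_monomial, Finsupp.prod_fintype _ _ (fun _ => pow_zero _), map_prod]
    simp only [map_pow]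
    simp [constantCoeff_apply]
  · intro α hα hP
    rw [map_mul, map_mul, coeff_zero_X_pow_sub h hα, if_neg hP, mul_zero, zero_mul]

lemma gevPoly_derivative_coeff_zero (h : IsInit g κ P ℓ) (ψ : ι → B[X]) (i₀ : ι) :
    (((derivative (gevPoly g κ ℓ ψ i₀)).eval (ψ i₀)).coeff 0) * (ψ i₀).coeff 0 =
      MvPolynomial.aeval (fun i => (ψ i).coeff 0) (logDeriv g P i₀) := by
  rw [← constantCoeff_apply, ← constantCoeff_apply, ← map_mul, gevPoly, derivative_sum,
    Polynomial.eval_finsetSum, Finset.sum_mul, map_sum, logDeriv, map_sum,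
    ← Finset.sum_subset h.subset (f := fun α => constantCoeff _)]
  · refine Finset.sum_congr rfl fun α hα => ?_
    rw [MvPolynomial.aeval_monomial, Finsupp.prod_fintype _ _ (fun _ => pow_zero _),
      ← Finset.mul_prod_erase _ _ (Finset.mem_univ i₀), derivative_C_mul, eval_mul, eval_C,
      derivative_X_pow, map_mul, map_mul, map_mul, map_mul, coeff_zero_X_pow_sub h (h.subset hα),
      if_pos hα, map_prod]
    rcases Nat.eq_zero_or_pos (α i₀) with h0 | h0
    · simp [h0]
    · have e : (ψ i₀).coeff 0 ^ α i₀ = (ψ i₀).coeff 0 ^ (α i₀ - 1) * (ψ i₀).coeff 0 := by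
        rw [← pow_succ, Nat.sub_add_cancel h0]
      have hC : ∀ c : B, constantCoeff (C c) = c := fun c => coeff_C_zero
      rw [e]
      simp only [eval_mul, eval_pow, eval_X, map_mul, map_pow, map_natCast, hC,
        eval_natCast]
      simp only [constantCoeff_apply]
      ring
  · intro α hα hP
    rw [derivative_C_mul, eval_mul, eval_C, map_mul, map_mul, map_mul, map_mul,
      coeff_zero_X_pow_sub h hα, if_neg hP]
    ring

end InitialForms

/-! ### The classes of the strata of the spaces of arcs -/

section Reduction

open Polynomial

variable {k : Type u} [Field k] {ι : Type} {B : Type u} [CommRing B] {m : ℕ}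

/-- The coefficients up to order `m` of the arc with coordinates `t ^ κ i * ψ i`. -/
def ofSeries (κ : ι → ℕ) (ψ : ι → B[X]) : ι × Fin (m + 1) → B :=
  fun p => if (p.2 : ℕ) < κ p.1 then 0 else (ψ p.1).coeff (p.2 - κ p.1)

lemma coeff_arc_eq (x : ι × Fin (m + 1) → B) (i : ι) (r : ℕ) :
    (arc x i).coeff r = if h : r < m + 1 then x (i, ⟨r, h⟩) else 0 := by
  split_ifs with h
  · exact coeff_arc x i ⟨r, h⟩
  · rw [arc, finsetSum_coeff]
    refine Finset.sum_eq_zero fun j _ => ?_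
    have h2 : r ≠ j := by omega
    simp [coeff_X_pow, h2]

lemma arc_ofSeries (κ : ι → ℕ) (ψ : ι → B[X]) (i : ι)
    (h : ∀ r, m < κ i + r → (ψ i).coeff r = 0) :
    arc (ofSeries (m := m) κ ψ) i = X ^ κ i * ψ i := by
  ext r
  rw [coeff_arc_eq, coeff_X_pow_mul']
  by_cases h1 : κ i ≤ r
  · rw [if_pos h1]
    split_ifs with h2
    · rw [ofSeries]
      exact if_neg (not_lt.2 h1)
    · rw [h _ (by omega)]
  · rw [if_neg h1]
    split_ifs with h2
    · rw [ofSeries]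
      exact if_pos (not_le.1 h1)
    · rfl

lemma exists_ofSeries (κ : ι → ℕ) (x : ι × Fin (m + 1) → B)
    (hx : ∀ i (j : Fin (m + 1)), (j : ℕ) < κ i → x (i, j) = 0) :
    ∃ ψ : ι → B[X], (∀ i r, m < κ i + r → (ψ i).coeff r = 0) ∧ x = ofSeries κ ψ := by
  have h : ∀ i, ∃ q, arc x i = X ^ κ i * q := fun i => X_pow_dvd_iff.2 fun d hd => by
    rw [coeff_arc_eq]
    split_ifs with h1
    · exact hx i ⟨d, h1⟩ hd
    · rfl
  choose ψ hψ using h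
  have hc : ∀ i r, (ψ i).coeff r = (arc x i).coeff (r + κ i) := fun i r => by
    rw [hψ, coeff_X_pow_mul]
  refine ⟨ψ, fun i r hr => ?_, ?_⟩
  · rw [hc, coeff_arc_eq, dif_neg (by omega)]
  · funext ⟨i, j⟩
    rw [ofSeries]
    split_ifs with h1
    · exact hx i j h1
    · have h2 : (j : ℕ) - κ i + κ i = j := Nat.sub_add_cancel (not_lt.1 h1)
      simp only [hc, h2]
      exact (coeff_arc x i j).symm

lemma ofSeries_self {κ : ι → ℕ} {ψ : ι → B[X]} {i : ι} {j : Fin (m + 1)} (h : (j : ℕ) = κ i) :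
    ofSeries κ ψ (i, j) = (ψ i).coeff 0 := by
  simp [ofSeries, h]

lemma ofSeries_val (κ : ι → Fin (m + 1)) (ψ : ι → B[X]) (i : ι) :
    ofSeries (fun i => (κ i : ℕ)) ψ (i, κ i) = (ψ i).coeff 0 :=
  ofSeries_self (κ := fun i => (κ i : ℕ)) rfl

variable [Fintype ι] [DecidableEq ι] [Algebra k B] {g : MvPolynomial ι k} {P : Finset (ι →₀ ℕ)}

lemma sum_mul_eq_lev (κ : ι → ℕ) (α : ι →₀ ℕ) : ∑ i, (κ i : ℤ) * α i = (lev κ α : ℤ) := by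
  rw [lev]
  push_cast
  rfl

/-- The open subset of the torus where `initForm g P` is invertible. -/
def baseA (g : MvPolynomial ι k) (P : Finset (ι →₀ ℕ)) (κ : ι → ℕ) (ℓ : ℕ) (hℓ : 0 < ℓ)
    (hP : ∀ α ∈ P, lev κ α = ℓ) : WPres k ι where
  wt i := κ i
  eqs := ∅
  inv := ∏ i, MvPolynomial.X i
  gm := initForm g P
  n := ℓ
  n_pos := hℓ
  eqs_homog f hf := hf.elim
  inv_homog := ⟨_, Homog.prod _ fun i _ => Homog.X _ i⟩
  gm_homog := homog_initForm g P _ _ fun α hα => by rw [sum_mul_eq_lev, hP α hα]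

lemma isPt_baseA {κ : ι → ℕ} {ℓ : ℕ} {hℓ : 0 < ℓ} {hP : ∀ α ∈ P, lev κ α = ℓ} {x : ι → B} :
    (baseA g P κ ℓ hℓ hP).IsPt x ↔
      IsUnit (MvPolynomial.aeval x (initForm g P)) ∧ ∀ i, IsUnit (x i) := by
  have e : IsUnit (MvPolynomial.aeval x (baseA g P κ ℓ hℓ hP).inv) ↔ ∀ i, IsUnit (x i) := by
    change IsUnit (MvPolynomial.aeval x (∏ i, MvPolynomial.X i : MvPolynomial ι k)) ↔ _
    rw [map_prod, IsUnit.prod_iff]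
    simp
  exact ⟨fun h => ⟨h.gm, e.1 h.inv⟩, fun h => ⟨fun f hf => hf.elim, h.1, e.2 h.2⟩⟩

/-- The product of `𝔾ₘ` with the subset of the torus where `initForm g P` vanishes and where
`logDeriv g P (e a)` is the first logarithmic derivative that does not vanish. -/
def baseB (g : MvPolynomial ι k) (P : Finset (ι →₀ ℕ)) {N : ℕ} (e : Fin N → ι) (a : Fin N)
    (κ : ι → ℕ) (ℓ m : ℕ) (hm : 0 < m) (hP : ∀ α ∈ P, lev κ α = ℓ) : WPres k (Option ι) where
  wt i := i.elim (m : ℤ) fun i => κ i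
  eqs := insert (MvPolynomial.rename some (initForm g P))
    {f | ∃ b < a, f = MvPolynomial.rename some (logDeriv g P (e b))}
  inv := MvPolynomial.rename some ((∏ i, MvPolynomial.X i) * logDeriv g P (e a))
  gm := MvPolynomial.X none
  n := m
  n_pos := hm
  eqs_homog := by
    rintro f (rfl | ⟨b, -, rfl⟩)
    · exact ⟨ℓ, WPres.homog_rename_some
        (homog_initForm g P _ _ fun α hα => (sum_mul_eq_lev κ α).trans (by rw [hP α hα]))⟩
    · exact ⟨ℓ, WPres.homog_rename_some
        (homog_logDeriv g P _ _ _ fun α hα => (sum_mul_eq_lev κ α).trans (by rw [hP α hα]))⟩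
  inv_homog := ⟨_, WPres.homog_rename_some ((Homog.prod _ fun i _ => Homog.X _ i).mul
    (homog_logDeriv g P _ _ _ fun α hα => (sum_mul_eq_lev κ α).trans (by rw [hP α hα])))⟩
  gm_homog := Homog.X _ none

lemma isPt_baseB {N : ℕ} {e : Fin N → ι} {a : Fin N} {κ : ι → ℕ} {ℓ m : ℕ} {hm : 0 < m}
    {hP : ∀ α ∈ P, lev κ α = ℓ} {x : Option ι → B} :
    (baseB g P e a κ ℓ m hm hP).IsPt x ↔
      IsUnit (x none) ∧ (∀ i, IsUnit (x (some i))) ∧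
      MvPolynomial.aeval (fun i => x (some i)) (initForm g P) = 0 ∧
      (∀ b < a, MvPolynomial.aeval (fun i => x (some i)) (logDeriv g P (e b)) = 0) ∧
      IsUnit (MvPolynomial.aeval (fun i => x (some i)) (logDeriv g P (e a))) := by
  have hr : ∀ f : MvPolynomial ι k, MvPolynomial.aeval x (MvPolynomial.rename some f) =
      MvPolynomial.aeval (fun i => x (some i)) f := fun f => MvPolynomial.aeval_rename _ _ _
  have e0 : IsUnit (MvPolynomial.aeval x (baseB g P e a κ ℓ m hm hP).inv) ↔
      (∀ i, IsUnit (x (some i))) ∧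
      IsUnit (MvPolynomial.aeval (fun i => x (some i)) (logDeriv g P (e a))) := by
    refine (iff_of_eq (congrArg IsUnit (hr _))).trans ?_
    rw [map_mul, IsUnit.mul_iff, map_prod, IsUnit.prod_iff]
    simp
  constructor
  · intro h
    have h1 : IsUnit (MvPolynomial.aeval x (MvPolynomial.X none : MvPolynomial (Option ι) k)) :=
      h.gm
    rw [MvPolynomial.aeval_X] at h1
    obtain ⟨h2, h3⟩ := e0.1 h.inv
    refine ⟨h1, h2, ?_, fun b hb => ?_, h3⟩
    · rw [← hr]
      exact h.eqs _ (Set.mem_insert _ _)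
    · rw [← hr]
      exact h.eqs _ (Set.mem_insert_of_mem _ ⟨b, hb, rfl⟩)
  · rintro ⟨h1, h2, h3, h4, h5⟩
    refine ⟨?_, ?_, e0.2 ⟨h2, h5⟩⟩
    · rintro f (rfl | ⟨b, hb, rfl⟩)
      · rw [hr, h3]
      · rw [hr, h4 b hb]
    · change IsUnit (MvPolynomial.aeval x (MvPolynomial.X none : MvPolynomial (Option ι) k))
      rwa [MvPolynomial.aeval_X]

variable {V : Set ι} {hm : 0 < m} {κ : ι → Fin (m + 1)} {ℓ : ℕ}

lemma isPt_ordStratum_ofSeries (h : ∀ α ∈ g.support, ℓ ≤ lev (fun i => κ i) α)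
    (hV : ∀ i ∈ V, 0 < κ i) (ψ : ι → B[X]) (hψ : ∀ i r, m < κ i + r → (ψ i).coeff r = 0) :
    ((jetPres g V hm).ordStratum Finset.univ κ).IsPt (ofSeries (m := m) (fun i => κ i) ψ) ↔
      (∀ l < m, (X ^ ℓ * gev g (fun i => κ i) ℓ ψ).coeff l = 0) ∧
      IsUnit ((X ^ ℓ * gev g (fun i => κ i) ℓ ψ).coeff m) ∧ ∀ i, IsUnit ((ψ i).coeff 0) := by
  have e : MvPolynomial.aeval (arc (ofSeries (m := m) (fun i => κ i) ψ)) g =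
      X ^ ℓ * gev g (fun i => κ i) ℓ ψ := by
    rw [← aeval_X_pow_mul h]
    congr 2
    funext i
    exact arc_ofSeries _ ψ i (hψ i)
  rw [WPres.isPt_ordStratum, isPt_jetPres, e]
  constructor
  · rintro ⟨⟨h1, h2, -⟩, h3⟩
    refine ⟨h1, h2, fun i => ?_⟩
    have := (h3 i (Finset.mem_univ i)).2
    rwa [ofSeries_val] at this
  · rintro ⟨h1, h2, h3⟩
    have h4 : ∀ i, ∀ j < κ i, ofSeries (fun i => (κ i : ℕ)) ψ (i, j) = 0 := fun i j hj => if_pos hj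
    refine ⟨⟨h1, h2, fun i hi => h4 i 0 (hV i hi)⟩, fun i _ => ⟨h4 i, ?_⟩⟩
    rw [ofSeries_val]
    exact h3 i

lemma exists_ofSeries_of_isPt {y : ι × Fin (m + 1) → B}
    (hy : ((jetPres g V hm).ordStratum Finset.univ κ).IsPt y) :
    ∃ ψ : ι → B[X], (∀ i r, m < κ i + r → (ψ i).coeff r = 0) ∧ y = ofSeries (fun i => κ i) ψ :=
  exists_ofSeries _ y fun i j hj =>
    ((WPres.isPt_ordStratum.1 hy).2 i (Finset.mem_univ i)).1 j hj

/-- The indices of the coefficients of an arc above the initial ones. -/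
abbrev HigherCoeff (κ : ι → Fin (m + 1)) : Type := {p : ι × Fin (m + 1) // κ p.1 < p.2}

lemma card_higherCoeff (κ : ι → Fin (m + 1)) :
    (Fintype.card (HigherCoeff κ) : ℤ) = ∑ i, ((m : ℤ) - (κ i : ℕ)) := by
  have e : HigherCoeff κ ≃ (i : ι) × {j : Fin (m + 1) // κ i < j} :=
    Equiv.subtypeProdEquivSigmaSubtype fun i j => κ i < j
  rw [Fintype.card_congr e, Fintype.card_sigma]
  push_cast
  refine Finset.sum_congr rfl fun i _ => ?_
  have h : Fintype.card {j : Fin (m + 1) // κ i < j} = m - κ i := by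
    rw [Fintype.card_subtype]
    have e2 : (Finset.univ.filter fun j => κ i < j) = Finset.Ioi (κ i) := by
      ext j
      simp
    rw [e2, Fin.card_Ioi]
    omega
  rw [h]
  have := (κ i).is_le
  omega

/-- The stratum is empty if `g` vanishes to an order greater than `m`. -/
lemma cls_ordStratum_of_lt (h : ∀ α ∈ g.support, ℓ ≤ lev (fun i => κ i) α) (hmℓ : m < ℓ)
    (hV : ∀ i ∈ V, 0 < κ i) : ((jetPres g V hm).ordStratum Finset.univ κ).cls = 0 := by
  refine WPres.cls_eq_zero _ fun B _ _ y hy => ?_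
  obtain ⟨ψ, hψ, rfl⟩ := exists_ofSeries_of_isPt hy
  have h1 := ((isPt_ordStratum_ofSeries h hV ψ hψ).1 hy).2.1
  rw [coeff_X_pow_mul', if_neg (by omega)] at h1
  exact isUnit_zero_iff.1 h1 |> fun h => subsingleton_of_zero_eq_one h

/-- A stratum is empty if a coordinate that is required to vanish has order zero. -/
lemma cls_ordStratum_of_order_zero (i : ι) (hi : i ∈ V) (hκ : κ i = 0) :
    ((jetPres g V hm).ordStratum Finset.univ κ).cls = 0 := by
  refine WPres.cls_eq_zero _ fun B _ _ y hy => ?_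
  have h1 := ((WPres.isPt_ordStratum.1 hy).2 i (Finset.mem_univ i)).2
  rw [hκ, (isPt_jetPres.1 (WPres.isPt_ordStratum.1 hy).1).2.2 i hi] at h1
  exact isUnit_zero_iff.1 h1 |> fun h => subsingleton_of_zero_eq_one h

/-- The class of a stratum on which the order of `g` is the generic one. -/
lemma cls_ordStratum_eq (h : IsInit g (fun i => κ i) P m) (hV : ∀ i ∈ V, 0 < κ i) :
    ((jetPres g V hm).ordStratum Finset.univ κ).cls =
      (LaurentPolynomial.T (∑ i, ((m : ℤ) - (κ i : ℕ))) : ℤ[T;T⁻¹]) •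
        (baseA g P (fun i => κ i) m hm fun α hα => (h.iff α (h.subset hα)).2 hα).cls := by
  rw [← card_higherCoeff]
  have hm0 : ∀ {B : Type u} [CommRing B] [Algebra k B] (ψ : ι → B[X]),
      (X ^ m * gev g (fun i => (κ i : ℕ)) m ψ).coeff m =
        MvPolynomial.aeval (fun i => (ψ i).coeff 0) (initForm g P) := fun ψ => by
    rw [coeff_X_pow_mul_zero_add, gev_coeff_zero h]
  refine WPres.cls_eq_of_bundle _ _ (fun B _ _ y i => y (i, κ i)) Subtype.val rfl ?_ ?_ ?_ ?_ ?_
  · intro B _ _ y hy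
    obtain ⟨ψ, hψ, rfl⟩ := exists_ofSeries_of_isPt hy
    obtain ⟨-, h2, h3⟩ := (isPt_ordStratum_ofSeries h.le hV ψ hψ).1 hy
    rw [hm0] at h2
    refine isPt_baseA.2 ?_
    simp only [ofSeries_val]
    exact ⟨h2, h3⟩
  · intros
    rfl
  · intros
    rfl
  · intro B _ _ y hy
    obtain ⟨ψ, hψ, rfl⟩ := exists_ofSeries_of_isPt hy
    change MvPolynomial.aeval _ (initForm g P) = MvPolynomial.aeval _ (jetCoeff g m m)
    rw [aeval_jetCoeff]
    have e : arc (ofSeries (m := m) (fun i => (κ i : ℕ)) ψ) = fun i => X ^ (κ i : ℕ) * ψ i :=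
      funext fun i => arc_ofSeries _ ψ i (hψ i)
    rw [e, aeval_X_pow_mul h.le, hm0]
    simp only [ofSeries_val]
  · intro B _ _ x w hx
    obtain ⟨h1, h2⟩ := isPt_baseA.1 hx
    refine ⟨fun p => if hp : κ p.1 < p.2 then w ⟨p, hp⟩ else if κ p.1 = p.2 then x p.1 else 0,
      ⟨?_, ?_, ?_⟩, ?_⟩
    · set y : ι × Fin (m + 1) → B := fun p =>
        if hp : κ p.1 < p.2 then w ⟨p, hp⟩ else if κ p.1 = p.2 then x p.1 else 0 with hy
      obtain ⟨ψ, hψ, hyψ⟩ := exists_ofSeries (fun i => (κ i : ℕ)) y fun i j hj => by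
        have hj' : j < κ i := hj
        simp only [hy]
        rw [dif_neg (not_lt.2 hj'.le), if_neg hj'.ne']
      have hx' : ∀ i, (ψ i).coeff 0 = x i := fun i => by
        rw [← ofSeries_val κ ψ, ← hyψ]
        simp [hy]
      rw [hyψ, isPt_ordStratum_ofSeries h.le hV ψ hψ, hm0]
      simp only [hx']
      refine ⟨fun l hl => ?_, h1, h2⟩
      rw [coeff_X_pow_mul', if_neg (by omega)]
    · funext i
      simp
    · rintro ⟨p, hp⟩
      simp [hp]
    · rintro y ⟨hy1, hy2, hy3⟩
      funext p
      split_ifs with h3 h4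
      · exact hy3 ⟨p, h3⟩
      · obtain ⟨i, j⟩ := p
        rw [← hy2, ← show κ i = j from h4]
      · exact ((WPres.isPt_ordStratum.1 hy1).2 p.1 (Finset.mem_univ _)).1 p.2
          (lt_of_le_of_ne (not_lt.1 h3) (Ne.symm h4))

lemma WPres.homog_rename {σ τ : Type} {w : τ → ℤ} {f : MvPolynomial σ k} {d : ℤ} (r : σ → τ)
    (h : Homog (fun i => w (r i)) f d) : Homog w (MvPolynomial.rename r f) d := by
  intro B _ _ a x
  rw [MvPolynomial.aeval_rename, MvPolynomial.aeval_rename]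
  exact h B a (x ∘ r)

/-- The logarithmic derivative in the direction `i`, as a function of the initial coefficients of
an arc. -/
def initLogDeriv (g : MvPolynomial ι k) (P : Finset (ι →₀ ℕ)) (κ : ι → Fin (m + 1)) (i : ι) :
    MvPolynomial (ι × Fin (m + 1)) k :=
  MvPolynomial.rename (fun i => (i, κ i)) (logDeriv g P i)

lemma aeval_initLogDeriv (κ : ι → Fin (m + 1)) (i : ι) (y : ι × Fin (m + 1) → B) :
    MvPolynomial.aeval y (initLogDeriv g P κ i) =
      MvPolynomial.aeval (fun i => y (i, κ i)) (logDeriv g P i) :=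
  MvPolynomial.aeval_rename _ _ _

lemma homog_initLogDeriv (hP : ∀ α ∈ P, lev (fun i => (κ i : ℕ)) α = ℓ) (i : ι) :
    ∃ d, Homog ((jetPres g V hm).ordStratum Finset.univ κ).wt (initLogDeriv g P κ i) d :=
  ⟨ℓ, WPres.homog_rename _ (homog_logDeriv g P i (fun i => ((κ i : ℕ) : ℤ)) ℓ
    fun α hα => (sum_mul_eq_lev _ α).trans (by rw [hP α hα]))⟩

/-- The higher coefficients of an arc that are not determined by the value of `g`. -/
abbrev FreeCoeff (κ : ι → Fin (m + 1)) (i₀ : ι) (j : ℕ) : Type :=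
  {p : ι × Fin (m + 1) // κ p.1 < p.2 ∧ ¬ (p.1 = i₀ ∧ (p.2 : ℕ) ≤ κ i₀ + j)}

lemma card_freeCoeff (κ : ι → Fin (m + 1)) (i₀ : ι) (j : ℕ) (h : κ i₀ + j ≤ m) :
    (Fintype.card (FreeCoeff κ i₀ j) : ℤ) = ∑ i, ((m : ℤ) - (κ i : ℕ)) - j := by
  rw [← card_higherCoeff]
  let f : FreeCoeff κ i₀ j ⊕ Fin j → HigherCoeff κ :=
    Sum.elim (fun p => ⟨p.1, p.2.1⟩) fun r => ⟨(i₀, ⟨κ i₀ + (r + 1), by omega⟩), by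
      change (κ i₀ : ℕ) < κ i₀ + (r + 1)
      omega⟩
  have hf : Function.Bijective f := by
    constructor
    · rintro (p | r) (q | s) hpq
      · have h1 : p.1 = q.1 := congrArg (fun p : HigherCoeff κ => p.1) hpq
        rw [Subtype.ext h1]
      · have h1 : p.1 = (i₀, ⟨κ i₀ + (s + 1), by omega⟩) :=
          congrArg (fun p : HigherCoeff κ => p.1) hpq
        refine absurd ?_ p.2.2
        rw [h1]
        exact ⟨rfl, by simp⟩
      · have h1 : (i₀, ⟨κ i₀ + (r + 1), by omega⟩) = q.1 :=
          congrArg (fun p : HigherCoeff κ => p.1) hpq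
        refine absurd ?_ q.2.2
        rw [← h1]
        exact ⟨rfl, by simp⟩
      · have h1 := congrArg (fun p : HigherCoeff κ => (p.1.2 : ℕ)) hpq
        simp only [f, Sum.elim_inr] at h1
        congr 1
        ext
        omega
    · rintro ⟨⟨i, r⟩, hp⟩
      by_cases h1 : i = i₀ ∧ (r : ℕ) ≤ κ i₀ + j
      · obtain ⟨rfl, h2⟩ := h1
        have h3 : (κ i : ℕ) < r := hp
        refine ⟨Sum.inr ⟨r - κ i - 1, by omega⟩, ?_⟩
        simp only [f, Sum.elim_inr]
        congr 2
        ext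
        simp only
        omega
      · exact ⟨Sum.inl ⟨(i, r), hp, h1⟩, rfl⟩
  rw [← Fintype.card_congr (Equiv.ofBijective f hf), Fintype.card_sum, Fintype.card_fin]
  push_cast
  ring

/-- The part of a stratum where the order of `g` is greater than the generic one and the
logarithmic derivative in the direction `e a` is the first one that does not vanish. -/
lemma cls_firstNonzero_eq (h : IsInit g (fun i => κ i) P ℓ) (hℓ : ℓ < m) (hV : ∀ i ∈ V, 0 < κ i)
    (hκ : ∀ i, (κ i : ℕ) ≤ ℓ) {N : ℕ} (e : Fin N → ι) (a : Fin N) :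
    (((jetPres g V hm).ordStratum Finset.univ κ).firstNonzero (fun b => initLogDeriv g P κ (e b))
      (fun b => homog_initLogDeriv (fun α hα => (h.iff α (h.subset hα)).2 hα) (e b)) a).cls =
      (LaurentPolynomial.T (∑ i, ((m : ℤ) - (κ i : ℕ)) - (m - ℓ : ℕ)) : ℤ[T;T⁻¹]) •
        (baseB g P e a (fun i => κ i) ℓ m hm fun α hα => (h.iff α (h.subset hα)).2 hα).cls := by
  obtain ⟨j, rfl⟩ := Nat.exists_eq_add_of_lt hℓ
  have hj : ℓ + j + 1 - ℓ = j + 1 := by omega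
  rw [hj, ← card_freeCoeff κ (e a) (j + 1) (by have := hκ (e a); omega)]
  -- the points, in terms of the series `ψ`
  have key : ∀ {B : Type u} [CommRing B] [Algebra k B] (ψ : ι → B[X]),
      (∀ i r, ℓ + j + 1 < κ i + r → (ψ i).coeff r = 0) →
      ((((jetPres g V hm).ordStratum Finset.univ κ).firstNonzero
        (fun b => initLogDeriv g P κ (e b)) (fun b => homog_initLogDeriv
          (fun α hα => (h.iff α (h.subset hα)).2 hα) (e b)) a).IsPt
        (ofSeries (fun i => κ i) ψ) ↔
      (∀ r < j + 1, (gev g (fun i => κ i) ℓ ψ).coeff r = 0) ∧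
      IsUnit ((gev g (fun i => κ i) ℓ ψ).coeff (j + 1)) ∧ (∀ i, IsUnit ((ψ i).coeff 0)) ∧
      (∀ b < a, MvPolynomial.aeval (fun i => (ψ i).coeff 0) (logDeriv g P (e b)) = 0) ∧
      IsUnit (MvPolynomial.aeval (fun i => (ψ i).coeff 0) (logDeriv g P (e a)))) := by
    intro B _ _ ψ hψ
    rw [WPres.isPt_firstNonzero, isPt_ordStratum_ofSeries h.le hV ψ hψ]
    simp only [aeval_initLogDeriv, ofSeries_val]
    have e1 : (X ^ ℓ * gev g (fun i => (κ i : ℕ)) ℓ ψ).coeff (ℓ + j + 1) =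
        (gev g (fun i => (κ i : ℕ)) ℓ ψ).coeff (j + 1) := by
      rw [coeff_X_pow_mul', if_pos (by omega), hj]
    rw [e1, and_assoc, and_assoc]
    refine and_congr_left fun _ => ⟨fun h1 r hr => ?_, fun h1 l hl => ?_⟩
    · have := h1 (ℓ + r) (by omega)
      rwa [add_comm ℓ r, coeff_X_pow_mul] at this
    · rw [coeff_X_pow_mul']
      split_ifs with h2
      · exact h1 _ (by omega)
      · rfl
  have hex : ∀ {B : Type u} [CommRing B] [Algebra k B] (y : ι × Fin (ℓ + j + 1 + 1) → B),
      (((jetPres g V hm).ordStratum Finset.univ κ).firstNonzero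
        (fun b => initLogDeriv g P κ (e b)) (fun b => homog_initLogDeriv
          (fun α hα => (h.iff α (h.subset hα)).2 hα) (e b)) a).IsPt y →
      ∃ ψ : ι → B[X], (∀ i r, ℓ + j + 1 < κ i + r → (ψ i).coeff r = 0) ∧
        y = ofSeries (fun i => κ i) ψ :=
    fun y hy => exists_ofSeries_of_isPt (WPres.isPt_firstNonzero.1 hy).1
  have hgm : ∀ {B : Type u} [CommRing B] [Algebra k B] (ψ : ι → B[X]),
      (∀ i r, ℓ + j + 1 < κ i + r → (ψ i).coeff r = 0) →
      MvPolynomial.aeval (ofSeries (m := ℓ + j + 1) (fun i => (κ i : ℕ)) ψ)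
        (jetCoeff g (ℓ + j + 1) (ℓ + j + 1)) =
      (gev g (fun i => (κ i : ℕ)) ℓ ψ).coeff (j + 1) := by
    intro B _ _ ψ hψ
    rw [aeval_jetCoeff]
    have e1 : arc (ofSeries (m := ℓ + j + 1) (fun i => (κ i : ℕ)) ψ) =
        fun i => X ^ (κ i : ℕ) * ψ i := funext fun i => arc_ofSeries _ ψ i (hψ i)
    rw [e1, aeval_X_pow_mul h.le, coeff_X_pow_mul', if_pos (by omega), hj]
  have hder : ∀ {B : Type u} [CommRing B] [Algebra k B] (ψ : ι → B[X]),
      IsUnit (MvPolynomial.aeval (fun i => (ψ i).coeff 0) (logDeriv g P (e a))) →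
      IsUnit (((derivative (gevPoly g (fun i => (κ i : ℕ)) ℓ ψ (e a))).eval
        (ψ (e a))).coeff 0) := by
    intro B _ _ ψ hu
    rw [← gevPoly_derivative_coeff_zero h] at hu
    exact isUnit_of_mul_isUnit_left hu
  refine WPres.cls_eq_of_bundle _ _ (fun B _ _ y i => i.elim
    (MvPolynomial.aeval y (jetCoeff g (ℓ + j + 1) (ℓ + j + 1))) fun i => y (i, κ i))
    Subtype.val rfl ?_ ?_ ?_ ?_ ?_
  · intro B _ _ y hy
    obtain ⟨ψ, hψ, rfl⟩ := hex y hy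
    obtain ⟨h1, h2, h3, h4, h5⟩ := (key ψ hψ).1 hy
    refine isPt_baseB.2 ?_
    simp only [Option.elim_none, Option.elim_some, ofSeries_val, hgm ψ hψ]
    exact ⟨h2, h3, by rw [← gev_coeff_zero h, h1 0 (Nat.succ_pos j)], h4, h5⟩
  · intro B B' _ _ _ _ f y hy i
    rcases i with - | i
    · exact aeval_comp_algHom f y _
    · rfl
  · intro B _ _ b y hy
    funext i
    rcases i with - | i
    · exact homog_jetCoeff g _ _ B b y
    · rfl
  · intro B _ _ y hy
    exact MvPolynomial.aeval_X _ _
  · intro B _ _ x w hx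
    obtain ⟨h1, h2, h3, h4, h5⟩ := isPt_baseB.1 hx
    have hm1 : ∀ i, (κ i : ℕ) + (j + 1) ≤ ℓ + j + 1 := fun i => by have := hκ i; omega
    refine existsUnique_of_exists_of_unique ?_ ?_
    · set y₀ : ι × Fin (ℓ + j + 1 + 1) → B := fun p =>
        if hp : κ p.1 < p.2 ∧ ¬ (p.1 = e a ∧ (p.2 : ℕ) ≤ κ (e a) + (j + 1)) then w ⟨p, hp⟩
        else if κ p.1 = p.2 then x (some p.1) else 0 with hy₀
      obtain ⟨ψ₀, hψ₀, hyψ₀⟩ := exists_ofSeries (fun i => (κ i : ℕ)) y₀ fun i r hr => by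
        have hr' : r < κ i := hr
        simp only [hy₀]
        rw [dif_neg fun h => h.1.not_gt hr', if_neg hr'.ne']
      have hx0 : ∀ i, (ψ₀ i).coeff 0 = x (some i) := fun i => by
        rw [← ofSeries_val κ ψ₀, ← hyψ₀]
        simp [hy₀]
      -- the coefficients of order `1, …, j + 1` in the direction `e a` are determined by those of
      -- `t⁻ˡ g`, which are to be `0, …, 0, x none`
      obtain ⟨y', hy1, hy2⟩ := exists_eval_coeff_eq
        (gevPoly g (fun i => (κ i : ℕ)) ℓ ψ₀ (e a)) (ψ₀ (e a))
        (hder ψ₀ (by simpa only [hx0] using h5)) (fun r => if r = j + 1 then x none else 0) (j + 1)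
      set ψ := Function.update ψ₀ (e a) y' with hψdef
      have hc : ∀ i r, i ≠ e a ∨ r = 0 ∨ j + 1 < r → (ψ i).coeff r = (ψ₀ i).coeff r := by
        intro i r hir
        by_cases hi : i = e a
        · subst hi
          rw [hψdef, Function.update_self]
          exact hy1 r (hir.resolve_left (not_not.2 rfl))
        · rw [hψdef, Function.update_of_ne hi]
      have hψ : ∀ i r, ℓ + j + 1 < κ i + r → (ψ i).coeff r = 0 := by
        intro i r hr
        rw [hc i r (Or.inr (Or.inr (by have := hm1 i; omega))), hψ₀ i r hr]
      have hx' : ∀ i, (ψ i).coeff 0 = x (some i) := fun i =>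
        (hc i 0 (Or.inr (Or.inl rfl))).trans (hx0 i)
      have hg : ∀ r, 0 < r → r ≤ j + 1 → (gev g (fun i => (κ i : ℕ)) ℓ ψ).coeff r =
          if r = j + 1 then x none else 0 := fun r hr1 hr2 => by
        rw [← hy2 r hr1 hr2, gevPoly_eval]
      have hg1 : (gev g (fun i => (κ i : ℕ)) ℓ ψ).coeff (j + 1) = x none := by
        rw [hg _ (Nat.succ_pos j) le_rfl, if_pos rfl]
      refine ⟨ofSeries (fun i => (κ i : ℕ)) ψ, (key ψ hψ).2 ⟨fun r hr => ?_, ?_, ?_⟩, ?_, ?_⟩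
      · rcases Nat.eq_zero_or_pos r with rfl | hr0
        · rw [gev_coeff_zero h]
          simpa only [hx'] using h3
        · rw [hg r hr0 hr.le, if_neg hr.ne]
      · rwa [hg1]
      · simp only [hx']
        exact ⟨h2, h4, h5⟩
      · funext i
        rcases i with - | i
        · simp only [Option.elim_none, hgm ψ hψ, hg1]
        · simp only [Option.elim_some, ofSeries_val, hx']
      · rintro ⟨⟨i, r⟩, hp⟩
        have hr : (κ i : ℕ) < r := hp.1
        have e1 : ofSeries (fun i => (κ i : ℕ)) ψ (i, r) = y₀ (i, r) := by
          rw [hyψ₀, ofSeries, ofSeries, if_neg hr.not_gt, if_neg hr.not_gt]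
          refine hc _ _ ?_
          by_cases hi : i = e a
          · subst hi
            have h6 : ¬ (r : ℕ) ≤ κ (e a) + (j + 1) := fun h6 => hp.2 ⟨rfl, h6⟩
            right; right
            simp only
            omega
          · exact Or.inl hi
        simp only [e1, hy₀]
        rw [dif_pos hp]
    · rintro y y' ⟨hy1, hy2, hy3⟩ ⟨hy1', hy2', hy3'⟩
      obtain ⟨ψ, hψ, rfl⟩ := hex y hy1
      obtain ⟨ψ', hψ', rfl⟩ := hex y' hy1'
      obtain ⟨p1, -, -, -, p5⟩ := (key ψ hψ).1 hy1
      obtain ⟨q1, -, -, -, -⟩ := (key ψ' hψ').1 hy1'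
      have s0 : ∀ i, (ψ' i).coeff 0 = (ψ i).coeff 0 := fun i => by
        have a1 := congrFun hy2 (some i)
        have a2 := congrFun hy2' (some i)
        simp only [Option.elim_some, ofSeries_val] at a1 a2
        rw [a1, a2]
      have s1 : (gev g (fun i => (κ i : ℕ)) ℓ ψ').coeff (j + 1) =
          (gev g (fun i => (κ i : ℕ)) ℓ ψ).coeff (j + 1) := by
        have a1 := congrFun hy2 none
        have a2 := congrFun hy2' none
        simp only [Option.elim_none, hgm ψ hψ, hgm ψ' hψ'] at a1 a2
        rw [a1, a2]
      have s2 : ∀ i r, i ≠ e a ∨ r = 0 ∨ j + 1 < r → (ψ' i).coeff r = (ψ i).coeff r := by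
        intro i r hir
        rcases Nat.eq_zero_or_pos r with rfl | hr0
        · exact s0 i
        · by_cases hr1 : ℓ + j + 1 < κ i + r
          · rw [hψ i r hr1, hψ' i r hr1]
          · have hp : κ i < (⟨κ i + r, by omega⟩ : Fin (ℓ + j + 1 + 1)) ∧
                ¬ (i = e a ∧ κ i + r ≤ κ (e a) + (j + 1)) := by
              refine ⟨?_, ?_⟩
              · change (κ i : ℕ) < κ i + r
                omega
              · rintro ⟨rfl, h7⟩
                rcases hir with h8 | h8 | h8
                · exact h8 rfl
                · omega
                · omega
            have a1 := (hy3' ⟨(i, ⟨κ i + r, by omega⟩), hp⟩).trans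
              (hy3 ⟨(i, ⟨κ i + r, by omega⟩), hp⟩).symm
            simpa [ofSeries] using a1
      have s3 : ψ' = Function.update ψ (e a) (ψ' (e a)) := by
        funext i
        by_cases hi : i = e a
        · subst hi
          rw [Function.update_self]
        · rw [Function.update_of_ne hi]
          exact Polynomial.ext fun r => s2 i r (Or.inl hi)
      have s4 : ψ' (e a) = ψ (e a) := by
        refine eq_of_eval_coeff_eq (gevPoly g (fun i => (κ i : ℕ)) ℓ ψ (e a)) _ _ (hder ψ p5)
          (j + 1) (fun r hr => s2 _ r (Or.inr hr)) fun r hr1 hr2 => ?_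
        rw [gevPoly_eval, gevPoly_eval, ← s3, Function.update_eq_self]
        rcases Nat.lt_or_ge r (j + 1) with h6 | h6
        · rw [p1 r h6, q1 r h6]
        · rw [le_antisymm hr2 h6, s1]
      rw [s3, s4, Function.update_eq_self]

lemma logDeriv_eq (g : MvPolynomial ι k) (P : Finset (ι →₀ ℕ)) (i : ι) :
    logDeriv g P i = MvPolynomial.X i * MvPolynomial.pderiv i (initForm g P) := by
  rw [logDeriv, initForm, map_sum, Finset.mul_sum]
  refine Finset.sum_congr rfl fun α _ => ?_
  rw [MvPolynomial.pderiv_monomial, MvPolynomial.X, MvPolynomial.monomial_mul, one_mul]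
  rcases Nat.eq_zero_or_pos (α i) with h | h
  · simp [h]
  · have e : Finsupp.single i 1 + (α - Finsupp.single i 1) = α := by
      ext i'
      by_cases hi : i = i'
      · subst hi
        simp
        omega
      · simp [hi]
    rw [e]

/-- The class of a stratum on which the order of `g` is greater than the generic one. -/
lemma cls_ordStratum_eq_sum (h : IsInit g (fun i => κ i) P ℓ) (hℓ : ℓ < m)
    (hV : ∀ i ∈ V, 0 < κ i) (hκ : ∀ i, (κ i : ℕ) ≤ ℓ) {N : ℕ} (e : Fin N ≃ ι)
    (hs : IsSmoothOnTorus (initForm g P)) :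
    ((jetPres g V hm).ordStratum Finset.univ κ).cls =
      (LaurentPolynomial.T (∑ i, ((m : ℤ) - (κ i : ℕ)) - (m - ℓ : ℕ)) : ℤ[T;T⁻¹]) •
        ∑ a, (baseB g P e a (fun i => κ i) ℓ m hm
          fun α hα => (h.iff α (h.subset hα)).2 hα).cls := by
  rw [Finset.smul_sum, WPres.cls_eq_sum_firstNonzero _ (fun b => initLogDeriv g P κ (e b))
    (fun b => homog_initLogDeriv (fun α hα => (h.iff α (h.subset hα)).2 hα) (e b))]
  · exact Finset.sum_congr rfl fun a _ => cls_firstNonzero_eq h hℓ hV hκ e a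
  · -- the logarithmic derivatives have no common zero on the torus, since `initForm g P` is smooth
    refine WPres.cls_eq_zero_of_algebraicClosure _ fun x hx => ?_
    obtain ⟨h1, h2⟩ := WPres.isPt_allZero.1 hx
    obtain ⟨i, hi⟩ := hs (fun i => x (i, κ i)) fun i =>
      ((WPres.isPt_ordStratum.1 h1).2 i (Finset.mem_univ i)).2.ne_zero
    have h3 := h2 (e.symm i)
    rw [e.apply_symm_apply, aeval_initLogDeriv, logDeriv_eq, map_mul, MvPolynomial.aeval_X] at h3
    exact (mul_ne_zero ((WPres.isPt_ordStratum.1 h1).2 i (Finset.mem_univ i)).2.ne_zero hi) h3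

end Reduction

/-! ### The classes of the bases of the strata -/

section Independence

variable {k : Type u} [Field k] {ι : Type} [Fintype ι] [DecidableEq ι] {g : MvPolynomial ι k}
  {P : Finset (ι →₀ ℕ)} {v : ι → ℤ} {o : ι}

lemma cls_baseA_eq {κ κ' : ι → ℕ} {ℓ ℓ' : ℕ} {hℓ : 0 < ℓ} {hℓ' : 0 < ℓ'}
    {hP : ∀ α ∈ P, lev κ α = ℓ} {hP' : ∀ α ∈ P, lev κ' α = ℓ'} (ho : v o = 1)
    (hv : ∀ α ∈ P, ∑ i, v i * α i = 0) :
    (baseA g P κ ℓ hℓ hP).cls = (baseA g P κ' ℓ' hℓ' hP').cls :=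
  WPres.cls_eq_of_same_equations _ _ rfl rfl rfl o v ho (fun _ hf => hf.elim)
    ⟨_, Homog.prod _ fun i _ => Homog.X _ i⟩ (homog_initForm g P v 0 hv)
    fun _ _ _ _ hx => (isPt_baseA.1 hx).2 o

lemma cls_baseB_eq {κ κ' : ι → ℕ} {ℓ ℓ' m m' : ℕ} {hm : 0 < m} {hm' : 0 < m'}
    {hP : ∀ α ∈ P, lev κ α = ℓ} {hP' : ∀ α ∈ P, lev κ' α = ℓ'} {N : ℕ} (e : Fin N → ι) (a : Fin N)
    (ho : v o = 1) (hv : ∀ α ∈ P, ∑ i, v i * α i = 0) :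
    (baseB g P e a κ ℓ m hm hP).cls = (baseB g P e a κ' ℓ' m' hm' hP').cls := by
  refine WPres.cls_eq_of_same_equations _ _ rfl rfl rfl (some o) (fun i => i.elim 0 v) ho ?_
    ?_ (Homog.X _ none) fun _ _ _ _ hx => (isPt_baseB.1 hx).2.1 o
  · rintro f (rfl | ⟨b, -, rfl⟩)
    · exact ⟨0, WPres.homog_rename_some (homog_initForm g P _ _ hv)⟩
    · exact ⟨0, WPres.homog_rename_some (homog_logDeriv g P _ _ _ hv)⟩
  · exact ⟨_, WPres.homog_rename_some ((Homog.prod _ fun i _ => Homog.X _ i).mul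
      (homog_logDeriv g P _ _ _ hv))⟩

variable (g P)

open Classical in
/-- The class of the open subset of the torus where `initForm g P` does not vanish, for some
weights for which this function is homogeneous. -/
def clsA : Mot (SpecK k k) :=
  if h : ∃ p : (ι → ℕ) × ℕ, 0 < p.2 ∧ ∀ α ∈ P, lev p.1 α = p.2 then
    (baseA g P h.choose.1 h.choose.2 h.choose_spec.1 h.choose_spec.2).cls
  else 0

/-- The sum of the classes of the strata of the zero locus of `initForm g P` in the torus on which
a given logarithmic derivative is the first one that does not vanish, multiplied with the class of
`𝔾ₘ`. -/
def clsB {N : ℕ} (e : Fin N → ι) : Mot (SpecK k k) :=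
  ∑ a, (baseB g P e a 0 0 1 zero_lt_one fun α _ => by simp [lev]).cls

variable {g P}

lemma clsA_eq {κ : ι → ℕ} {ℓ : ℕ} (hℓ : 0 < ℓ) (hP : ∀ α ∈ P, lev κ α = ℓ) (ho : v o = 1)
    (hv : ∀ α ∈ P, ∑ i, v i * α i = 0) : (baseA g P κ ℓ hℓ hP).cls = clsA g P := by
  have h : ∃ p : (ι → ℕ) × ℕ, 0 < p.2 ∧ ∀ α ∈ P, lev p.1 α = p.2 := ⟨(κ, ℓ), hℓ, hP⟩
  rw [clsA, dif_pos h]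
  exact cls_baseA_eq ho hv

lemma clsB_eq {κ : ι → ℕ} {ℓ m : ℕ} (hm : 0 < m) (hP : ∀ α ∈ P, lev κ α = ℓ) {N : ℕ}
    (e : Fin N → ι) (ho : v o = 1) (hv : ∀ α ∈ P, ∑ i, v i * α i = 0) :
    ∑ a, (baseB g P e a κ ℓ m hm hP).cls = clsB g P e :=
  Finset.sum_congr rfl fun a _ => cls_baseB_eq e a ho hv

end Independence

/-! ### Limits of generating series -/

section Limits

lemma HasLimInfty.add {M : Type*} [AddCommGroup M] [Module ℤ[T;T⁻¹] M] {Z Z' : ℕ → M} {c c' : M}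
    (h : HasLimInfty Z c) (h' : HasLimInfty Z' c') : HasLimInfty (Z + Z') (c + c') :=
  AddSubgroup.add_mem (limGraph M) h h'

lemma hasLimInfty_zero {M : Type*} [AddCommGroup M] [Module ℤ[T;T⁻¹] M] :
    HasLimInfty (0 : ℕ → M) 0 :=
  AddSubgroup.zero_mem (limGraph M)

lemma hasLimInfty_sum {M α : Type*} [AddCommGroup M] [Module ℤ[T;T⁻¹] M] (s : Finset α)
    {Z : α → ℕ → M} {c : α → M} (h : ∀ a ∈ s, HasLimInfty (Z a) (c a)) :
    HasLimInfty (∑ a ∈ s, Z a) (∑ a ∈ s, c a) := by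
  have := AddSubgroup.sum_mem (limGraph M) h
  have e : ∑ a ∈ s, (Z a, c a) = (∑ a ∈ s, Z a, ∑ a ∈ s, c a) := by
    ext <;> simp [Prod.fst_sum, Prod.snd_sum]
  rwa [e] at this

/-- Limits are compatible with linear maps. -/
lemma HasLimInfty.map {M M' : Type*} [AddCommGroup M] [Module ℤ[T;T⁻¹] M] [AddCommGroup M']
    [Module ℤ[T;T⁻¹] M'] (f : M →ₗ[ℤ[T;T⁻¹]] M') {Z : ℕ → M} {c : M} (h : HasLimInfty Z c) :
    HasLimInfty (fun m => f (Z m)) (f c) := by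
  let φ : (ℕ → M) × M →+ (ℕ → M') × M' := AddMonoidHom.mk' (fun z => (fun m => f (z.1 m), f z.2))
    fun x y => Prod.ext (funext fun m => map_add f _ _) (map_add f _ _)
  have key : limGraph M ≤ (limGraph M').comap φ := by
    rw [limGraph, AddSubgroup.closure_le]
    rintro _ ⟨a, s, hs, rfl⟩
    refine AddSubgroup.subset_closure ⟨f a, s, hs, ?_⟩
    change (_, _) = _
    simp
  exact key h

/-- Multiplication of a sequence of coefficients with `p_{c,d}`. -/
def mulPSeries (c : ℤ) (d : ℕ) (Z : ℕ → ℤ[T;T⁻¹]) (m : ℕ) : ℤ[T;T⁻¹] :=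
  PowerSeries.coeff m (pSeries c d * PowerSeries.mk Z)

lemma mulPSeries_add (c : ℤ) (d : ℕ) (Z Z' : ℕ → ℤ[T;T⁻¹]) :
    mulPSeries c d (Z + Z') = mulPSeries c d Z + mulPSeries c d Z' := by
  funext m
  have e : PowerSeries.mk (Z + Z') = PowerSeries.mk Z + PowerSeries.mk Z' := by
    ext m : 1
    simp
  rw [mulPSeries, e, mul_add, map_add]
  rfl

lemma mulPSeries_pProd (c : ℤ) (d : ℕ) (a : ℤ[T;T⁻¹]) (s : Multiset (ℤ × ℕ)) :
    mulPSeries c d (fun m => PowerSeries.coeff m (pProd s) • a) =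
      fun m => PowerSeries.coeff m (pProd ((c, d) ::ₘ s)) • a := by
  funext m
  have e1 : PowerSeries.mk (fun m => PowerSeries.coeff m (pProd s) • a) =
      pProd s * PowerSeries.C a := by
    ext m : 1
    rw [PowerSeries.coeff_mk, PowerSeries.coeff_mul_C, smul_eq_mul]
  have e2 : pProd ((c, d) ::ₘ s) = pSeries c d * pProd s := by simp [pProd]
  rw [mulPSeries, e1, e2, ← mul_assoc, PowerSeries.coeff_mul_C, smul_eq_mul]

/-- Multiplication with `p_{c,d}` changes the sign of the limit. -/
lemma HasLimInfty.mulPSeries {Z : ℕ → ℤ[T;T⁻¹]} {χ : ℤ[T;T⁻¹]} (h : HasLimInfty Z χ) (c : ℤ)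
    {d : ℕ} (hd : 0 < d) : HasLimInfty (mulPSeries c d Z) (-χ) := by
  let φ : (ℕ → ℤ[T;T⁻¹]) × ℤ[T;T⁻¹] →+ (ℕ → ℤ[T;T⁻¹]) × ℤ[T;T⁻¹] := AddMonoidHom.mk'
    (fun z => (MotivicMilnor.mulPSeries c d z.1, -z.2))
    fun _ _ => Prod.ext (mulPSeries_add c d _ _) (neg_add _ _)
  have key : limGraph ℤ[T;T⁻¹] ≤ (limGraph ℤ[T;T⁻¹]).comap φ := by
    rw [limGraph, AddSubgroup.closure_le]
    rintro _ ⟨a, s, hs, rfl⟩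
    refine AddSubgroup.subset_closure ⟨a, (c, d) ::ₘ s, ?_, ?_⟩
    · intro p hp
      rcases Multiset.mem_cons.1 hp with rfl | hp
      · exact hd
      · exact hs p hp
    · refine Prod.ext (mulPSeries_pProd c d a s) ?_
      change -((-1 : ℤ) ^ Multiset.card s • a) = (-1 : ℤ) ^ Multiset.card ((c, d) ::ₘ s) • a
      rw [Multiset.card_cons, pow_succ, mul_neg_one, neg_smul]
  have h1 : φ (Z, χ) ∈ limGraph ℤ[T;T⁻¹] := AddSubgroup.mem_comap.1 (key h)
  exact h1

lemma pSeries_eq_mk (c : ℤ) {d : ℕ} (hd : 0 < d) :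
    pSeries c d = PowerSeries.mk fun r =>
      ∑ n ∈ Finset.range r with d * (n + 1) = r,
        (LaurentPolynomial.T (c * (n + 1)) : ℤ[T;T⁻¹]) := by
  have h0 : (1 - PowerSeries.C (LaurentPolynomial.T c : ℤ[T;T⁻¹]) * PowerSeries.X ^ d) *
      pSeries c d = PowerSeries.C (LaurentPolynomial.T c) * PowerSeries.X ^ d := by
    rw [pSeries, mul_left_comm, PowerSeries.mul_invOfUnit, mul_one]
    simp [hd.ne']
  have h1 : ∀ r, PowerSeries.coeff r (pSeries c d) =
      if d ≤ r then LaurentPolynomial.T c * ((if r = d then 1 else 0) +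
        PowerSeries.coeff (r - d) (pSeries c d)) else 0 := by
    intro r
    have e : pSeries c d = PowerSeries.C (LaurentPolynomial.T c : ℤ[T;T⁻¹]) *
        (PowerSeries.X ^ d * (1 + pSeries c d)) := by
      linear_combination h0
    conv_lhs => rw [e]
    rw [PowerSeries.coeff_C_mul, PowerSeries.coeff_X_pow_mul']
    split_ifs with h2 h3
    · simp [h3]
    · rw [map_add, PowerSeries.coeff_one, if_neg (by omega)]
    · rw [mul_zero]
  ext r : 1
  rw [PowerSeries.coeff_mk]
  induction r using Nat.strong_induction_on with
  | _ r ih =>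
    rw [h1]
    split_ifs with h2 h3
    · subst h3
      have e : (Finset.range r).filter (fun n => r * (n + 1) = r) = {0} := by
        ext n
        simp only [Finset.mem_filter, Finset.mem_range, Finset.mem_singleton]
        constructor
        · rintro ⟨-, h4⟩
          have : n + 1 = 1 := Nat.eq_of_mul_eq_mul_left hd (by omega)
          omega
        · rintro rfl
          exact ⟨hd, by simp⟩
      rw [e, Finset.sum_singleton, ih _ (by omega)]
      simp
    · rw [ih _ (by omega), zero_add, Finset.mul_sum]
      refine Finset.sum_nbij (fun n => n + 1) ?_ ?_ ?_ ?_
      · intro n hn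
        simp only [Finset.mem_filter, Finset.mem_range] at hn ⊢
        have : d * (n + 1 + 1) = d * (n + 1) + d := by ring
        omega
      · intro a _ b _ hab
        simpa using hab
      · rintro (- | n) hn
        · simp only [Finset.coe_filter, Finset.mem_range, Set.mem_ofPred_eq] at hn
          omega
        · simp only [Finset.coe_filter, Finset.mem_range, Set.mem_ofPred_eq] at hn
          refine ⟨n, ?_, rfl⟩
          simp only [Finset.coe_filter, Finset.mem_range, Set.mem_ofPred_eq]
          have h5 : d * (n + 1 + 1) = d * (n + 1) + d := by ring
          have h6 : 1 * (n + 1) ≤ d * (n + 1) := Nat.mul_le_mul_right _ hd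
          omega
      · intro n _
        rw [← LaurentPolynomial.T_add]
        congr 1
        push_cast
        ring
    · symm
      refine Finset.sum_eq_zero fun n hn => absurd (Finset.mem_filter.1 hn).2 ?_
      have h6 : d * 1 ≤ d * (n + 1) := Nat.mul_le_mul_left _ (by omega)
      omega

/-- `Z` is the sequence of the coefficients of the series `∑ 𝕃 ^ e i T ^ ℓ i` over all `i` in `D`,
which is assumed to be defined: the fibres of `ℓ` on `D` are finite. -/
def IsGenSeries {I : Type*} (D : Set I) (e : I → ℤ) (ℓ : I → ℕ) (Z : ℕ → ℤ[T;T⁻¹]) : Prop :=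
  ∀ m, ∃ F : Finset I, (∀ i, i ∈ F ↔ i ∈ D ∧ ℓ i = m) ∧ Z m = ∑ i ∈ F, LaurentPolynomial.T (e i)

/-- The series `∑ 𝕃 ^ e i T ^ ℓ i` over all `i` in `D` has the limit `χ`. -/
def SumLim {I : Type*} (D : Set I) (e : I → ℤ) (ℓ : I → ℕ) (χ : ℤ[T;T⁻¹]) : Prop :=
  ∃ Z, IsGenSeries D e ℓ Z ∧ HasLimInfty Z χ

namespace SumLim

variable {I J : Type*} {D D' : Set I} {e : I → ℤ} {ℓ : I → ℕ} {χ χ' : ℤ[T;T⁻¹]}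

lemma empty : SumLim (∅ : Set I) e ℓ 0 :=
  ⟨0, fun m => ⟨∅, by simp, by simp⟩, hasLimInfty_zero⟩

lemma union (h : SumLim D e ℓ χ) (h' : SumLim D' e ℓ χ') (hD : Disjoint D D') :
    SumLim (D ∪ D') e ℓ (χ + χ') := by
  classical
  obtain ⟨Z, hZ, hχ⟩ := h
  obtain ⟨Z', hZ', hχ'⟩ := h'
  refine ⟨Z + Z', fun m => ?_, hχ.add hχ'⟩
  obtain ⟨F, hF, e1⟩ := hZ m
  obtain ⟨F', hF', e2⟩ := hZ' m
  refine ⟨F ∪ F', fun i => ?_, ?_⟩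
  · rw [Finset.mem_union, hF, hF', Set.mem_union, or_and_right]
  · rw [Finset.sum_union, Pi.add_apply, e1, e2]
    rw [Finset.disjoint_left]
    intro i hi hi'
    exact Set.disjoint_left.1 hD ((hF i).1 hi).1 ((hF' i).1 hi').1

lemma of_bijOn {D' : Set J} {e' : J → ℤ} {ℓ' : J → ℕ} (h : SumLim D e ℓ χ) (φ : I → J)
    (hφ : Set.BijOn φ D D') (he : ∀ i ∈ D, e' (φ i) = e i) (hℓ : ∀ i ∈ D, ℓ' (φ i) = ℓ i) :
    SumLim D' e' ℓ' χ := by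
  classical
  obtain ⟨Z, hZ, hχ⟩ := h
  refine ⟨Z, fun m => ?_, hχ⟩
  obtain ⟨F, hF, e1⟩ := hZ m
  refine ⟨F.image φ, fun j => ?_, ?_⟩
  · rw [Finset.mem_image]
    constructor
    · rintro ⟨i, hi, rfl⟩
      obtain ⟨h1, h2⟩ := (hF i).1 hi
      exact ⟨hφ.mapsTo h1, (hℓ i h1).trans h2⟩
    · rintro ⟨hj, h2⟩
      obtain ⟨i, hi, rfl⟩ := hφ.surjOn hj
      exact ⟨i, (hF i).2 ⟨hi, (hℓ i hi).symm.trans h2⟩, rfl⟩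
  · rw [Finset.sum_image fun i hi i' hi' h => hφ.injOn ((hF i).1 hi).1 ((hF i').1 hi').1 h, e1]
    exact Finset.sum_congr rfl fun i hi => by rw [he i ((hF i).1 hi).1]

lemma prod_pos (h : SumLim D e ℓ χ) (c : ℤ) {d : ℕ} (hd : 0 < d) :
    SumLim (D ×ˢ (Set.univ : Set ℕ)) (fun p => e p.1 + c * (p.2 + 1))
      (fun p => ℓ p.1 + d * (p.2 + 1)) (-χ) := by
  classical
  obtain ⟨Z, hZ, hχ⟩ := h
  choose F hF hZF using hZ
  refine ⟨_, fun m => ?_, hχ.mulPSeries c hd⟩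
  let G : Finset (I × ℕ) := (Finset.range m).biUnion fun n =>
    if d * (n + 1) ≤ m then
      (F (m - d * (n + 1))).map ⟨fun i => (i, n), fun _ _ h => congrArg Prod.fst h⟩
    else ∅
  refine ⟨G, ?_, ?_⟩
  · rintro ⟨i, n⟩
    simp only [G, Finset.mem_biUnion, Finset.mem_range, Set.mem_prod, Set.mem_univ, and_true]
    constructor
    · rintro ⟨n', hn', h1⟩
      split_ifs at h1 with h2
      · obtain ⟨i', hi', h3⟩ := Finset.mem_map.1 h1
        obtain ⟨rfl, rfl⟩ := Prod.mk.inj h3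
        obtain ⟨h4, h5⟩ := (hF _ _).1 hi'
        exact ⟨h4, by omega⟩
      · simp at h1
    · rintro ⟨h1, h2⟩
      have h6 : 1 * (n + 1) ≤ d * (n + 1) := Nat.mul_le_mul_right _ hd
      refine ⟨n, by omega, ?_⟩
      rw [if_pos (by omega), Finset.mem_map]
      exact ⟨i, (hF _ _).2 ⟨h1, by omega⟩, rfl⟩
  · rw [Finset.sum_biUnion]
    · rw [mulPSeries, pSeries_eq_mk c hd, PowerSeries.coeff_mul,
        Finset.Nat.sum_antidiagonal_eq_sum_range_succ_mk]
      simp only [PowerSeries.coeff_mk]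
      have e1 : ∀ r ∈ Finset.range (m + 1),
          (∑ n ∈ Finset.range r with d * (n + 1) = r,
            (LaurentPolynomial.T (c * (n + 1)) : ℤ[T;T⁻¹])) * Z (m - r) =
          ∑ n ∈ Finset.range m, if d * (n + 1) = r then
            (LaurentPolynomial.T (c * (n + 1)) : ℤ[T;T⁻¹]) * Z (m - d * (n + 1)) else 0 := by
        intro r hr
        rw [Finset.mem_range] at hr
        rw [Finset.sum_mul, ← Finset.sum_filter]
        have e2 : (Finset.range r).filter (fun n => d * (n + 1) = r) =
            (Finset.range m).filter (fun n => d * (n + 1) = r) := by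
          ext n
          simp only [Finset.mem_filter, Finset.mem_range]
          refine and_congr_left fun h => ?_
          have h6 : 1 * (n + 1) ≤ d * (n + 1) := Nat.mul_le_mul_right _ hd
          omega
        rw [e2]
        refine Finset.sum_congr rfl fun n hn => ?_
        rw [(Finset.mem_filter.1 hn).2]
      rw [Finset.sum_congr rfl e1, Finset.sum_comm]
      refine Finset.sum_congr rfl fun n _ => ?_
      rw [Finset.sum_ite_eq]
      by_cases h : d * (n + 1) ≤ m
      · rw [if_pos h, if_pos (Finset.mem_range.2 (by omega)), Finset.sum_map, hZF, Finset.mul_sum]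
        refine Finset.sum_congr rfl fun i _ => ?_
        rw [← LaurentPolynomial.T_add, add_comm]
        rfl
      · rw [if_neg h, if_neg (by rw [Finset.mem_range]; omega), Finset.sum_empty]
    · intro n _ n' _ hn
      rw [Function.onFun, Finset.disjoint_left]
      have h3 : ∀ (n : ℕ) (p : I × ℕ), p ∈ (if d * (n + 1) ≤ m then (F (m - d * (n + 1))).map
          ⟨fun i => (i, n), fun _ _ h => congrArg Prod.fst h⟩ else ∅ : Finset (I × ℕ)) →
          p.2 = n := by
        intro n p hp
        split_ifs at hp
        · obtain ⟨i, -, rfl⟩ := Finset.mem_map.1 hp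
          rfl
        · simp at hp
      exact fun p h1 h2 => hn ((h3 n p h1).symm.trans (h3 n' p h2))

/-- The limit of the product with a geometric series that starts with `1` is zero. -/
lemma prod_nat (h : SumLim D e ℓ χ) (c : ℤ) {d : ℕ} (hd : 0 < d) :
    SumLim (D ×ˢ (Set.univ : Set ℕ)) (fun p => e p.1 + c * p.2) (fun p => ℓ p.1 + d * p.2) 0 := by
  have h1 : SumLim (D ×ˢ ({0} : Set ℕ)) (fun p => e p.1 + c * p.2) (fun p => ℓ p.1 + d * p.2) χ :=
    h.of_bijOn (fun i => (i, 0)) ⟨fun i hi => ⟨hi, rfl⟩, fun _ _ _ _ h => congrArg Prod.fst h, by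
      rintro ⟨i, n⟩ ⟨hi, rfl⟩
      exact ⟨i, hi, rfl⟩⟩ (fun i _ => by simp) (fun i _ => by simp)
  have h2 : SumLim (D ×ˢ ({0}ᶜ : Set ℕ)) (fun p => e p.1 + c * p.2) (fun p => ℓ p.1 + d * p.2)
      (-χ) := by
    refine (h.prod_pos c hd).of_bijOn (fun p => (p.1, p.2 + 1)) ⟨?_, ?_, ?_⟩ ?_ ?_
    · rintro ⟨i, n⟩ ⟨hi, -⟩
      exact ⟨hi, Nat.succ_ne_zero n⟩
    · rintro ⟨i, n⟩ - ⟨i', n'⟩ - h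
      simpa using h
    · rintro ⟨i, n⟩ ⟨hi, hn⟩
      obtain ⟨n, rfl⟩ := Nat.exists_eq_succ_of_ne_zero hn
      exact ⟨(i, n), ⟨hi, trivial⟩, rfl⟩
    · intro p _
      push_cast
      rfl
    · intro p _
      rfl
  have h3 := h1.union h2 (Set.disjoint_prod.2 (Or.inr disjoint_compl_right))
  rwa [← Set.prod_union, Set.union_compl_self, add_neg_cancel] at h3

lemma orthant (S : Type) [Fintype S] : ∀ (c : S → ℤ) (d : S → ℕ) (_ : ∀ s, 0 < d s),
    SumLim (Set.univ : Set (S → ℕ)) (fun u => ∑ s, c s * (u s + 1)) (fun u => ∑ s, d s * (u s + 1))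
      ((-1) ^ Fintype.card S) := by
  refine Fintype.induction_empty_option (P := fun S _ => ∀ (c : S → ℤ) (d : S → ℕ)
    (_ : ∀ s, 0 < d s), SumLim (Set.univ : Set (S → ℕ)) (fun u => ∑ s, c s * (u s + 1))
      (fun u => ∑ s, d s * (u s + 1)) ((-1) ^ Fintype.card S)) ?_ ?_ ?_ S
  · intro S S' _ φ ih c d hd
    let _ : Fintype S := Fintype.ofEquiv S' φ.symm
    have h := ih (fun s => c (φ s)) (fun s => d (φ s)) fun s => hd _
    rw [Fintype.card_congr φ] at h
    refine h.of_bijOn (fun u s => u (φ.symm s)) ?_ ?_ ?_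
    · rw [Set.bijOn_univ]
      exact (Equiv.arrowCongr φ (Equiv.refl ℕ)).bijective
    · intro u _
      refine (Fintype.sum_equiv φ _ _ fun s => ?_).symm
      simp
    · intro u _
      refine (Fintype.sum_equiv φ _ _ fun s => ?_).symm
      simp
  · intro c d _
    refine ⟨fun m => PowerSeries.coeff m (pProd 0) • 1, fun m => ?_,
      AddSubgroup.subset_closure ⟨1, 0, by simp, by simp⟩⟩
    refine ⟨if m = 0 then Finset.univ else ∅, fun u => ?_, ?_⟩
    · split_ifs with hm
      · simp [hm, eq_iff_true_of_subsingleton]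
      · simp [Ne.symm hm]
    · split_ifs with hm
      · simp [pProd, hm]
      · simp [pProd, PowerSeries.coeff_one, hm]
  · intro S _ ih c d hd
    have h := (ih (fun s => c (some s)) (fun s => d (some s)) fun s => hd _).prod_pos (c none)
      (hd none)
    rw [Fintype.card_option, pow_succ, mul_neg_one]
    refine h.of_bijOn (fun p o => o.elim p.2 p.1) ⟨fun _ _ => trivial, ?_, ?_⟩ ?_ ?_
    · rintro ⟨u, n⟩ - ⟨u', n'⟩ - h
      exact Prod.ext (funext fun s => congrFun h (some s)) (congrFun h none)
    · intro w _
      refine ⟨(fun s => w (some s), w none), ⟨trivial, trivial⟩, funext fun o => ?_⟩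
      rcases o with - | s <;> rfl
    · intro p _
      rw [Fintype.sum_option, add_comm]
      rfl
    · intro p _
      rw [Fintype.sum_option, add_comm]
      rfl

lemma sum_add_single {S R : Type*} [Fintype S] [DecidableEq S] [CommSemiring R] (c w : S → R)
    (s : S) (a : R) : ∑ t, c t * (w t + (if t = s then a else 0)) = ∑ t, c t * w t + c s * a := by
  simp [mul_add, Finset.sum_add_distrib]

/-- The sum over the lattice points `(u, a)` with `u` in an open orthant and `0 ≤ a < b(u)`, for a
linear form `b` with nonnegative coefficients, has limit zero. -/
lemma half_open (S : Type) [Fintype S] (d : S → ℕ) (hd : ∀ s, 0 < d s) (f : ℤ) (N : ℕ) :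
    ∀ (c : S → ℤ) (b : S → ℕ), ∑ s, b s = N →
    SumLim {p : (S → ℕ) × ℕ | p.2 < ∑ s, b s * (p.1 s + 1)}
      (fun p => ∑ s, c s * (p.1 s + 1) + f * p.2) (fun p => ∑ s, d s * (p.1 s + 1)) 0 := by
  classical
  induction N with
  | zero =>
    intro c b hb
    have h : {p : (S → ℕ) × ℕ | p.2 < ∑ s, b s * (p.1 s + 1)} = ∅ := by
      ext p
      have h2 : ∀ s, b s = 0 := fun s => (Finset.sum_eq_zero_iff.1 hb) s (Finset.mem_univ s)
      simp [h2]
    rw [h]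
    exact empty
  | succ N ih =>
    intro c b hb
    obtain ⟨s, hs⟩ : ∃ s, b s ≠ 0 := by
      by_contra! h
      simp [h] at hb
    -- write `b = b' + e_s`; the additional points are those with `b'(u) ≤ a < b'(u) + u_s`
    obtain ⟨b', rfl⟩ : ∃ b' : S → ℕ, b = fun t => b' t + if t = s then 1 else 0 := by
      refine ⟨fun t => b t - if t = s then 1 else 0, funext fun t => ?_⟩
      by_cases h : t = s
      · subst h
        simp only [if_true]
        omega
      · simp only [if_neg h, Nat.sub_zero, Nat.add_zero]
    have hb' : ∑ s, b' s = N := by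
      rw [Finset.sum_add_distrib, Finset.sum_ite_eq' Finset.univ s,
        if_pos (Finset.mem_univ s)] at hb
      omega
    have e1 : ∀ u : S → ℕ, ∑ t, (b' t + if t = s then 1 else 0) * (u t + 1) =
        ∑ t, b' t * (u t + 1) + (u s + 1) := by
      intro u
      simp [add_mul, Finset.sum_add_distrib]
    have h1 := ih c b' hb'
    have h2 : SumLim {p : (S → ℕ) × ℕ | ∑ t, b' t * (p.1 t + 1) ≤ p.2 ∧
        p.2 < ∑ t, b' t * (p.1 t + 1) + (p.1 s + 1)}
        (fun p => ∑ s, c s * (p.1 s + 1) + f * p.2) (fun p => ∑ s, d s * (p.1 s + 1)) 0 := by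
      -- with `a = b'(u) + a'`, the condition `a' < u_s` is removed by the substitution
      -- `u = w + a' e_s`, so that `(w, a')` ranges over an orthant
      have h3 := (orthant S (fun t => c t + f * b' t) d hd).prod_nat (c s + f * b' s + f) (hd s)
      have e2 : ∀ (w : S → ℕ) (a : ℕ), ∑ t, b' t * (w t + (if t = s then a else 0) + 1) =
          ∑ t, b' t * (w t + 1) + b' s * a := fun w a => by
        rw [← sum_add_single]
        exact Finset.sum_congr rfl fun t _ => by ring
      refine h3.of_bijOn (fun p => (fun t => p.1 t + if t = s then p.2 else 0,
        ∑ t, b' t * (p.1 t + (if t = s then p.2 else 0) + 1) + p.2)) ⟨?_, ?_, ?_⟩ ?_ ?_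
      · rintro ⟨w, a⟩ -
        simp only [Set.mem_ofPred_eq, if_true]
        omega
      · rintro ⟨w, a⟩ - ⟨w', a'⟩ - h
        simp only [Prod.mk.injEq] at h
        obtain ⟨h4, h5⟩ := h
        have h6 : ∀ t, w t + (if t = s then a else 0) = w' t + if t = s then a' else 0 :=
          fun t => congrFun h4 t
        have h7 : a = a' := by
          simp only [h6] at h5
          omega
        subst h7
        exact Prod.ext (funext fun t => Nat.add_right_cancel (h6 t)) rfl
      · rintro ⟨u, a⟩ ⟨h4, h5⟩
        simp only at h4 h5
        have h6 : ∀ t, (u t - (if t = s then a - ∑ t, b' t * (u t + 1) else 0)) +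
            (if t = s then a - ∑ t, b' t * (u t + 1) else 0) = u t := by
          intro t
          split_ifs with h
          · subst h
            omega
          · omega
        refine ⟨(fun t => u t - if t = s then a - ∑ t, b' t * (u t + 1) else 0,
          a - ∑ t, b' t * (u t + 1)), ⟨trivial, trivial⟩, ?_⟩
        simp only [h6]
        refine Prod.ext rfl ?_
        simp only
        omega
      · rintro ⟨w, a⟩ -
        have e3 : ∑ t, c t * (((w t + if t = s then a else 0 : ℕ) : ℤ) + 1) =
            ∑ t, c t * (w t + 1) + c s * a := by
          rw [← sum_add_single]
          refine Finset.sum_congr rfl fun t _ => ?_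
          push_cast
          split_ifs <;> ring
        simp only [e2, e3, add_mul, Finset.sum_add_distrib]
        push_cast
        rw [mul_add, mul_add, Finset.mul_sum]
        simp only [mul_assoc]
        ring
      · rintro ⟨w, a⟩ -
        simp only
        rw [← sum_add_single]
        exact Finset.sum_congr rfl fun t _ => by ring
    have h3 := h1.union h2 (Set.disjoint_left.2 fun p hp hp' => absurd hp'.1 (not_le.2 hp))
    rw [add_zero] at h3
    refine Eq.mp (congrArg (fun D => SumLim D _ _ _) ?_) h3
    ext p
    simp only [Set.mem_union, Set.mem_ofPred_eq, e1]
    omega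

end SumLim
end Limits

/-! ### Subdivisions of cones -/

section Cones

variable {ι S : Type} [Fintype S]

/-- A point of the open cone spanned by the vectors `A s`. -/
def conePt (A : S → ι → ℕ) (u : S → ℕ) : ι → ℕ := ∑ s, (u s + 1) • A s

/-- The vectors `A s` are not zero, and their linear combinations with positive integral
coefficients are pairwise different. -/
structure IsRegular (A : S → ι → ℕ) : Prop where
  ne_zero : ∀ s, A s ≠ 0
  injective : Function.Injective (conePt A)

/-- The linear form `f` does not change its sign on the cone spanned by the vectors `A s`. -/
def SameSign (f : (ι → ℕ) →+ ℤ) (A : S → ι → ℕ) : Prop :=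
  (∀ s, 0 ≤ f (A s)) ∨ ∀ s, f (A s) ≤ 0

lemma map_conePt {M : Type*} [CommSemiring M] (f : (ι → ℕ) →+ M) (A : S → ι → ℕ) (u : S → ℕ) :
    f (conePt A u) = ∑ s, f (A s) * (u s + 1) := by
  rw [conePt, map_sum]
  refine Finset.sum_congr rfl fun s _ => ?_
  rw [map_nsmul, nsmul_eq_mul, mul_comm]
  push_cast
  rfl

lemma pos_conePt_iff {f : (ι → ℕ) →+ ℤ} {A : S → ι → ℕ} (h : ∀ s, 0 ≤ f (A s)) (u : S → ℕ) :
    0 < f (conePt A u) ↔ ∃ s, 0 < f (A s) := by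
  rw [map_conePt]
  constructor
  · intro h1
    by_contra! h2
    refine absurd h1 (not_lt.2 (Finset.sum_nonpos fun s _ => ?_))
    rw [le_antisymm (h2 s) (h s), zero_mul]
  · rintro ⟨s, hs⟩
    exact Finset.sum_pos' (fun t _ => mul_nonneg (h t) (by positivity))
      ⟨s, Finset.mem_univ s, mul_pos hs (by positivity)⟩

lemma SameSign.pos_iff {f : (ι → ℕ) →+ ℤ} {A : S → ι → ℕ} (h : SameSign f A) (u u' : S → ℕ) :
    0 < f (conePt A u) ↔ 0 < f (conePt A u') := by
  rcases h with h | h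
  · rw [pos_conePt_iff h, pos_conePt_iff h]
  · have h1 : ∀ u, ¬ 0 < f (conePt A u) := fun u => by
      rw [map_conePt, not_lt]
      exact Finset.sum_nonpos fun s _ => mul_nonpos_of_nonpos_of_nonneg (h s) (by positivity)
    simp [h1]

lemma SameSign.neg {f : (ι → ℕ) →+ ℤ} {A : S → ι → ℕ} (h : SameSign f A) : SameSign (-f) A :=
  h.elim (fun h => Or.inr fun s => by simpa using h s) fun h => Or.inl fun s => by simpa using h s

lemma SameSign.neg_iff {f : (ι → ℕ) →+ ℤ} {A : S → ι → ℕ} (h : SameSign f A) (u u' : S → ℕ) :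
    f (conePt A u) < 0 ↔ f (conePt A u') < 0 := by
  have := h.neg.pos_iff u u'
  simpa using this

variable [DecidableEq S]

/-- The family of vectors obtained by adding the vector with index `j` to that with index `i`. -/
def addCol (A : S → ι → ℕ) (i j : S) (s : S) : ι → ℕ := A s + if s = i then A j else 0

lemma conePt_addCol (A : S → ι → ℕ) (i j : S) (u : S → ℕ) :
    conePt (addCol A i j) u = conePt A fun s => u s + if s = j then u i + 1 else 0 := by
  simp only [conePt, addCol, smul_add, Finset.sum_add_distrib, add_right_comm _ _ 1,
    add_smul _ (ite _ _ _)]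
  simp

lemma conePt_addCol_subtype (A : S → ι → ℕ) {i j : S} (hij : i ≠ j) (u : {s // s ≠ j} → ℕ) :
    conePt (fun s => addCol A i j s.1) u =
      conePt A fun s => if h : s = j then u ⟨i, hij⟩ else u ⟨s, h⟩ := by
  have e : ∀ f : S → ι → ℕ, ∑ s, f s = f j + ∑ s : {s // s ≠ j}, f s := fun f =>
    Fintype.sum_eq_add_sum_subtype_ne f j
  rw [conePt, conePt, e, dif_pos rfl]
  simp only [addCol, smul_add, Finset.sum_add_distrib]
  rw [add_comm]
  congr 1
  · rw [Finset.sum_eq_single ⟨i, hij⟩]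
    · simp
    · rintro ⟨s, hs⟩ _ hsi
      rw [if_neg fun h => hsi (Subtype.ext h), smul_zero]
    · exact fun h => absurd (Finset.mem_univ _) h
  · exact Finset.sum_congr rfl fun s _ => by rw [dif_neg s.2]

lemma IsRegular.addCol {A : S → ι → ℕ} (h : IsRegular A) {i j : S} (hij : i ≠ j) :
    IsRegular (addCol A i j) where
  ne_zero s hs := h.ne_zero s (funext fun t => by
    have := congrFun hs t
    rw [MotivicMilnor.addCol, Pi.add_apply, Pi.zero_apply, Nat.add_eq_zero_iff] at this
    exact this.1)
  injective u u' huu := by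
    rw [conePt_addCol, conePt_addCol] at huu
    have h1 := fun s => congrFun (h.injective huu) s
    have h2 := h1 i
    rw [if_neg hij, if_neg hij] at h2
    simp only [add_zero] at h2
    refine funext fun s => ?_
    have h3 := h1 s
    rw [h2] at h3
    exact Nat.add_right_cancel h3

lemma IsRegular.addCol_subtype {A : S → ι → ℕ} (h : IsRegular A) {i j : S} (hij : i ≠ j) :
    IsRegular (fun s : {s // s ≠ j} => MotivicMilnor.addCol A i j s.1) where
  ne_zero s := (h.addCol hij).ne_zero s.1
  injective u u' huu := by
    rw [conePt_addCol_subtype A hij, conePt_addCol_subtype A hij] at huu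
    refine funext fun s => ?_
    have h1 := congrFun (h.injective huu) s.1
    rwa [dif_neg s.2, dif_neg s.2] at h1

/-- A cone is the disjoint union of the subsets where the coordinate `i` is smaller than, greater
than, or equal to the coordinate `j`. -/
lemma cone_subdivision {Φ : Set (ι → ℕ) → Prop}
    (hΦ : ∀ X Y, Φ X → Φ Y → Disjoint X Y → Φ (X ∪ Y)) {A : S → ι → ℕ} (h : IsRegular A) {i j : S}
    (hij : i ≠ j) (h1 : Φ (Set.range (conePt (addCol A i j))))
    (h2 : Φ (Set.range (conePt (addCol A j i))))
    (h3 : Φ (Set.range (conePt fun s : {s // s ≠ j} => addCol A i j s.1))) :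
    Φ (Set.range (conePt A)) := by
  have e1 : ∀ i j : S, i ≠ j →
      Set.range (conePt (addCol A i j)) = conePt A '' {u | u i < u j} := by
    intro i j hij
    ext k
    constructor
    · rintro ⟨u, rfl⟩
      rw [conePt_addCol]
      refine ⟨_, ?_, rfl⟩
      simp only [Set.mem_ofPred_eq, if_neg hij, if_true]
      omega
    · rintro ⟨u, hu, rfl⟩
      have hu' : u i < u j := hu
      refine ⟨fun s => u s - if s = j then u i + 1 else 0, ?_⟩
      rw [conePt_addCol]
      congr 1
      funext s
      rw [if_neg hij]
      split_ifs with hs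
      · subst hs
        omega
      · omega
  have e3 : Set.range (conePt fun s : {s // s ≠ j} => addCol A i j s.1) =
      conePt A '' {u | u i = u j} := by
    ext k
    constructor
    · rintro ⟨u, rfl⟩
      rw [conePt_addCol_subtype A hij]
      refine ⟨_, ?_, rfl⟩
      simp [hij]
    · rintro ⟨u, hu, rfl⟩
      refine ⟨fun s => u s.1, ?_⟩
      rw [conePt_addCol_subtype A hij]
      congr 1
      funext s
      split_ifs with hs
      · rw [hs]
        exact hu
      · rfl
  rw [e1 i j hij] at h1
  rw [e1 j i hij.symm] at h2
  rw [e3] at h3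
  have h4 := hΦ _ _ (hΦ _ _ h1 h2 ?_) h3 ?_
  · rw [← Set.image_union, ← Set.image_union] at h4
    rw [← Set.image_univ]
    convert h4
    ext u
    simp only [Set.mem_univ, Set.mem_union, Set.mem_ofPred_eq, true_iff]
    omega
  · rw [Set.disjoint_image_iff h.injective, Set.disjoint_left]
    intro u hu hu'
    simp only [Set.mem_ofPred_eq] at hu hu'
    omega
  · rw [← Set.image_union, Set.disjoint_image_iff h.injective, Set.disjoint_left]
    intro u hu hu'
    simp only [Set.mem_ofPred_eq, Set.mem_union] at hu hu'
    omega

/-- The pairs of vectors on which `f` has values of opposite sign with difference `M`. -/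
def mixedPairs (f : (ι → ℕ) →+ ℤ) (A : S → ι → ℕ) (M : ℕ) : Finset (S × S) :=
  Finset.univ.filter fun p => 0 < f (A p.1) ∧ f (A p.2) < 0 ∧ f (A p.1) - f (A p.2) = M

lemma mixedPairs_card_lt {S' : Type} [Fintype S'] [DecidableEq S'] {f : (ι → ℕ) →+ ℤ}
    {A : S → ι → ℕ} {A' : S' → ι → ℕ} {M : ℕ} (r : S' → S) (hr : Function.Injective r) {i j : S}
    (hij : (i, j) ∈ mixedPairs f A M)
    (h : ∀ s t, 0 < f (A' s) → f (A' t) < 0 → f (A' s) - f (A' t) = M →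
      f (A (r s)) = f (A' s) ∧ f (A (r t)) = f (A' t) ∧ (r s ≠ i ∨ r t ≠ j)) :
    (mixedPairs f A' M).card < (mixedPairs f A M).card := by
  rw [← Finset.card_image_of_injective (mixedPairs f A' M) (hr.prodMap hr)]
  refine Finset.card_lt_card ⟨fun p hp => ?_, fun hsub => ?_⟩
  · obtain ⟨⟨s, t⟩, hq, rfl⟩ := Finset.mem_image.1 hp
    obtain ⟨-, h1, h2, h3⟩ := Finset.mem_filter.1 hq
    obtain ⟨h4, h5, -⟩ := h s t h1 h2 h3
    refine Finset.mem_filter.2 ⟨Finset.mem_univ _, ?_⟩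
    simp only [Prod.map_apply, h4, h5]
    exact ⟨h1, h2, h3⟩
  · obtain ⟨⟨s, t⟩, hq, hst⟩ := Finset.mem_image.1 (hsub hij)
    obtain ⟨-, h1, h2, h3⟩ := Finset.mem_filter.1 hq
    obtain ⟨h4, h5⟩ := Prod.mk.inj hst
    exact (h s t h1 h2 h3).2.2.elim (fun h => h h4) fun h => h h5

lemma SameSign.addCol {f : (ι → ℕ) →+ ℤ} {A : S → ι → ℕ} (h : SameSign f A) (i j : S) :
    SameSign f (addCol A i j) := by
  have e : ∀ s, f (MotivicMilnor.addCol A i j s) = f (A s) + if s = i then f (A j) else 0 := by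
    intro s
    rw [MotivicMilnor.addCol, map_add]
    split_ifs
    · rfl
    · rw [map_zero]
  rcases h with h | h
  · refine Or.inl fun s => ?_
    rw [e]
    split_ifs
    · exact add_nonneg (h s) (h j)
    · simpa using h s
  · refine Or.inr fun s => ?_
    rw [e]
    split_ifs
    · exact add_nonpos (h s) (h j)
    · simpa using h s

/-- Every cone can be subdivided into cones on which one further linear form does not change its
sign, without losing this property for other linear forms. A pair of vectors on which the values of
the form have opposite signs and the largest difference is replaced until there is none. -/
lemma sameSign_induction_step {Φ : Set (ι → ℕ) → Prop}
    (hΦ : ∀ X Y, Φ X → Φ Y → Disjoint X Y → Φ (X ∪ Y)) (Λ : List ((ι → ℕ) →+ ℤ))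
    (f : (ι → ℕ) →+ ℤ) (h : ∀ (S : Type) [Fintype S] (A : S → ι → ℕ), IsRegular A →
      (∀ f' ∈ f :: Λ, SameSign f' A) → Φ (Set.range (conePt A))) :
    ∀ (S : Type) [Fintype S] (A : S → ι → ℕ), IsRegular A → (∀ f' ∈ Λ, SameSign f' A) →
      Φ (Set.range (conePt A)) := by
  classical
  -- induction on the largest difference `M` and on the number `c` of pairs where it is attained
  have key : ∀ M c : ℕ, ∀ (S : Type) [Fintype S] (A : S → ι → ℕ), IsRegular A →
      (∀ f' ∈ Λ, SameSign f' A) →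
      (∀ s t, 0 < f (A s) → f (A t) < 0 → f (A s) - f (A t) ≤ M) →
      (mixedPairs f A M).card ≤ c → Φ (Set.range (conePt A)) := by
    intro M
    induction M with
    | zero =>
      intro c S _ A hA hΛ hM _
      refine h S A hA fun f' hf' => ?_
      rcases List.mem_cons.1 hf' with rfl | hf'
      · by_contra hs
        simp only [SameSign, not_or, not_forall, not_le] at hs
        obtain ⟨⟨t, ht⟩, s, hs⟩ := hs
        have := hM s t hs ht
        push_cast at this
        omega
      · exact hΛ f' hf'
    | succ M ihM =>
      intro c
      induction c with
      | zero =>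
        intro S _ A hA hΛ hM hc
        refine ihM _ S A hA hΛ (fun s t hs ht => ?_) le_rfl
        have h1 := hM s t hs ht
        have h2 : (s, t) ∉ mixedPairs f A (M + 1) := by
          rw [Finset.card_eq_zero.1 (Nat.le_zero.1 hc)]
          exact Finset.notMem_empty _
        rw [mixedPairs, Finset.mem_filter] at h2
        have h3 : f (A s) - f (A t) ≠ ((M + 1 : ℕ) : ℤ) := fun h3 =>
          h2 ⟨Finset.mem_univ _, hs, ht, h3⟩
        push_cast at h1 h3
        omega
      | succ c ihc =>
        intro S _ A hA hΛ hM hc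
        rcases (mixedPairs f A (M + 1)).eq_empty_or_nonempty with h0 | ⟨⟨i, j⟩, hp⟩
        · exact ihc S A hA hΛ hM (by rw [h0]; simp)
        obtain ⟨-, hi, hj, hs⟩ := Finset.mem_filter.1 hp
        simp only at hi hj hs
        have hij : i ≠ j := fun hij => by
          rw [hij] at hi
          omega
        have e1 : ∀ s, f (addCol A i j s) = if s = i then f (A i) + f (A j) else f (A s) := by
          intro s
          rw [addCol, map_add]
          split_ifs with h
          · rw [h]
          · rw [map_zero, add_zero]
        have e2 : ∀ s, f (addCol A j i s) = if s = j then f (A j) + f (A i) else f (A s) := by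
          intro s
          rw [addCol, map_add]
          split_ifs with h
          · rw [h]
          · rw [map_zero, add_zero]
        refine cone_subdivision hΦ hA hij (ihc S _ (hA.addCol hij)
          (fun f' hf' => (hΛ f' hf').addCol i j) ?_ (Nat.lt_succ_iff.1 (lt_of_lt_of_le ?_ hc)))
          (ihc S _ (hA.addCol hij.symm) (fun f' hf' => (hΛ f' hf').addCol j i) ?_
            (Nat.lt_succ_iff.1 (lt_of_lt_of_le ?_ hc)))
          (ihc _ _ (hA.addCol_subtype hij) (fun f' hf' => ?_) ?_
            (Nat.lt_succ_iff.1 (lt_of_lt_of_le ?_ hc)))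
        · intro s t h1 h2
          have a1 := hM s t
          have a2 := hM i t
          have a3 := hM s j
          rw [e1] at h1 h2 ⊢
          rw [e1]
          split_ifs at h1 h2 ⊢ <;> push_cast at * <;> omega
        · refine mixedPairs_card_lt id Function.injective_id hp fun s t h1 h2 h3 => ?_
          have a1 := hM s t
          have a2 := hM i t
          have a3 := hM s j
          simp only [id]
          rw [e1] at h1 h2 h3 ⊢
          rw [e1] at h3 ⊢
          split_ifs at h1 h2 h3 ⊢ <;> push_cast at *
          all_goals first | omega | exact ⟨rfl, rfl, Or.inl ‹_›⟩
        · intro s t h1 h2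
          have a1 := hM s t
          have a2 := hM i t
          have a3 := hM s j
          rw [e2] at h1 h2 ⊢
          rw [e2]
          split_ifs at h1 h2 ⊢ <;> push_cast at * <;> omega
        · refine mixedPairs_card_lt id Function.injective_id hp fun s t h1 h2 h3 => ?_
          have a1 := hM s t
          have a2 := hM i t
          have a3 := hM s j
          simp only [id]
          rw [e2] at h1 h2 h3 ⊢
          rw [e2] at h3 ⊢
          split_ifs at h1 h2 h3 ⊢ <;> push_cast at *
          all_goals first | omega | exact ⟨rfl, rfl, Or.inr ‹_›⟩
        · exact ((hΛ f' hf').addCol i j).imp (fun h s => h s.1) fun h s => h s.1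
        · rintro ⟨s, hs'⟩ ⟨t, ht'⟩ h1 h2
          have a1 := hM s t
          have a2 := hM i t
          have a3 := hM s j
          simp only at h1 h2 ⊢
          rw [e1] at h1 h2 ⊢
          rw [e1]
          split_ifs at h1 h2 ⊢ <;> push_cast at * <;> omega
        · refine mixedPairs_card_lt Subtype.val Subtype.val_injective hp ?_
          rintro ⟨s, hs'⟩ ⟨t, ht'⟩ h1 h2 h3
          have a1 := hM s t
          have a2 := hM i t
          have a3 := hM s j
          simp only at h1 h2 h3 ⊢
          rw [e1] at h1 h2 h3 ⊢
          rw [e1] at h3 ⊢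
          split_ifs at h1 h2 h3 ⊢ <;> push_cast at *
          all_goals first | omega | exact ⟨rfl, rfl, Or.inr ht'⟩
  intro S _ A hA hΛ
  refine key (∑ s, (f (A s)).natAbs + ∑ s, (f (A s)).natAbs) _ S A hA hΛ (fun s t _ _ => ?_) le_rfl
  have h1 := Finset.single_le_sum (f := fun s => (f (A s)).natAbs) (fun _ _ => Nat.zero_le _)
    (Finset.mem_univ s)
  have h2 := Finset.single_le_sum (f := fun s => (f (A s)).natAbs) (fun _ _ => Nat.zero_le _)
    (Finset.mem_univ t)
  omega

/-- A property of sets of lattice points that is inherited by disjoint unions and holds for all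
cones on which the linear forms in `Λ` do not change their signs holds for all cones. -/
lemma sameSign_induction {Φ : Set (ι → ℕ) → Prop}
    (hΦ : ∀ X Y, Φ X → Φ Y → Disjoint X Y → Φ (X ∪ Y)) (Λ : List ((ι → ℕ) →+ ℤ))
    (h : ∀ (S : Type) [Fintype S] (A : S → ι → ℕ), IsRegular A →
      (∀ f ∈ Λ, SameSign f A) → Φ (Set.range (conePt A))) :
    ∀ (S : Type) [Fintype S] (A : S → ι → ℕ), IsRegular A → Φ (Set.range (conePt A)) := by
  induction Λ with
  | nil => exact fun S _ A hA => h S A hA fun f hf => absurd hf List.not_mem_nil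
  | cons f Λ ih => exact ih (sameSign_induction_step hΦ Λ f h)

/-- The space of all lattice points is the union of the open faces of the orthant. -/
lemma orthant_induction [Fintype ι] {Φ : Set (ι → ℕ) → Prop} (h0 : Φ ∅)
    (hΦ : ∀ X Y, Φ X → Φ Y → Disjoint X Y → Φ (X ∪ Y)) (Λ : List ((ι → ℕ) →+ ℤ))
    (h : ∀ (S : Type) [Fintype S] (A : S → ι → ℕ), IsRegular A →
      (∀ f ∈ Λ, SameSign f A) → Φ (Set.range (conePt A))) : Φ Set.univ := by
  classical
  have h1 : ∀ t : Finset ι, Φ {k | ∀ i, k i ≠ 0 ↔ i ∈ t} := by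
    intro t
    let A : {i // i ∈ t} → ι → ℕ := fun s => Pi.single s.1 1
    have e : ∀ u i, conePt A u i = if hi : i ∈ t then u ⟨i, hi⟩ + 1 else 0 := by
      intro u i
      rw [conePt, Finset.sum_apply]
      split_ifs with hi
      · rw [Finset.sum_eq_single ⟨i, hi⟩]
        · simp [A]
        · rintro ⟨s, hs⟩ _ hsi
          have : i ≠ s := fun h => hsi (Subtype.ext h.symm)
          simp [A, this]
        · exact fun h => absurd (Finset.mem_univ _) h
      · refine Finset.sum_eq_zero fun s _ => ?_
        have : i ≠ s.1 := fun h => hi (h ▸ s.2)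
        simp [A, this]
    have hA : IsRegular A := by
      refine ⟨fun s hs => ?_, fun u u' huu => funext fun s => ?_⟩
      · have := congrFun hs s.1
        simp [A] at this
      · have := congrFun huu s.1
        rw [e, e, dif_pos s.2, dif_pos s.2] at this
        exact Nat.succ_injective this
    convert sameSign_induction hΦ Λ h _ A hA using 1
    ext k
    constructor
    · intro hk
      refine ⟨fun s => k s.1 - 1, funext fun i => ?_⟩
      rw [e]
      split_ifs with hi
      · have := (hk i).2 hi
        simp only
        omega
      · by_contra h
        exact hi ((hk i).1 (Ne.symm h))
    · rintro ⟨u, rfl⟩ i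
      rw [e]
      split_ifs with hi <;> simp [hi]
  have h2 : ∀ T : Finset (Finset ι), Φ {k | ∃ t ∈ T, ∀ i, k i ≠ 0 ↔ i ∈ t} := by
    intro T
    induction T using Finset.induction_on with
    | empty => simpa using h0
    | insert t T ht ih =>
      convert hΦ _ _ (h1 t) ih ?_ using 1
      · ext k
        simp only [Finset.mem_insert, Set.mem_ofPred_eq, Set.mem_union, exists_eq_or_imp]
      · rw [Set.disjoint_left]
        rintro k hk ⟨t', ht', hk'⟩
        refine ht ?_
        convert ht'
        ext i
        rw [← hk, ← hk']
  have e : {k : ι → ℕ | ∃ t ∈ (Finset.univ : Finset (Finset ι)), ∀ i, k i ≠ 0 ↔ i ∈ t} =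
      Set.univ := by
    refine Set.eq_univ_of_forall fun k => ?_
    rw [Set.mem_ofPred_eq]
    exact ⟨Finset.univ.filter fun i => k i ≠ 0, Finset.mem_univ _, fun i => by simp⟩
  rw [← e]
  exact h2 _

end Cones

/-! ### Lattice points below a minimum of coordinates -/

section Region

variable {ι : Type} [Fintype ι]

/-- The sum over the lattice points `(k, a)` where `k` belongs to a set that is given by conditions
on the signs of linear forms, and `0 ≤ a < min k (y j)`, has limit zero. -/
lemma sumLim_region (Λ : List ((ι → ℕ) →+ ℤ)) (R : (ι → ℕ) → Prop)
    (hR : ∀ k k', (∀ f ∈ Λ, (0 < f k ↔ 0 < f k') ∧ (f k < 0 ↔ f k' < 0)) → R k → R k')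
    {Y : Type} [Finite Y] [Nonempty Y] (y : Y → ι)
    (hy : ∀ j j', ∃ f ∈ Λ, ∀ k, f k = (k (y j) : ℤ) - k (y j')) (E : (ι → ℕ) →+ ℤ)
    (L : (ι → ℕ) →+ ℕ) (hL : ∀ k, k ≠ 0 → 0 < L k) (c : ℤ) :
    SumLim {p : (ι → ℕ) × ℕ | R p.1 ∧ ∀ j, p.2 < p.1 (y j)} (fun p => E p.1 + c * p.2)
      (fun p => L p.1) 0 := by
  have key := orthant_induction (Φ := fun X => SumLim {p : (ι → ℕ) × ℕ | p.1 ∈ X ∧ R p.1 ∧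
    ∀ j, p.2 < p.1 (y j)} (fun p => E p.1 + c * p.2) (fun p => L p.1) 0) ?_ ?_ Λ ?_
  · simpa using key
  · simpa using SumLim.empty
  · intro X X' h h' hX
    have h1 := h.union h' (Set.disjoint_left.2 fun p hp hp' => Set.disjoint_left.1 hX hp.1 hp'.1)
    rw [add_zero] at h1
    convert h1 using 1
    ext p
    simp only [Set.mem_union, Set.mem_ofPred_eq, or_and_right]
  · intro S _ A hA hΛ
    have hsign : ∀ u u' f, f ∈ Λ → (0 < f (conePt A u) ↔ 0 < f (conePt A u')) ∧
        (f (conePt A u) < 0 ↔ f (conePt A u') < 0) :=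
      fun u u' f hf => ⟨(hΛ f hf).pos_iff u u', (hΛ f hf).neg_iff u u'⟩
    by_cases hR0 : R (conePt A 0)
    · -- on the cone, the minimum is always attained by the same coordinate `y j₀`, since `Λ`
      -- contains the differences of the coordinates
      obtain ⟨j₀, hj₀⟩ := Finite.exists_min fun j => conePt A 0 (y j)
      have hmin : ∀ u j, conePt A u (y j₀) ≤ conePt A u (y j) := by
        intro u j
        obtain ⟨f, hf, hfk⟩ := hy j j₀
        have h1 := (hsign u 0 f hf).2
        rw [hfk, hfk] at h1
        have h2 := hj₀ j
        omega
      have e : ∀ u, conePt A u (y j₀) = ∑ s, A s (y j₀) * (u s + 1) := fun u =>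
        map_conePt (Pi.evalAddMonoidHom (fun _ : ι => ℕ) (y j₀)) A u
      refine (SumLim.half_open S (fun s => L (A s)) (fun s => hL _ (hA.ne_zero s)) c _
        (fun s => E (A s)) (fun s => A s (y j₀)) rfl).of_bijOn (fun p => (conePt A p.1, p.2))
        ⟨?_, ?_, ?_⟩ ?_ ?_
      · rintro ⟨u, a⟩ hu
        rw [Set.mem_ofPred_eq, ← e] at hu
        exact ⟨⟨u, rfl⟩, hR _ _ (hsign 0 u) hR0, fun j => lt_of_lt_of_le hu (hmin u j)⟩
      · rintro ⟨u, a⟩ - ⟨u', a'⟩ - h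
        obtain ⟨h1, h2⟩ := Prod.mk.inj h
        exact Prod.ext (hA.injective h1) h2
      · rintro ⟨_, a⟩ ⟨⟨u, rfl⟩, -, h2⟩
        refine ⟨(u, a), ?_, rfl⟩
        rw [Set.mem_ofPred_eq, ← e]
        exact h2 j₀
      · rintro ⟨u, a⟩ -
        simp only [map_conePt E]
      · rintro ⟨u, a⟩ -
        simp only [map_conePt L]
        simp
    · convert SumLim.empty using 1
      ext ⟨k, a⟩
      simp only [Set.mem_ofPred_eq, Set.mem_empty_iff_false, iff_false]
      rintro ⟨⟨u, rfl⟩, h, -⟩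
      exact hR0 (hR _ _ (hsign u 0) h)

end Region

/-! ### The sum over the orders with a given initial form -/

section Orders

variable {k : Type u} [Field k] {d₁ d₂ d₃ : ℕ}

/-- The weights of the coordinates with respect to which `g` is invariant. -/
def dirWt : Fin d₁ ⊕ Fin d₂ ⊕ Fin d₃ → ℤ := Sum.elim 1 (Sum.elim (-1) 0)

/-- The linear form `κ ↦ lev κ α`. -/
def levHom {ι : Type} [Fintype ι] (α : ι →₀ ℕ) : (ι → ℕ) →+ ℕ where
  toFun κ := lev κ α
  map_zero' := by simp [lev]
  map_add' κ κ' := by simp [lev, add_mul, Finset.sum_add_distrib]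

/-- The linear form `κ ↦ κ i`. -/
def coordHom {ι : Type} (i : ι) : (ι → ℕ) →+ ℤ :=
  (Nat.castAddMonoidHom ℤ).comp (Pi.evalAddMonoidHom _ i)

lemma lev_pos {ι : Type} [Fintype ι] {α : ι →₀ ℕ} (hα : ∀ i, 0 < α i) {κ : ι → ℕ} (hκ : κ ≠ 0) :
    0 < lev κ α := by
  obtain ⟨i, hi⟩ := Function.ne_iff.1 hκ
  exact Finset.sum_pos' (fun _ _ => Nat.zero_le _)
    ⟨i, Finset.mem_univ i, Nat.mul_pos (Nat.pos_of_ne_zero hi) (hα i)⟩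

/-- The translation of a vector of orders by `a` times the direction `dirWt`. -/
def translate (p : (Fin d₁ ⊕ Fin d₂ ⊕ Fin d₃ → ℕ) × ℕ) : Fin d₁ ⊕ Fin d₂ ⊕ Fin d₃ → ℕ :=
  Sum.elim (fun i => p.1 (Sum.inl i) + p.2)
    (Sum.elim (fun j => p.1 (Sum.inr (Sum.inl j)) - p.2) fun l => p.1 (Sum.inr (Sum.inr l)))

lemma translate_eq {p : (Fin d₁ ⊕ Fin d₂ ⊕ Fin d₃ → ℕ) × ℕ}
    (hp : ∀ j, p.2 < p.1 (Sum.inr (Sum.inl j))) (i : Fin d₁ ⊕ Fin d₂ ⊕ Fin d₃) :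
    (translate p i : ℤ) = p.1 i + p.2 * dirWt i := by
  rcases i with i | j | l
  · simp [translate, dirWt]
  · have := hp j
    simp only [translate, dirWt, Sum.elim_inr, Sum.elim_inl, Pi.neg_apply, Pi.one_apply]
    omega
  · simp [translate, dirWt]

lemma lev_translate {p : (Fin d₁ ⊕ Fin d₂ ⊕ Fin d₃ → ℕ) × ℕ}
    (hp : ∀ j, p.2 < p.1 (Sum.inr (Sum.inl j))) {α : Fin d₁ ⊕ Fin d₂ ⊕ Fin d₃ →₀ ℕ}
    (hα : ∑ i, dirWt i * α i = 0) : lev (translate p) α = lev p.1 α := by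
  have h : (lev (translate p) α : ℤ) = lev p.1 α := by
    rw [← sum_mul_eq_lev, ← sum_mul_eq_lev]
    simp only [translate_eq hp, add_mul, Finset.sum_add_distrib, mul_assoc, ← Finset.mul_sum, hα,
      mul_zero, add_zero]
  exact_mod_cast h

/-- The set of the orders of the coordinates of arcs for which the initial form of `g` is the sum
of the terms with exponents in `P`. -/
def initOrders (g : MvPolynomial (Fin d₁ ⊕ Fin d₂ ⊕ Fin d₃) k)
    (P : Finset (Fin d₁ ⊕ Fin d₂ ⊕ Fin d₃ →₀ ℕ)) : Set (Fin d₁ ⊕ Fin d₂ ⊕ Fin d₃ → ℕ) :=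
  {κ | (∀ i ∈ vanishingCoords d₁ d₂ d₃, 0 < κ i) ∧ ∃ ℓ, IsInit g κ P ℓ}

lemma isInit_iff {ι : Type} [Fintype ι] {g : MvPolynomial ι k} {P : Finset (ι →₀ ℕ)}
    {α₀ : ι →₀ ℕ} (hP : P ⊆ g.support) (hα₀ : α₀ ∈ P) (κ : ι → ℕ) : (∃ ℓ, IsInit g κ P ℓ) ↔
      ∀ α ∈ g.support, lev κ α₀ ≤ lev κ α ∧ (lev κ α = lev κ α₀ ↔ α ∈ P) := by
  constructor
  · rintro ⟨ℓ, h⟩ α hα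
    have h0 : lev κ α₀ = ℓ := (h.iff α₀ (hP hα₀)).2 hα₀
    rw [h0]
    exact ⟨h.le α hα, h.iff α hα⟩
  · exact fun h => ⟨_, ⟨α₀, hα₀⟩, hP, fun α hα => (h α hα).1, fun α hα => (h α hα).2⟩

/-- The sum over all orders for which the initial form of `g` is given has limit zero: the fibres
of the projection along the direction `dirWt` are half-open intervals. -/
lemma sumLim_initOrders (hd₁ : 0 < d₁) (hd₂ : 0 < d₂)
    {g : MvPolynomial (Fin d₁ ⊕ Fin d₂ ⊕ Fin d₃) k}
    (hpos : ∀ α ∈ g.support, ∀ i, 0 < α i) (hwt : ∀ α ∈ g.support, ∑ i, dirWt i * α i = 0)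
    {P : Finset (Fin d₁ ⊕ Fin d₂ ⊕ Fin d₃ →₀ ℕ)} (hP : P ⊆ g.support)
    {α₀ : Fin d₁ ⊕ Fin d₂ ⊕ Fin d₃ →₀ ℕ} (hα₀ : α₀ ∈ P) :
    SumLim (initOrders g P) (fun κ => -∑ i, (κ i : ℤ)) (fun κ => lev κ α₀) 0 := by
  let _ : NeZero d₁ := ⟨hd₁.ne'⟩
  let _ : NeZero d₂ := ⟨hd₂.ne'⟩
  let x : Fin d₁ → Fin d₁ ⊕ Fin d₂ ⊕ Fin d₃ := Sum.inl
  let y : Fin d₂ → Fin d₁ ⊕ Fin d₂ ⊕ Fin d₃ := fun j => Sum.inr (Sum.inl j)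
  let z : Fin d₃ → Fin d₁ ⊕ Fin d₂ ⊕ Fin d₃ := fun j => Sum.inr (Sum.inr j)
  let Λ : List ((Fin d₁ ⊕ Fin d₂ ⊕ Fin d₃ → ℕ) →+ ℤ) :=
    (Finset.univ : Finset (Fin d₁ ⊕ Fin d₂ ⊕ Fin d₃)).toList.map coordHom ++
    (Finset.univ : Finset (Fin d₂ × Fin d₂)).toList.map
      (fun p => coordHom (y p.1) - coordHom (y p.2)) ++
    g.support.toList.map fun α => (Nat.castAddMonoidHom ℤ).comp (levHom α) -
      (Nat.castAddMonoidHom ℤ).comp (levHom α₀)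
  have hΛ1 : ∀ i, coordHom i ∈ Λ := fun i => by simp [Λ]
  have hΛ2 : ∀ j j', coordHom (y j) - coordHom (y j') ∈ Λ := fun j j' => by
    refine List.mem_append_left _ (List.mem_append_right _ (List.mem_map.2 ⟨(j, j'), ?_, rfl⟩))
    simp
  have hΛ3 : ∀ α ∈ g.support, (Nat.castAddMonoidHom ℤ).comp (levHom α) -
      (Nat.castAddMonoidHom ℤ).comp (levHom α₀) ∈ Λ := fun α hα =>
    List.mem_append_right _ (List.mem_map.2 ⟨α, Finset.mem_toList.2 hα, rfl⟩)
  -- Every vector of orders is `k + a • dirWt` for a unique `k` whose smallest `x`-coordinate is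
  -- zero and a unique `a ≥ 0`; the `y`-coordinates stay positive as long as `a < min k (y j)`.
  let E : (Fin d₁ ⊕ Fin d₂ ⊕ Fin d₃ → ℕ) →+ ℤ := -∑ i, coordHom i
  have hE : ∀ κ, E κ = -∑ i, (κ i : ℤ) := fun κ => by
    simp [E, coordHom]
  have h := sumLim_region Λ (fun κ => (∃ i, κ (x i) = 0) ∧ (∀ l, 0 < κ (z l)) ∧
    ∀ α ∈ g.support, lev κ α₀ ≤ lev κ α ∧ (lev κ α = lev κ α₀ ↔ α ∈ P)) ?_ y
    (fun j j' => ⟨_, hΛ2 j j', fun κ => rfl⟩) E (levHom α₀)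
    (fun κ hκ => lev_pos (hpos α₀ (hP hα₀)) hκ) (-∑ i : Fin d₁ ⊕ Fin d₂ ⊕ Fin d₃, dirWt i)
  · refine h.of_bijOn translate ⟨?_, ?_, ?_⟩ ?_ ?_
    · rintro p ⟨⟨-, h2, h3⟩, h4⟩
      refine ⟨?_, (isInit_iff hP hα₀ _).2 fun α hα => ?_⟩
      · rintro _ ⟨j | l, rfl⟩
        · exact Nat.sub_pos_of_lt (h4 j)
        · exact h2 l
      · rw [lev_translate h4 (hwt α hα), lev_translate h4 (hwt α₀ (hP hα₀))]
        exact h3 α hα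
    · rintro ⟨κ, a⟩ ⟨⟨⟨i, h1⟩, -, -⟩, h4⟩ ⟨κ', a'⟩ ⟨⟨⟨i', h1'⟩, -, -⟩, h4'⟩ hp
      have e1 : ∀ i, κ (x i) + a = κ' (x i) + a' := fun i => congrFun hp (x i)
      have e2 : ∀ i, κ (y i) - a = κ' (y i) - a' := fun i => congrFun hp (y i)
      have e3 : ∀ i, κ (z i) = κ' (z i) := fun i => congrFun hp (z i)
      have ha : a = a' := by
        have a1 := e1 i
        have a2 := e1 i'
        simp only at h1 h1'
        omega
      subst ha
      refine Prod.ext (funext fun i => ?_) rfl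
      rcases i with i | j | l
      · exact Nat.add_right_cancel (e1 i)
      · have a1 : a < κ (y j) := h4 j
        have a2 : a < κ' (y j) := h4' j
        have a3 := e2 j
        change κ (y j) = κ' (y j)
        omega
      · exact e3 l
    · rintro κ ⟨h1, h2⟩
      obtain ⟨i₀, hi₀⟩ := Finite.exists_min fun i => κ (x i)
      let p : (Fin d₁ ⊕ Fin d₂ ⊕ Fin d₃ → ℕ) × ℕ := (Sum.elim (fun i => κ (x i) - κ (x i₀))
        (Sum.elim (fun j => κ (y j) + κ (x i₀)) fun l => κ (z l)), κ (x i₀))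
      have e : translate p = κ := by
        funext i
        rcases i with i | j | l
        · exact Nat.sub_add_cancel (hi₀ i)
        · exact Nat.add_sub_cancel _ _
        · rfl
      have h4 : ∀ j, p.2 < p.1 (Sum.inr (Sum.inl j)) := fun j =>
        Nat.lt_add_of_pos_left (h1 _ ⟨Sum.inl j, rfl⟩)
      refine ⟨p, ⟨⟨⟨i₀, Nat.sub_self _⟩, fun l => h1 _ ⟨Sum.inr l, rfl⟩, fun α hα => ?_⟩, h4⟩, e⟩
      have h5 := (isInit_iff hP hα₀ κ).1 h2 α hα
      rwa [← e, lev_translate h4 (hwt α hα), lev_translate h4 (hwt α₀ (hP hα₀))] at h5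
    · rintro p ⟨-, h4⟩
      rw [hE]
      simp only [translate_eq h4, Finset.sum_add_distrib, ← Finset.mul_sum]
      ring
    · rintro p ⟨-, h4⟩
      exact lev_translate h4 (hwt α₀ (hP hα₀))
  · rintro κ κ' hs ⟨⟨i, h1⟩, h2, h3⟩
    have hc : ∀ i, 0 < κ i ↔ 0 < κ' i := fun i => by
      have := (hs _ (hΛ1 i)).1
      change (0 : ℤ) < (κ i : ℕ) ↔ (0 : ℤ) < (κ' i : ℕ) at this
      simpa using this
    refine ⟨⟨i, ?_⟩, fun l => (hc _).1 (h2 l), fun α hα => ?_⟩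
    · have := hc (x i)
      omega
    · have h4 := hs _ (hΛ3 α hα)
      change ((0 : ℤ) < (lev κ α : ℤ) - (lev κ α₀ : ℤ) ↔
        (0 : ℤ) < (lev κ' α : ℤ) - (lev κ' α₀ : ℤ)) ∧
        ((lev κ α : ℤ) - (lev κ α₀ : ℤ) < 0 ↔ (lev κ' α : ℤ) - (lev κ' α₀ : ℤ) < 0) at h4
      obtain ⟨h5, h6⟩ := h3 α hα
      refine ⟨by omega, ?_⟩
      rw [← h6]
      omega

end Orders

/-! ### Faces of the Newton polyhedron -/

section Faces

variable {k : Type u} [Field k] {ι : Type} [Fintype ι]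

/-- The linear form on `ℝ^ι` with coefficients `w`. -/
def dualPairing (w : ι → ℝ) : (ι → ℝ) →L[ℝ] ℝ :=
  ∑ i, w i • ContinuousLinearMap.proj (R := ℝ) (φ := fun _ : ι => ℝ) i

lemma dualPairing_apply (w v : ι → ℝ) : dualPairing w v = ∑ i, w i * v i := by
  simp [dualPairing]

lemma expVec_mem_newtonPolyhedron {g : MvPolynomial ι k} {α : ι →₀ ℕ} (hα : α ∈ g.support) :
    expVec α ∈ newtonPolyhedron g :=
  subset_convexHull ℝ _ ⟨α, hα, 0, fun _ => le_rfl, (add_zero _).symm⟩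

/-- The set of the points of the Newton polyhedron where a linear form with positive coefficients
is minimal is the convex hull of the exponents with this property. -/
lemma newtonPolyhedron_inter_eq {g : MvPolynomial ι k} {w : ι → ℝ} (hw : ∀ i, 0 < w i) {m : ℝ}
    {Q : Finset (ι →₀ ℕ)} (hQ : Q ⊆ g.support) (hm : ∀ α ∈ g.support, m ≤ dualPairing w (expVec α))
    (hmQ : ∀ α ∈ g.support, dualPairing w (expVec α) = m ↔ α ∈ Q) :
    (∀ v ∈ newtonPolyhedron g, m ≤ dualPairing w v) ∧
      {v ∈ newtonPolyhedron g | dualPairing w v = m} =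
        convexHull ℝ (expVec '' (Q : Set (ι →₀ ℕ))) := by
  have h1 : ∀ v ∈ convexHull ℝ (expVec '' (Q : Set (ι →₀ ℕ))), dualPairing w v = m := by
    refine fun v hv => convexHull_min (t := {v | dualPairing w v = m}) ?_ ?_ hv
    · rintro _ ⟨α, hα, rfl⟩
      exact (hmQ α (hQ hα)).2 hα
    · exact convex_hyperplane (dualPairing w).isLinear m
  have h2 : ∀ v ∈ newtonPolyhedron g, m < dualPairing w v ∨
      v ∈ convexHull ℝ (expVec '' (Q : Set (ι →₀ ℕ))) := by
    refine fun v hv => convexHull_min (t := {v | m < dualPairing w v ∨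
      v ∈ convexHull ℝ (expVec '' (Q : Set (ι →₀ ℕ)))}) ?_ ?_ hv
    · rintro _ ⟨α, hα, r, hr, rfl⟩
      have e : dualPairing w (expVec α + r) = dualPairing w (expVec α) + ∑ i, w i * r i := by
        rw [map_add, dualPairing_apply w r]
      have h3 := hm α hα
      have h4 : ∀ i ∈ Finset.univ, 0 ≤ w i * r i := fun i _ => mul_nonneg (hw i).le (hr i)
      rcases (Finset.sum_nonneg h4).eq_or_lt with h5 | h5
      · have h6 : r = 0 := funext fun i => by
          have := (Finset.sum_eq_zero_iff_of_nonneg h4).1 h5.symm i (Finset.mem_univ i)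
          exact (mul_eq_zero.1 this).resolve_left (hw i).ne'
        rw [h6, add_zero]
        by_cases h7 : α ∈ Q
        · exact Or.inr (subset_convexHull ℝ _ ⟨α, h7, rfl⟩)
        · exact Or.inl (lt_of_le_of_ne h3 fun h => h7 ((hmQ α hα).1 h.symm))
      · refine Or.inl ?_
        rw [e]
        linarith
    · intro a ha b hb s t hs ht hst
      have ha' : m ≤ dualPairing w a := ha.elim le_of_lt fun h => (h1 a h).ge
      have hb' : m ≤ dualPairing w b := hb.elim le_of_lt fun h => (h1 b h).ge
      have e : dualPairing w (s • a + t • b) = s * dualPairing w a + t * dualPairing w b := by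
        simp
      rcases hs.eq_or_lt with rfl | hs
      · rw [zero_add] at hst
        rwa [hst, zero_smul, one_smul, zero_add]
      rcases ht.eq_or_lt with rfl | ht
      · rw [add_zero] at hst
        rwa [hst, zero_smul, one_smul, add_zero]
      have hm' : m = s * m + t * m := by rw [← add_mul, hst, one_mul]
      rcases ha with ha | ha
      · refine Or.inl ?_
        rw [e, hm']
        exact add_lt_add_of_lt_of_le (mul_lt_mul_of_pos_left ha hs)
          (mul_le_mul_of_nonneg_left hb' ht.le)
      rcases hb with hb | hb
      · refine Or.inl ?_
        rw [e, hm']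
        exact add_lt_add_of_le_of_lt (mul_le_mul_of_nonneg_left ha' hs.le)
          (mul_lt_mul_of_pos_left hb ht)
      · exact Or.inr (convex_convexHull ℝ _ ha hb hs.le ht.le hst)
  refine ⟨fun v hv => (h2 v hv).elim le_of_lt fun h => (h1 v h).ge, ?_⟩
  ext v
  constructor
  · rintro ⟨hv, hv'⟩
    exact (h2 v hv).resolve_left fun h => h.ne' hv'
  · intro hv
    refine ⟨convexHull_min ?_ (convex_convexHull ℝ _) hv, h1 v hv⟩
    rintro _ ⟨α, hα, rfl⟩
    exact expVec_mem_newtonPolyhedron (hQ hα)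

variable {g : MvPolynomial ι k} {w : ι → ℝ} {m : ℝ} {Q : Finset (ι →₀ ℕ)}

lemma isCompactFace_of_weight (hw : ∀ i, 0 < w i) (hQ : Q ⊆ g.support) (hne : Q.Nonempty)
    (hm : ∀ α ∈ g.support, m ≤ dualPairing w (expVec α))
    (hmQ : ∀ α ∈ g.support, dualPairing w (expVec α) = m ↔ α ∈ Q) :
    IsCompactFace g {v ∈ newtonPolyhedron g | dualPairing w v = m} := by
  obtain ⟨h1, h2⟩ := newtonPolyhedron_inter_eq hw hQ hm hmQ
  obtain ⟨α, hα⟩ := hne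
  refine ⟨⟨expVec α, expVec_mem_newtonPolyhedron (hQ hα), (hmQ α (hQ hα)).2 hα⟩, fun _ => ?_, ?_⟩
  · refine ⟨-dualPairing w, ?_⟩
    ext v
    refine and_congr_right fun hv => ⟨fun h v' hv' => ?_, fun h => ?_⟩
    · rw [_root_.neg_apply, _root_.neg_apply, h]
      exact neg_le_neg (h1 v' hv')
    · have h3 := h (expVec α) (expVec_mem_newtonPolyhedron (hQ hα))
      rw [_root_.neg_apply, _root_.neg_apply, (hmQ α (hQ hα)).2 hα] at h3
      exact le_antisymm (neg_le_neg_iff.1 h3) (h1 v hv)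
  · rw [h2]
    exact ((Finset.finite_toSet Q).image _).isCompact_convexHull ℝ

lemma faceFunction_eq [DecidableEq ι] {γ : Set (ι → ℝ)} (hQ : Q ⊆ g.support)
    (h : ∀ α ∈ g.support, expVec α ∈ γ ↔ α ∈ Q) : faceFunction g γ = initForm g Q := by
  classical
  unfold faceFunction initForm
  congr 1
  ext α
  rw [Finset.mem_filter]
  exact ⟨fun h' => (h α h'.1).1 h'.2, fun h' => ⟨hQ h', (h α (hQ h')).2 h'⟩⟩

/-- If no vertex of the Newton polyhedron lies in a coordinate plane, no exponent does. -/
lemma NoVertexInCoordinatePlane.pos (hv : NoVertexInCoordinatePlane g) {α : ι →₀ ℕ}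
    (hα : α ∈ g.support) (i : ι) : 0 < α i := by
  classical
  by_contra h0
  have hi : α i = 0 := Nat.eq_zero_of_not_pos h0
  -- a weight for which every exponent `β` with `β i ≠ 0` has larger degree than `α`
  let C : ℝ := 1 + ∑ j, (α j : ℝ)
  have hC : 1 ≤ C := le_add_of_nonneg_right (Finset.sum_nonneg fun _ _ => Nat.cast_nonneg _)
  let w : ι → ℝ := fun j => if j = i then C else 1
  have hw : ∀ j, 0 < w j := fun j => by
    simp only [w]
    split_ifs
    · linarith
    · exact one_pos
  obtain ⟨β, hβ, hmin⟩ := Finset.exists_min_image g.support (fun β => dualPairing w (expVec β))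
    ⟨α, hα⟩
  let Q := g.support.filter fun β' => dualPairing w (expVec β') = dualPairing w (expVec β)
  have hQ : Q ⊆ g.support := Finset.filter_subset _ _
  have hmQ : ∀ β' ∈ g.support, dualPairing w (expVec β') = dualPairing w (expVec β) ↔ β' ∈ Q :=
    fun β' h => ⟨fun h' => Finset.mem_filter.2 ⟨h, h'⟩, fun h' => (Finset.mem_filter.1 h').2⟩
  have hQi : ∀ β' ∈ Q, β' i = 0 := by
    intro β' hβ'
    by_contra hne
    have h1 : dualPairing w (expVec β') ≤ dualPairing w (expVec α) := by
      rw [(Finset.mem_filter.1 hβ').2]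
      exact hmin α hα
    have h2 : dualPairing w (expVec α) = ∑ j, (α j : ℝ) := by
      rw [dualPairing_apply]
      refine Finset.sum_congr rfl fun j _ => ?_
      simp only [w, expVec]
      split_ifs with h
      · rw [h, hi]
        simp
      · rw [one_mul]
    have h3 : C ≤ dualPairing w (expVec β') := by
      rw [dualPairing_apply]
      have h4 : w i * expVec β' i ≤ ∑ j, w j * expVec β' j :=
        Finset.single_le_sum (f := fun j => w j * expVec β' j)
          (fun j _ => mul_nonneg (hw j).le (Nat.cast_nonneg _)) (Finset.mem_univ i)
      have h5 : (1 : ℝ) ≤ expVec β' i := by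
        simp only [expVec]
        exact_mod_cast Nat.one_le_iff_ne_zero.2 hne
      have h6 : w i = C := if_pos rfl
      rw [h6] at h4
      nlinarith
    rw [h2] at h1
    simp only [C] at h3
    linarith
  have hface := isCompactFace_of_weight hw hQ ⟨β, (hmQ β hβ).1 rfl⟩ hmin hmQ
  -- by the Krein–Milman theorem, the face on which `w` is minimal has a vertex
  obtain ⟨v, hve⟩ := hface.2.2.extremePoints_nonempty hface.1
  refine hv v (hface.2.1.isExtreme.extremePoints_subset_extremePoints hve) i ?_
  have hv1 := extremePoints_subset hve
  rw [(newtonPolyhedron_inter_eq hw hQ hmin hmQ).2] at hv1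
  refine convexHull_min (t := {v | (ContinuousLinearMap.proj (R := ℝ) (φ := fun _ : ι => ℝ) i) v
    = 0}) ?_ (convex_hyperplane (ContinuousLinearMap.proj (R := ℝ) (φ := fun _ : ι => ℝ) i).isLinear
      0) hv1
  rintro _ ⟨β', hβ', rfl⟩
  change ((β' i : ℕ) : ℝ) = 0
  rw [hQi β' hβ', Nat.cast_zero]

end Faces

section WeightZero

variable {k : Type u} [Field k] {d₁ d₂ d₃ : ℕ} {g : MvPolynomial (Fin d₁ ⊕ Fin d₂ ⊕ Fin d₃) k}

lemma IsWeightZero.sum_eq_zero [CharZero k] (hg : IsWeightZero g)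
    {α : Fin d₁ ⊕ Fin d₂ ⊕ Fin d₃ →₀ ℕ} (hα : α ∈ g.support) : ∑ i, dirWt i * α i = 0 := by
  have h2 : (2 : k) ≠ 0 := two_ne_zero
  -- it suffices to compare the coefficients for `t = 2`, which is not a root of unity
  let g' : MvPolynomial (Fin d₁ ⊕ Fin d₂ ⊕ Fin d₃) k :=
    ∑ β ∈ g.support, MvPolynomial.monomial β ((2 : k) ^ (∑ i, dirWt i * (β i : ℤ)) * g.coeff β)
  have e : g' = g := by
    refine MvPolynomial.funext fun x => ?_
    have h3 := hg (Units.mk0 2 h2) (fun i => x (Sum.inl i)) (fun i => x (Sum.inr (Sum.inl i)))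
      (fun i => x (Sum.inr (Sum.inr i)))
    have e1 : Sum.elim (fun i => x (Sum.inl i)) (Sum.elim (fun i => x (Sum.inr (Sum.inl i)))
        fun i => x (Sum.inr (Sum.inr i))) = x := by
      funext i
      rcases i with i | i | i <;> rfl
    have e2 : Sum.elim (fun i => ((Units.mk0 2 h2 : kˣ) : k) * x (Sum.inl i))
        (Sum.elim (fun i => (((Units.mk0 2 h2)⁻¹ : kˣ) : k) * x (Sum.inr (Sum.inl i)))
        fun i => x (Sum.inr (Sum.inr i))) = torus dirWt (Units.mk0 2 h2) x := by
      funext i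
      rcases i with i | i | i <;> simp [torus, dirWt]
    rw [e1, e2] at h3
    rw [← h3]
    conv_rhs => rw [MvPolynomial.as_sum g]
    rw [map_sum, map_sum]
    refine Finset.sum_congr rfl fun β _ => ?_
    have h4 := homog_monomial (k := k) dirWt β (g.coeff β) k (Units.mk0 2 h2) x
    rw [MvPolynomial.aeval_eq_eval, MvPolynomial.aeval_eq_eval] at h4
    rw [h4, MvPolynomial.eval_monomial, MvPolynomial.eval_monomial]
    simp [mul_assoc]
  have h5 : MvPolynomial.coeff α g' = (2 : k) ^ (∑ i, dirWt i * (α i : ℤ)) * g.coeff α := by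
    simp only [g', MvPolynomial.coeff_sum, MvPolynomial.coeff_monomial]
    rw [Finset.sum_ite_eq' g.support α, if_pos hα]
  rw [e] at h5
  have h6 : (2 : k) ^ (∑ i, dirWt i * (α i : ℤ)) = 1 :=
    (mul_eq_right₀ (MvPolynomial.mem_support_iff.1 hα)).1 h5.symm
  have h7 : ((2 : ℚ) ^ (∑ i, dirWt i * (α i : ℤ))) = 1 := by
    have : (((2 : ℚ) ^ (∑ i, dirWt i * (α i : ℤ)) : ℚ) : k) = ((1 : ℚ) : k) := by
      push_cast
      exact h6
    exact_mod_cast this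
  exact (zpow_eq_one_iff_right₀ (by norm_num) (by norm_num)).1 h7

/-- The initial forms of `g` are smooth on the torus. The weights `2 κ + dirWt` have the same
initial form as the weights `κ` and are positive. -/
lemma IsNondegenerate.isSmoothOnTorus (hnd : IsNondegenerate g)
    (hwt : ∀ α ∈ g.support, ∑ i, dirWt i * α i = 0) {κ : Fin d₁ ⊕ Fin d₂ ⊕ Fin d₃ → ℕ}
    (hκ : ∀ i ∈ vanishingCoords d₁ d₂ d₃, 0 < κ i) {P : Finset (Fin d₁ ⊕ Fin d₂ ⊕ Fin d₃ →₀ ℕ)}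
    {ℓ : ℕ} (h : IsInit g κ P ℓ) : IsSmoothOnTorus (initForm g P) := by
  let w : Fin d₁ ⊕ Fin d₂ ⊕ Fin d₃ → ℝ := fun i => ((2 * κ i + dirWt i : ℤ) : ℝ)
  have hw : ∀ i, 0 < w i := by
    intro i
    simp only [w, Int.cast_pos]
    rcases i with i | j | l
    · simp only [dirWt, Sum.elim_inl, Pi.one_apply]
      omega
    · have := hκ _ ⟨Sum.inl j, rfl⟩
      simp only [dirWt, Sum.elim_inr, Sum.elim_inl, Pi.neg_apply, Pi.one_apply]
      omega
    · have := hκ _ ⟨Sum.inr l, rfl⟩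
      simp only [dirWt, Sum.elim_inr, Pi.zero_apply]
      omega
  have e : ∀ α ∈ g.support, dualPairing w (expVec α) = ((2 * lev κ α : ℕ) : ℝ) := by
    intro α hα
    rw [dualPairing_apply]
    have h1 : ∑ i, (2 * κ i + dirWt i : ℤ) * α i = ((2 * lev κ α : ℕ) : ℤ) := by
      simp only [add_mul, Finset.sum_add_distrib, hwt α hα, mul_assoc, ← Finset.mul_sum,
        sum_mul_eq_lev]
      push_cast
      ring
    have h2 := congrArg (Int.cast (R := ℝ)) h1
    rw [Int.cast_sum] at h2
    rw [← Int.cast_natCast (R := ℝ), ← h2]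
    exact Finset.sum_congr rfl fun i _ => by simp [w, expVec]
  have hm : ∀ α ∈ g.support, ((2 * ℓ : ℕ) : ℝ) ≤ dualPairing w (expVec α) := fun α hα => by
    rw [e α hα, Nat.cast_le]
    exact Nat.mul_le_mul_left 2 (h.le α hα)
  have hmQ : ∀ α ∈ g.support, dualPairing w (expVec α) = ((2 * ℓ : ℕ) : ℝ) ↔ α ∈ P := fun α hα => by
    rw [e α hα, Nat.cast_inj, ← h.iff α hα]
    omega
  rw [← faceFunction_eq (γ := {v ∈ newtonPolyhedron g | dualPairing w v = (2 * ℓ : ℕ)}) h.subset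
    fun α hα => ⟨fun h' => (hmQ α hα).1 h'.2,
      fun h' => ⟨expVec_mem_newtonPolyhedron hα, (hmQ α hα).2 h'⟩⟩]
  exact hnd _ (isCompactFace_of_weight hw h.subset h.nonempty hm hmQ)

end WeightZero

/-! ### The integral of the motivic zeta function -/

section Zeta

variable {k : Type u} [Field k]

/-- An additive map that is compatible with the powers of `𝕃` is linear. -/
def Mot.toLinearMap {S S' : KSch k} (F : Mot S →+ Mot S')
    (hF : ∀ X e, F (Mot.cls X e) = (LaurentPolynomial.T e : ℤ[T;T⁻¹]) • F (Mot.cls X 0)) :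
    Mot S →ₗ[ℤ[T;T⁻¹]] Mot S' where
  toFun := F
  map_add' := map_add F
  map_smul' r x := by
    have hT : ∀ (n : ℤ) (x : Mot S), F ((LaurentPolynomial.T n : ℤ[T;T⁻¹]) • x) =
        (LaurentPolynomial.T n : ℤ[T;T⁻¹]) • F x := fun n x => by
      have h : F.comp (DistribSMul.toAddMonoidHom (Mot S) (LaurentPolynomial.T n : ℤ[T;T⁻¹])) =
          (DistribSMul.toAddMonoidHom (Mot S') (LaurentPolynomial.T n : ℤ[T;T⁻¹])).comp F := by
        refine Mot.hom_ext fun X e => ?_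
        change F ((LaurentPolynomial.T n : ℤ[T;T⁻¹]) • Mot.cls X e) =
          (LaurentPolynomial.T n : ℤ[T;T⁻¹]) • F (Mot.cls X e)
        rw [Mot.T_smul_cls, hF, hF X e, smul_smul, ← LaurentPolynomial.T_add, add_comm]
      exact DFunLike.congr_fun h x
    have hC : ∀ a : ℤ, (LaurentPolynomial.C a : ℤ[T;T⁻¹]) = (a : ℤ[T;T⁻¹]) := fun a =>
      map_intCast (LaurentPolynomial.C (R := ℤ)) a
    change F (r • x) = r • F x
    induction r using LaurentPolynomial.induction_on' with
    | add p q hp hq => rw [add_smul, add_smul, map_add, hp, hq]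
    | C_mul_T n a => rw [mul_smul, mul_smul, hC, Int.cast_smul_eq_zsmul ℤ[T;T⁻¹],
        Int.cast_smul_eq_zsmul ℤ[T;T⁻¹], map_zsmul, hT]

lemma intIncl_cls {d₁ d₂ d₃ : ℕ} (g : MvPolynomial (Fin d₁ ⊕ Fin d₂ ⊕ Fin d₃) k)
    (hg : restrictX g = 0) (X : GmVar (zeroLocus g)) (e : ℤ) :
    intIncl g hg (Mot.cls X e) =
      (LaurentPolynomial.T e : ℤ[T;T⁻¹]) • intIncl g hg (Mot.cls X 0) := by
  have h : ∀ e, intIncl g hg (Mot.cls X e) =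
      Mot.cls ((X.pullback (incl g hg)).pushforward (affSpaceStr k d₁)) e := fun e =>
    (congrArg (Mot.pushforward (affSpaceStr k d₁)) (Mot.pullback_cls (incl g hg) X e)).trans
      (Mot.pushforward_cls _ _ e)
  rw [h, h, ← Mot.cls_eq_smul]

lemma Mot.cls_eq_zero_of_isEmpty {S : KSch k} (X : GmVar S) (hX : IsEmpty X.X.left) (e : ℤ) :
    Mot.cls X e = 0 := by
  let i : X.Hom X := ⟨𝟙 _, rfl, fun a y => by rw [Category.comp_id, Category.comp_id],
    Category.id_comp _, Units.ext (pull_id _)⟩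
  have h := Mot.cls_scissor X X X i i (inferInstanceAs (IsClosedImmersion (𝟙 X.X.left)))
    (inferInstanceAs (IsOpenImmersion (𝟙 X.X.left))) (Set.eq_of_subset_of_subset
      (fun y => (hX.false y).elim) fun y => (hX.false y).elim) e
  rw [sub_self, zero_sub, neg_eq_zero] at h
  exact h

/-- The motivic zeta function of the zero polynomial is zero, since no arc has finite order. -/
lemma motivicZeta_zero {ι : Type} [Fintype ι] : motivicZeta (0 : MvPolynomial ι k) = 0 := by
  funext m
  rw [motivicZeta]
  split_ifs with hm
  · refine Mot.cls_eq_zero_of_isEmpty _ ?_ _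
    obtain ⟨u, hu⟩ := isUnit_jetMk_coeff (0 : MvPolynomial ι k) m
    have h1 : jetCoeff (0 : MvPolynomial ι k) m m = 0 := by
      rw [jetCoeff, map_zero, Polynomial.coeff_zero]
    have h2 : (u : JetRing (0 : MvPolynomial ι k) m) = 0 :=
      hu.trans ((congrArg (jetMk (0 : MvPolynomial ι k) m) h1).trans (map_zero _))
    have h3 : Subsingleton (JetRing (0 : MvPolynomial ι k) m) :=
      subsingleton_of_zero_eq_one (isUnit_zero_iff.1 ⟨u, h2⟩)
    change IsEmpty (PrimeSpectrum (JetRing (0 : MvPolynomial ι k) m))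
    infer_instance
  · rfl

lemma localMilnorFiber_zero {ι : Type} [Fintype ι] (h : MvPolynomial ι k)
    (h0 : MvPolynomial.eval 0 h = 0) (hh : h = 0) : localMilnorFiber h h0 = 0 := by
  subst hh
  rw [localMilnorFiber, milnorFiber, motivicZeta_zero, hasLimInfty_zero.limInfty_eq, neg_zero,
    map_zero]

variable {d₁ d₂ d₃ : ℕ} {g : MvPolynomial (Fin d₁ ⊕ Fin d₂ ⊕ Fin d₃) k}

lemma restrictZ_eq_zero (hd : 0 < d₁ + d₂) (hpos : ∀ α ∈ g.support, ∀ i, 0 < α i) :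
    restrictZ g = 0 := by
  rw [restrictZ, MvPolynomial.aeval_def, MvPolynomial.eval₂_eq']
  refine Finset.sum_eq_zero fun α hα => ?_
  have h : ∃ i : Fin d₁ ⊕ Fin d₂ ⊕ Fin d₃, Sum.elim (0 : Fin d₁ → MvPolynomial (Fin d₃) k)
      (Sum.elim 0 MvPolynomial.X) i = 0 := by
    rcases Nat.eq_zero_or_pos d₁ with h1 | h1
    · exact ⟨Sum.inr (Sum.inl ⟨0, by omega⟩), rfl⟩
    · exact ⟨Sum.inl ⟨0, h1⟩, rfl⟩
  obtain ⟨i, hi⟩ := h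
  rw [Finset.prod_eq_zero (Finset.mem_univ i), mul_zero]
  rw [hi, zero_pow (hpos α hα i).ne']

lemma le_lev {ι : Type} [Fintype ι] {α : ι →₀ ℕ} (hα : ∀ i, 0 < α i) (κ : ι → ℕ) (i : ι) :
    κ i ≤ lev κ α :=
  (Nat.le_mul_of_pos_right _ (hα i)).trans
    (Finset.single_le_sum (f := fun i => κ i * α i) (fun _ _ => Nat.zero_le _) (Finset.mem_univ i))

lemma exists_isInit {ι : Type} [Fintype ι] {g : MvPolynomial ι k} (hg : g ≠ 0) (κ : ι → ℕ) :
    ∃ P ℓ, IsInit g κ P ℓ := by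
  classical
  obtain ⟨α, hα, hmin⟩ := Finset.exists_min_image g.support (lev κ)
    (MvPolynomial.support_nonempty.2 hg)
  exact ⟨g.support.filter fun β => lev κ β = lev κ α, lev κ α, ⟨α, by simpa using hα⟩,
    Finset.filter_subset _ _, hmin, fun β hβ => by simp [MvPolynomial.mem_support_iff.1 hβ]⟩

lemma IsInit.unique {ι : Type} [Fintype ι] {g : MvPolynomial ι k} {κ : ι → ℕ}
    {P P' : Finset (ι →₀ ℕ)} {ℓ ℓ' : ℕ} (h : IsInit g κ P ℓ) (h' : IsInit g κ P' ℓ') : P = P' := by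
  obtain ⟨α, hα⟩ := h.nonempty
  obtain ⟨β, hβ⟩ := h'.nonempty
  have h1 : lev κ α = ℓ := (h.iff α (h.subset hα)).2 hα
  have h2 : lev κ β = ℓ' := (h'.iff β (h'.subset hβ)).2 hβ
  have h3 := h.le β (h'.subset hβ)
  have h4 := h'.le α (h.subset hα)
  have e : ℓ = ℓ' := by omega
  subst e
  ext γ
  exact ⟨fun hγ => (h'.iff γ (h.subset hγ)).1 ((h.iff γ (h.subset hγ)).2 hγ),
    fun hγ => (h.iff γ (h'.subset hγ)).1 ((h'.iff γ (h'.subset hγ)).2 hγ)⟩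

/-- If all exponents of `g` are positive, no arc with a vanishing coordinate occurs in the
integral of the motivic zeta function. -/
lemma cls_jetPres_eq_sum {ι : Type} [Fintype ι] [DecidableEq ι] {g : MvPolynomial ι k} {V : Set ι}
    (hpos : ∀ α ∈ g.support, ∀ i, 0 < α i) {m : ℕ} (hm : 0 < m) :
    (jetPres g V hm).cls =
      ∑ κ : ι → Fin (m + 1), ((jetPres g V hm).ordStratum Finset.univ κ).cls := by
  refine WPres.cls_eq_sum_ordStratum _ fun B _ _ x hx i hi => ?_
  have h1 : arc x i = 0 := Finset.sum_eq_zero fun j _ => by rw [hi, map_zero, zero_mul]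
  have h2 : MvPolynomial.aeval (arc x) g = 0 := by
    rw [MvPolynomial.aeval_def, MvPolynomial.eval₂_eq']
    refine Finset.sum_eq_zero fun α hα => ?_
    rw [Finset.prod_eq_zero (Finset.mem_univ i), mul_zero]
    rw [h1, zero_pow (hpos α hα i).ne']
  have h3 := (isPt_jetPres.1 hx).2.1
  rw [h2, Polynomial.coeff_zero] at h3
  exact subsingleton_of_zero_eq_one (isUnit_zero_iff.1 h3)

open Classical in
/-- The contribution of a stratum to the integral of the motivic zeta function: only the set `P` of
exponents of the initial form matters, apart from powers of `𝕃`. The exponent `α P` is any element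
of `P`. -/
lemma T_smul_cls_ordStratum (hd₁ : 0 < d₁) (hg : g ≠ 0) (hpos : ∀ α ∈ g.support, ∀ i, 0 < α i)
    (hwt : ∀ α ∈ g.support, ∑ i, dirWt i * α i = 0) (hnd : IsNondegenerate g) {N : ℕ}
    (e : Fin N ≃ Fin d₁ ⊕ Fin d₂ ⊕ Fin d₃)
    (α : Finset (Fin d₁ ⊕ Fin d₂ ⊕ Fin d₃ →₀ ℕ) → Fin d₁ ⊕ Fin d₂ ⊕ Fin d₃ →₀ ℕ)
    (hα : ∀ P, P.Nonempty → α P ∈ P) {m : ℕ} (hm : 0 < m)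
    (κ : Fin d₁ ⊕ Fin d₂ ⊕ Fin d₃ → Fin (m + 1)) :
    (LaurentPolynomial.T (-((m : ℤ) * Fintype.card (Fin d₁ ⊕ Fin d₂ ⊕ Fin d₃))) : ℤ[T;T⁻¹]) •
      ((jetPres g (vanishingCoords d₁ d₂ d₃) hm).ordStratum Finset.univ κ).cls =
    ∑ P ∈ g.support.powerset with P.Nonempty,
      ((if (fun i => (κ i : ℕ)) ∈ initOrders g P ∧ lev (fun i => κ i) (α P) = m then
        (LaurentPolynomial.T (-∑ i, ((κ i : ℕ) : ℤ)) : ℤ[T;T⁻¹]) • clsA g P else 0) +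
      if (fun i => (κ i : ℕ)) ∈ initOrders g P ∧ lev (fun i => κ i) (α P) < m then
        (LaurentPolynomial.T (-∑ i, ((κ i : ℕ) : ℤ) - (m - lev (fun i => κ i) (α P) : ℕ)) :
          ℤ[T;T⁻¹]) • clsB g P e else 0) := by
  have esum : ∑ i, ((m : ℤ) - (κ i : ℕ)) =
      m * Fintype.card (Fin d₁ ⊕ Fin d₂ ⊕ Fin d₃) - ∑ i, ((κ i : ℕ) : ℤ) := by
    rw [Finset.sum_sub_distrib, Finset.sum_const, Finset.card_univ, nsmul_eq_mul, mul_comm]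
  by_cases hV : ∀ i ∈ vanishingCoords d₁ d₂ d₃, 0 < κ i
  · have hV' : ∀ i ∈ vanishingCoords d₁ d₂ d₃, 0 < (κ i : ℕ) := hV
    obtain ⟨P, ℓ, h⟩ := exists_isInit hg fun i => (κ i : ℕ)
    have hmem : (fun i => (κ i : ℕ)) ∈ initOrders g P := ⟨hV', ℓ, h⟩
    have hPα := hα P h.nonempty
    have hlev : lev (fun i => (κ i : ℕ)) (α P) = ℓ := (h.iff _ (h.subset hPα)).2 hPα
    have hP : ∀ β ∈ P, lev (fun i => (κ i : ℕ)) β = ℓ := fun β hβ => (h.iff β (h.subset hβ)).2 hβ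
    have ho : dirWt (Sum.inl ⟨0, hd₁⟩ : Fin d₁ ⊕ Fin d₂ ⊕ Fin d₃) = 1 := rfl
    have hv : ∀ β ∈ P, ∑ i, dirWt i * β i = 0 := fun β hβ => hwt β (h.subset hβ)
    rw [Finset.sum_eq_single P]
    · simp only [hmem, hlev, true_and]
      rcases lt_trichotomy ℓ m with hℓ | rfl | hℓ
      · rw [if_neg hℓ.ne, if_pos hℓ, zero_add, cls_ordStratum_eq_sum h hℓ hV
          (fun i => (le_lev (hpos _ (h.subset hPα)) (fun i => (κ i : ℕ)) i).trans hlev.le) e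
          (hnd.isSmoothOnTorus hwt hV' h), clsB_eq hm hP e ho hv, smul_smul,
          ← LaurentPolynomial.T_add, esum]
        congr 2
        ring
      · rw [if_pos rfl, if_neg (lt_irrefl _), add_zero, cls_ordStratum_eq h hV, clsA_eq hm hP ho hv,
          smul_smul, ← LaurentPolynomial.T_add, esum]
        congr 2
        ring
      · rw [if_neg hℓ.ne', if_neg hℓ.not_gt, cls_ordStratum_of_lt h.le hℓ hV, smul_zero, add_zero]
    · intro P' _ hP'
      have h1 : (fun i => (κ i : ℕ)) ∉ initOrders g P' := fun h1 => hP' (h1.2.choose_spec.unique h)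
      simp [h1]
    · intro h1
      exact absurd (Finset.mem_filter.2 ⟨Finset.mem_powerset.2 h.subset, h.nonempty⟩) h1
  · push Not at hV
    obtain ⟨i, hi, hκ⟩ := hV
    have hκ0 : κ i = 0 := le_antisymm hκ (Fin.zero_le _)
    rw [cls_ordStratum_of_order_zero i hi hκ0, smul_zero]
    symm
    refine Finset.sum_eq_zero fun P _ => ?_
    have h1 : (fun i => (κ i : ℕ)) ∉ initOrders g P := fun h1 => by
      have := h1.1 i hi
      simp [hκ0] at this
    simp [h1]

/-- The sum over the strata on which the order of `g` is the generic one. -/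
lemma sum_orders_eq {M : Type*} [AddCommGroup M] [Module ℤ[T;T⁻¹] M] {ι : Type} [Fintype ι]
    [DecidableEq ι] {D : Set (ι → ℕ)} {α : ι →₀ ℕ} (hα : ∀ i, 0 < α i) {Z : ℕ → ℤ[T;T⁻¹]}
    (hZ : IsGenSeries D (fun κ => -∑ i, (κ i : ℤ)) (fun κ => lev κ α) Z) (m : ℕ) (A : M)
    [DecidablePred fun κ : ι → Fin (m + 1) => (fun i => (κ i : ℕ)) ∈ D ∧
      lev (fun i => κ i) α = m] :
    ∑ κ : ι → Fin (m + 1), (if (fun i => (κ i : ℕ)) ∈ D ∧ lev (fun i => κ i) α = m then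
      (LaurentPolynomial.T (-∑ i, ((κ i : ℕ) : ℤ)) : ℤ[T;T⁻¹]) • A else 0) = Z m • A := by
  obtain ⟨F, hF, e⟩ := hZ m
  rw [e, Finset.sum_smul, ← Finset.sum_filter]
  refine Finset.sum_nbij (fun κ i => (κ i : ℕ)) ?_ ?_ ?_ fun _ _ => rfl
  · intro κ hκ
    exact (hF _).2 (Finset.mem_filter.1 hκ).2
  · intro κ _ κ' _ h
    exact funext fun i => Fin.ext (congrFun h i)
  · intro κ hκ
    have h1 := (hF κ).1 hκ
    have h2 : ∀ i, κ i < m + 1 := fun i => Nat.lt_succ_of_le (h1.2 ▸ le_lev hα κ i)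
    exact ⟨fun i => ⟨κ i, h2 i⟩,
      Finset.mem_coe.2 (Finset.mem_filter.2 ⟨Finset.mem_univ _, h1⟩), rfl⟩

/-- The sum over the strata on which the order of `g` is greater than the generic one. -/
lemma sum_orders_lt {M : Type*} [AddCommGroup M] [Module ℤ[T;T⁻¹] M] {ι : Type} [Fintype ι]
    [DecidableEq ι] {D : Set (ι → ℕ)} {α : ι →₀ ℕ} (hα : ∀ i, 0 < α i) {Z : ℕ → ℤ[T;T⁻¹]}
    (hZ : IsGenSeries (D ×ˢ (Set.univ : Set ℕ)) (fun p => -∑ i, (p.1 i : ℤ) + -1 * (p.2 + 1))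
      (fun p => lev p.1 α + 1 * (p.2 + 1)) Z) (m : ℕ) (A : M)
    [DecidablePred fun κ : ι → Fin (m + 1) => (fun i => (κ i : ℕ)) ∈ D ∧
      lev (fun i => κ i) α < m] :
    ∑ κ : ι → Fin (m + 1), (if (fun i => (κ i : ℕ)) ∈ D ∧ lev (fun i => κ i) α < m then
      (LaurentPolynomial.T (-∑ i, ((κ i : ℕ) : ℤ) - (m - lev (fun i => κ i) α : ℕ)) : ℤ[T;T⁻¹]) • A
      else 0) = Z m • A := by
  obtain ⟨F, hF, e⟩ := hZ m
  rw [e, Finset.sum_smul, ← Finset.sum_filter]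
  refine Finset.sum_nbij (fun κ => (fun i => (κ i : ℕ), m - lev (fun i => (κ i : ℕ)) α - 1))
    ?_ ?_ ?_ ?_
  · intro κ hκ
    obtain ⟨-, h1, h2⟩ := Finset.mem_filter.1 hκ
    exact (hF _).2 ⟨⟨h1, trivial⟩, by simp only; omega⟩
  · intro κ _ κ' _ h
    exact funext fun i => Fin.ext (congrFun (Prod.mk.inj h).1 i)
  · rintro ⟨κ, n⟩ hκ
    obtain ⟨⟨h1, -⟩, h3⟩ := (hF _).1 hκ
    have h3' : lev κ α + 1 * (n + 1) = m := h3
    have h2 : ∀ i, κ i < m + 1 := fun i => by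
      have := le_lev hα κ i
      omega
    refine ⟨fun i => ⟨κ i, h2 i⟩,
      Finset.mem_coe.2 (Finset.mem_filter.2 ⟨Finset.mem_univ _, h1, ?_⟩),
      Prod.ext rfl ?_⟩
    · change lev κ α < m
      omega
    · change m - lev κ α - 1 = n
      omega
  · intro κ hκ
    obtain ⟨-, h1, h2⟩ := Finset.mem_filter.1 hκ
    congr 2
    simp only
    omega

/-- The integral of the motivic zeta function has the limit zero. -/
lemma hasLimInfty_intIncl [CharZero k] (hd : 0 < d₁ + d₂) (hg : IsWeightZero g)
    (hnd : IsNondegenerate g) (hpos : ∀ α ∈ g.support, ∀ i, 0 < α i) (hX : restrictX g = 0) :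
    HasLimInfty (fun m => intIncl g hX (motivicZeta g m)) 0 := by
  classical
  by_cases hg0 : g = 0
  · subst hg0
    simp only [motivicZeta_zero, Pi.zero_apply, map_zero]
    exact hasLimInfty_zero
  have hwt : ∀ α ∈ g.support, ∑ i, dirWt i * α i = 0 := fun α hα => hg.sum_eq_zero hα
  -- an exponent of weight zero without vanishing entries involves both `x` and `y`
  have hd' : 0 < d₁ ∧ 0 < d₂ := by
    obtain ⟨α, hα⟩ := MvPolynomial.support_nonempty.2 hg0
    have h1 := hwt α hα
    rw [Fintype.sum_sum_type, Fintype.sum_sum_type] at h1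
    simp only [dirWt, Sum.elim_inl, Sum.elim_inr, Pi.one_apply, Pi.neg_apply, Pi.zero_apply,
      one_mul, neg_mul, zero_mul, Finset.sum_const_zero, add_zero, Finset.sum_neg_distrib] at h1
    have hsum : ∀ {d : ℕ} (f : Fin d → Fin d₁ ⊕ Fin d₂ ⊕ Fin d₃), 0 < d →
        (0 : ℤ) < ∑ i, (α (f i) : ℤ) := fun {d} f hd =>
      Finset.sum_pos (fun i _ => by exact_mod_cast hpos α hα (f i)) ⟨⟨0, hd⟩, Finset.mem_univ _⟩
    by_contra hcon
    rcases Nat.eq_zero_or_pos d₁ with h2 | h2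
    · subst h2
      have := hsum (fun j => Sum.inr (Sum.inl j)) (show 0 < d₂ by omega)
      simp only [Finset.univ_eq_empty, Finset.sum_empty] at h1
      omega
    · have h3 : d₂ = 0 := by omega
      subst h3
      have := hsum (fun j => Sum.inl j) h2
      simp only [Finset.univ_eq_empty, Finset.sum_empty] at h1
      omega
  obtain ⟨hd₁, hd₂⟩ := hd'
  let e : Fin (Fintype.card (Fin d₁ ⊕ Fin d₂ ⊕ Fin d₃)) ≃ Fin d₁ ⊕ Fin d₂ ⊕ Fin d₃ :=
    (Fintype.equivFin _).symm
  let α : Finset (Fin d₁ ⊕ Fin d₂ ⊕ Fin d₃ →₀ ℕ) → Fin d₁ ⊕ Fin d₂ ⊕ Fin d₃ →₀ ℕ :=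
    fun P => if h : P.Nonempty then h.choose else 0
  have hα : ∀ P, P.Nonempty → α P ∈ P := fun P h => by
    simp only [α, dif_pos h]
    exact h.choose_spec
  let I := g.support.powerset.filter Finset.Nonempty
  have hI : ∀ P ∈ I, α P ∈ P ∧ P ⊆ g.support := fun P hP =>
    ⟨hα P (Finset.mem_filter.1 hP).2, Finset.mem_powerset.1 (Finset.mem_filter.1 hP).1⟩
  have hA : ∀ P ∈ I, SumLim (initOrders g P) (fun κ => -∑ i, (κ i : ℤ)) (fun κ => lev κ (α P)) 0 :=
    fun P hP => sumLim_initOrders hd₁ hd₂ hpos hwt (hI P hP).2 (hI P hP).1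
  have hB := fun P hP => (hA P hP).prod_pos (-1) one_pos
  choose! ZA hZA hlA using hA
  choose! ZB hZB hlB using hB
  have hne : ∀ P ∈ I, ∀ κ ∈ initOrders g P, 0 < lev κ (α P) := fun P hP κ hκ =>
    lev_pos (hpos _ ((hI P hP).2 (hI P hP).1)) fun h0 => by
      have := hκ.1 (Sum.inr (Sum.inl ⟨0, hd₂⟩)) ⟨_, rfl⟩
      simp [h0] at this
  have key : (fun m => intIncl g hX (motivicZeta g m)) =
      ∑ P ∈ I, ((fun m => ZA P m • clsA g P) + fun m => ZB P m • clsB g P e) := by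
    funext m
    rw [Finset.sum_apply]
    rcases Nat.eq_zero_or_pos m with rfl | hm
    · rw [motivicZeta, dif_neg (lt_irrefl 0), map_zero]
      symm
      refine Finset.sum_eq_zero fun P hP => ?_
      obtain ⟨F, hF, e1⟩ := hZA P hP 0
      obtain ⟨F', hF', e2⟩ := hZB P hP 0
      have h1 : F = ∅ := Finset.eq_empty_of_forall_notMem fun κ hκ =>
        (hne P hP κ ((hF κ).1 hκ).1).ne' ((hF κ).1 hκ).2
      have h2 : F' = ∅ := Finset.eq_empty_of_forall_notMem fun p hp => by
        have h3 : lev p.1 (α P) + 1 * (p.2 + 1) = 0 := ((hF' p).1 hp).2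
        omega
      rw [Pi.add_apply, e1, e2, h1, h2, Finset.sum_empty, Finset.sum_empty, zero_smul, zero_smul,
        add_zero]
    · rw [motivicZeta, dif_pos hm, intIncl_cls, intIncl_jetVar, cls_jetPres_eq_sum hpos hm,
        Finset.smul_sum]
      simp only [T_smul_cls_ordStratum hd₁ hg0 hpos hwt hnd e α hα hm]
      rw [Finset.sum_comm]
      refine Finset.sum_congr rfl fun P hP => ?_
      have hp := hpos _ ((hI P hP).2 (hI P hP).1)
      rw [Finset.sum_add_distrib, sum_orders_eq hp (hZA P hP), sum_orders_lt hp (hZB P hP)]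
      rfl
  have hlim : ∀ P ∈ I,
      HasLimInfty ((fun m => ZA P m • clsA g P) + fun m => ZB P m • clsB g P e) 0 := by
    intro P hP
    have h1 := (hlA P hP).map (LinearMap.toSpanSingleton ℤ[T;T⁻¹] _ (clsA g P))
    have h2 := (hlB P hP).map (LinearMap.toSpanSingleton ℤ[T;T⁻¹] _ (clsB g P e))
    have h3 := h1.add h2
    rw [map_zero, neg_zero, map_zero, add_zero] at h3
    exact h3
  rw [key]
  have h := hasLimInfty_sum I hlim
  rwa [Finset.sum_const_zero] at h

/-- If `Z` has a limit, its image under `f` is the limit of `f Z`, hence zero; if not, `limInfty Z`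
is zero by convention. That the motivic zeta function always has a limit is a theorem of Denef and
Loeser, which relies on resolution of singularities and is not needed here. -/
lemma map_limInfty_eq_zero {M M' : Type*} [AddCommGroup M] [Module ℤ[T;T⁻¹] M] [AddCommGroup M']
    [Module ℤ[T;T⁻¹] M'] (f : M →ₗ[ℤ[T;T⁻¹]] M') {Z : ℕ → M}
    (h : HasLimInfty (fun m => f (Z m)) 0) : f (limInfty Z) = 0 := by
  by_cases hZ : ∃ c, HasLimInfty Z c
  · obtain ⟨c, hc⟩ := hZ
    rw [hc.limInfty_eq]
    exact (hc.map f).unique h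
  · rw [limInfty, dif_neg hZ, map_zero]

end Zeta

end MotivicMilnor

end

theorem proposition5p4 {k : Type*} [Field k] [CharZero k] (d₁ d₂ d₃ : ℕ) (hd : 0 < d₁ + d₂)
    (g : MvPolynomial (Fin d₁ ⊕ Fin d₂ ⊕ Fin d₃) k)
    (h0 : MvPolynomial.eval 0 g = 0)
    (hg : IsWeightZero g)
    (hnd : IsNondegenerate g)
    (hvert : NoVertexInCoordinatePlane g) :
    HasLimInfty (fun m => intIncl g (restrictX_eq_zero g h0 hg) (motivicZeta g m)) 0 ∧
    intIncl g (restrictX_eq_zero g h0 hg) (milnorFiber g) = 0 ∧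
    restrictZ g = 0 ∧
    intIncl g (restrictX_eq_zero g h0 hg) (milnorFiber g) =
      (LaurentPolynomial.T (d₁ : ℤ) : LaurentPolynomial ℤ) •
        localMilnorFiber (restrictZ g) (eval_zero_restrictZ g h0) := by
  have hpos : ∀ α ∈ g.support, ∀ i, 0 < α i := fun α hα i => hvert.pos hα i
  have hlim := hasLimInfty_intIncl hd hg hnd hpos (restrictX_eq_zero g h0 hg)
  have hmil : intIncl g (restrictX_eq_zero g h0 hg) (milnorFiber g) = 0 := by
    rw [milnorFiber, map_neg, neg_eq_zero]
    exact map_limInfty_eq_zero (Mot.toLinearMap _ (intIncl_cls g _)) hlim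
  have hZ := restrictZ_eq_zero hd hpos
  exact ⟨hlim, hmil, hZ, by rw [hmil, localMilnorFiber_zero _ _ hZ, smul_zero]⟩
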